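/- Let $N\ge 1$, let $\Delta$ be a fundamental discriminant ($\Delta=1$ allowed) and let $r\in\mathbb Z$ with $\Delta\equiv r^2 \pmod{4N}$. On traceless real $2\times2$ matrices put $Q(\lambda)=N\det\lambda$, $(\lambda,\mu)=-N\,\mathrm{tr}(\lambda\mu)$, and $Q_\Delta=Q/|\Delta|$. Let $$L=\Big\{\begin{pmatrix} b&-a/N\\ c&-b\end{pmatrix}: a,b,c\in\mathbb Z\Big\},\qquad L'=\Big\{\begin{pmatrix} b/2N&-a/N\\ c&-b/2N\end{pmatrix}: a,b,c\in\mathbb Z\Big\}.$$ For $\delta\in L'/\Delta L$ represented by $(a,b,c)$ let $\chi_\Delta(\delta)=\left(\frac{\Delta}{n}\right)$ if $\Delta\mid b^2-4Nac$, $(b^2-4Nac)/\Delta$ is a square modulo $4N$ and $\gcd(a,b,c,\Delta)=1$, where $n$ is any integer prime to $\Delta$ represented by one of the forms $[N_1a,b,N_2c]$ with $N_1N_2=N$, $N_1,N_2>0$; otherwise let $\chi_\Delta(\delta)=0$. Let $\pi:L'/\Delta L\to L'/L$ be the projection. For $z=x+iy$ in the upper half plane $\mathbb H$ put $\lambda(z)=\frac{1}{\sqrt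 N y}\begin{pmatrix}-x&|z|^2\\-1&x\end{pmatrix}$, $(\lambda,\lambda)_z=(\lambda,\lambda(z))^2-(\lambda,\lambda)$, $R(\lambda,z)=\frac12(\lambda,\lambda(z))^2-(\lambda,\lambda)$, and for $\tau=u+iv\in\mathbb H$ $$\varphi(\lambda,\tau,z)=e^{2\pi iQ_\Delta(\lambda)\tau}\Big(\tfrac{v}{|\Delta|}(\lambda,\lambda(z))^2-\tfrac1{2\pi}\Big)e^{-2\pi vR(\lambda,z)/|\Delta|},\qquad \varphi_{2,1}(\lambda,\tau,z)=v^{1/2}e^{\frac{\pi i}{|\Delta|}(-u(\lambda,\lambda)+iv(\lambda,\lambda)_z)}.$$ For $\phi\in\{\varphi,\varphi_{2,1}\}$ and $h\in L'/L$ let $$\Theta_{\Delta,r,h}(\tau,z,\phi)=\sum_{\substack{\delta\in L'/\Delta L,\ \pi(\delta)=rh\\ Q_\Delta(\delta)\equiv\mathrm{sgn}(\Delta)Q(h)\ (\mathbb Z)}}\chi_\Delta(\delta)\sum_{\lambda\in\Delta L+\delta}\phi(\lambda,\tau,z).$$ The twisted Kudla–Millson lift $I_\Delta(\tau,f)$ and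 the twisted Maass lift $I^M_\Delta(\tau,f)$ of a $\Gamma_0(N)$-invariant function $f$ on $\mathbb H$ are the $\mathbb C[L'/L]$-valued functions with components $$\int_{\Gamma_0(N)\backslash\mathbb H} f(z)\,\Theta_{\Delta,r,h}(\tau,z,\phi)\,\frac{dx\,dy}{y^2},\qquad \phi=\varphi\ \text{ and }\ \phi=\varphi_{2,1}\ \text{ respectively.}$$ Put $\xi_kF=2iv^k\,\overline{\partial F/\partial\bar\tau}$, applied componentwise, and $\Omega=y^2(\partial_x^2+\partial_y^2)$. **Theorem.** Let $f$ be a Maass cusp form of weight $0$ for $\Gamma_0(N)$ with $\Omega f=\alpha f$: a $C^2$, $\Gamma_0(N)$-invariant eigenfunction of moderate growth at all cusps, whose constant terms at all cusps vanish. Then the theta series and the integrals defining $I_\Delta(\tau,f)$ and $I^M_\Delta(\tau,f)$ converge absolutely, both lifts are real differentiable in $\tau$, and $$\xi_{1/2}I^M_\Delta(\tau,f)=-\pi I_\Delta(\tau,\bar f),\qquad \xi_{3/2}I_\Delta(\tau,f)=-\frac{\bar\alpha}{4\pi}I^M_\Delta(\tau,\bar f).$$ The convergence, the differentiability and the first identity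 also hold for every continuous $\Gamma_0(N)$-invariant function $f$, not necessarily an eigenfunction, such that for each $\sigma\in\mathrm{SL}_2(\mathbb Z)$ there is $\varepsilon>0$ with $f(\sigma z)=O(y^{-\varepsilon})$ as $y\to\infty$, uniformly in $x$. (For real-valued $f\neq 0$ one has $\bar f=f$ and $\bar\alpha=\alpha$.) -/

import Mathlib

open UpperHalfPlane CongruenceSubgroup MeasureTheory Filter
open scoped MatrixGroups ComplexConjugate InnerProductSpace

noncomputable section

namespace TwistedLift

/-! ## The quadratic space, the upper half plane and the lattices -/

/-- `2 × 2` real matrices; the quadratic space is the subspace of traceless ones. -/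
abbrev Mat : Type := Matrix (Fin 2) (Fin 2) ℝ

/-- The quadratic form `Q(X) = N det X`. -/
def quad (N : ℕ) (X : Mat) : ℝ := N * X.det

/-- The bilinear form `(X, Y) = -N tr(XY)`. -/
def bil (N : ℕ) (X Y : Mat) : ℝ := -(N * (X * Y).trace)

/-- The generator `λ(z)` of the positive line attached to `z`; here `(z + z̄)/2 = Re z` and
`z z̄ = |z|²`. -/
def lineGen (N : ℕ) (z : ℍ) : Mat :=
  (1 / (Real.sqrt N * z.im)) • !![-z.re, Complex.normSq z; -1, z.re]

/-- The majorant `(X, X)_z = (X, λ(z))² - (X, X)`. -/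
def majorant (N : ℕ) (X : Mat) (z : ℍ) : ℝ := bil N X (lineGen N z) ^ 2 - bil N X X

/-- `R(X, z) = ½ (X, λ(z))² - (X, X)`. -/
def bigR (N : ℕ) (X : Mat) (z : ℍ) : ℝ := 1 / 2 * bil N X (lineGen N z) ^ 2 - bil N X X

/-- The vector of the dual lattice that corresponds to the binary quadratic form `[a, b, Nc]`. -/
def formVec (N : ℕ) (a b c : ℤ) : Mat :=
  !![(b : ℝ) / (2 * N), -(a : ℝ) / N; (c : ℝ), -((b : ℝ) / (2 * N))]

/-- The lattice `L` of all `(b, -a/N; c, -b)` with `a, b, c ∈ ℤ`. -/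
def latticeL (N : ℕ) : AddSubgroup Mat where
  carrier := {X | ∃ a b c : ℤ, X = !![(b : ℝ), -(a : ℝ) / N; (c : ℝ), -(b : ℝ)]}
  zero_mem' := ⟨0, 0, 0, by ext i j; fin_cases i <;> fin_cases j <;> simp⟩
  add_mem' := by
    rintro _ _ ⟨a, b, c, rfl⟩ ⟨a', b', c', rfl⟩
    refine ⟨a + a', b + b', c + c', ?_⟩
    ext i j; fin_cases i <;> fin_cases j <;> simp <;> ring
  neg_mem' := by
    rintro _ ⟨a, b, c, rfl⟩
    refine ⟨-a, -b, -c, ?_⟩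
    ext i j; fin_cases i <;> fin_cases j <;> simp; ring

/-- The dual lattice `L'` of all `(b/2N, -a/N; c, -b/2N)` with `a, b, c ∈ ℤ`. -/
def dualL (N : ℕ) : AddSubgroup Mat where
  carrier := {X | ∃ a b c : ℤ, X = formVec N a b c}
  zero_mem' := ⟨0, 0, 0, by ext i j; fin_cases i <;> fin_cases j <;> simp [formVec]⟩
  add_mem' := by
    rintro _ _ ⟨a, b, c, rfl⟩ ⟨a', b', c', rfl⟩
    refine ⟨a + a', b + b', c + c', ?_⟩
    ext i j; fin_cases i <;> fin_cases j <;> simp [formVec] <;> ring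
  neg_mem' := by
    rintro _ ⟨a, b, c, rfl⟩
    refine ⟨-a, -b, -c, ?_⟩
    ext i j; fin_cases i <;> fin_cases j <;> simp [formVec] <;> ring

/-- The rescaled lattice `ΔL`. -/
def scaledL (N : ℕ) (D : ℤ) : AddSubgroup Mat := (latticeL N).map (zsmulAddGroupHom D)

/-- The discriminant group `L'/ΔL`. For `Δ = 1` it is `L'/L`. -/
abbrev DiscGroup (N : ℕ) (D : ℤ) : Type := dualL N ⧸ (scaledL N D).addSubgroupOf (dualL N)

/-- The class of a vector of `L'` in `L'/ΔL`. -/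
def cls (N : ℕ) (D : ℤ) (X : dualL N) : DiscGroup N D := QuotientAddGroup.mk X

theorem scaledL_le (N : ℕ) (D : ℤ) : scaledL N D ≤ scaledL N 1 := by
  rintro _ ⟨X, hX, rfl⟩
  exact ⟨D • X, (latticeL N).zsmul_mem hX D, by simp⟩

/-- The canonical projection `π : L'/ΔL → L'/L`. -/
def proj (N : ℕ) (D : ℤ) : DiscGroup N D →+ DiscGroup N 1 :=
  QuotientAddGroup.map _ _ (AddMonoidHom.id (dualL N)) fun _ hX => scaledL_le N D hX

/-! ## Discriminants, the genus character and the twisting map -/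

/-- `D` is `1` or the discriminant of a quadratic number field. -/
def IsFundamentalDiscriminant (D : ℤ) : Prop :=
  (D % 4 = 1 ∧ Squarefree D) ∨ ∃ m : ℤ, D = 4 * m ∧ (m % 4 = 2 ∨ m % 4 = 3) ∧ Squarefree m

/-- The Kronecker symbol `(a / n)`. -/
def kronecker (a n : ℤ) : ℤ :=
  if n = 0 then (if a.natAbs = 1 then 1 else 0)
  else (if n < 0 ∧ a < 0 then -1 else 1)
    * ZMod.χ₈ (a : ZMod 8) ^ (n.natAbs.factorization 2)
    * jacobiSym a (n.natAbs / 2 ^ n.natAbs.factorization 2)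

/-- `n` is an admissible integer for computing the genus character of `δ ∈ L'/ΔL`: some
representative `[a, b, Nc]` of `δ` has discriminant divisible by `Δ` with quotient a square
modulo `4N`, satisfies `gcd(a, b, c, Δ) = 1`, and `n` is prime to `Δ` and represented by one of
the forms `[N₁a, b, N₂c]` with `N = N₁N₂`. -/
def GenusWitness (N : ℕ) (D : ℤ) (δ : DiscGroup N D) (n : ℤ) : Prop :=
  ∃ (a b c : ℤ) (X : dualL N), (X : Mat) = formVec N a b c ∧ cls N D X = δ ∧
    (∃ d s : ℤ, b ^ 2 - 4 * N * a * c = D * d ∧ d ≡ s ^ 2 [ZMOD 4 * N]) ∧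
    Int.gcd a (Int.gcd b (Int.gcd c D)) = 1 ∧
    (∃ (N₁ N₂ : ℕ) (x y : ℤ), N₁ * N₂ = N ∧
      n = N₁ * a * x ^ 2 + b * x * y + N₂ * c * y ^ 2) ∧
    IsCoprime n D

open Classical in
/-- The generalized genus character `χ_Δ` on `L'/ΔL`; its value does not depend on the choice
of the admissible integer `n`. -/
def genusChar (N : ℕ) (D : ℤ) (δ : DiscGroup N D) : ℤ :=
  if h : ∃ n, GenusWitness N D δ n then kronecker D h.choose else 0

/-- The congruence `Q_Δ(δ) ≡ sgn(Δ) Q(h)` modulo `ℤ`, where `Q_Δ = Q / |Δ|`. -/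
def QuadCongr (N : ℕ) (D : ℤ) (δ : DiscGroup N D) (h : DiscGroup N 1) : Prop :=
  ∃ (X Y : dualL N) (n : ℤ), cls N D X = δ ∧ cls N 1 Y = h ∧
    quad N X / |(D : ℝ)| - (D.sign : ℝ) * quad N Y = n

open Classical in
/-- The coefficient of `ψ_{Δ,r}(𝔢_h)` at `𝔢_δ`. -/
def psi (N : ℕ) (D r : ℤ) (h : DiscGroup N 1) (δ : DiscGroup N D) : ℂ :=
  if proj N D δ = r • h ∧ QuadCongr N D δ h then (genusChar N D δ : ℂ) else 0

/-! ## Theta kernels -/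

/-- The Schwartz function `φ⁰_Δ(X, z)`, as the coefficient of `ω = dx dy / y²`. -/
def phi0 (N : ℕ) (D : ℤ) (X : Mat) (z : ℍ) : ℝ :=
  (1 / |(D : ℝ)| * bil N X (lineGen N z) ^ 2 - 1 / (2 * Real.pi))
    * Real.exp (-(2 * Real.pi * bigR N X z / |(D : ℝ)|))

/-- The Kudla–Millson function `φ(X, τ, z) = e^{2πi Q_Δ(X) τ} φ⁰_Δ(√v X, z)`, as the
coefficient of `ω`. -/
def phiKM (N : ℕ) (D : ℤ) (X : Mat) (τ z : ℍ) : ℂ :=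
  Complex.exp (2 * Real.pi * Complex.I * (quad N X / |(D : ℝ)| : ℝ) * (τ : ℂ))
    * (phi0 N D (Real.sqrt τ.im • X) z : ℂ)

/-- The Siegel function
`φ_{2,1}(X, τ, z) = v^{1/2} exp((πi / |Δ|) (-u (X, X) + i v (X, X)_z))`. -/
def phiSiegel (N : ℕ) (D : ℤ) (X : Mat) (τ z : ℍ) : ℂ :=
  (Real.sqrt τ.im : ℂ)
    * Complex.exp (Real.pi * Complex.I / (|(D : ℝ)| : ℝ)
        * (-(τ.re * bil N X X : ℝ) + Complex.I * (τ.im * majorant N X z : ℝ)))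

/-- The theta series `Θ_δ(τ, z, φ)`, the sum of `φ(X, τ, z)` over `X ∈ ΔL + δ`. -/
def theta (N : ℕ) (D : ℤ) (φ : Mat → ℍ → ℍ → ℂ) (δ : DiscGroup N D) (τ z : ℍ) : ℂ :=
  ∑' X : {X : dualL N // cls N D X = δ}, φ (X.1 : Mat) τ z

/-- The component at `h ∈ L'/L` of the twisted theta function: the sum over the (finitely many)
`δ ∈ L'/ΔL` of `ψ_{Δ,r}(𝔢_h)_δ · Θ_δ(τ, z, φ)`. -/
def twistedTheta (N : ℕ) (D r : ℤ) (φ : Mat → ℍ → ℍ → ℂ) (h : DiscGroup N 1) (τ z : ℍ) : ℂ :=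
  ∑ᶠ δ : DiscGroup N D, psi N D r h δ * theta N D φ δ τ z

/-! ## Integration over `M = Γ₀(N)\ℍ` and the lifts -/

/-- The integral over `M = Γ₀(N)\ℍ`, with respect to `dx dy / y²`, of a `Γ₀(N)`-invariant
function: the sum over representatives `γ` of `Γ₀(N)\SL₂(ℤ)` of the integrals over the
translates by `γ` of the standard fundamental domain of `SL₂(ℤ)`. -/
def integralM (N : ℕ) (F : ℍ → ℂ) : ℂ :=
  ∑ᶠ c : SL(2, ℤ) ⧸ Gamma0 N, ∫ z in ModularGroup.fd, F (c.out⁻¹ • z)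

/-- Absolute convergence of the integral over `M = Γ₀(N)\ℍ`. -/
def IntegrableM (N : ℕ) (F : ℍ → ℂ) : Prop :=
  ∀ c : SL(2, ℤ) ⧸ Gamma0 N, IntegrableOn (fun z : ℍ => F (c.out⁻¹ • z)) ModularGroup.fd

/-- The component at `h` of the twisted theta lift of `f` with the kernel `φ`. -/
def lift (N : ℕ) (D r : ℤ) (φ : Mat → ℍ → ℍ → ℂ) (f : ℍ → ℂ) (h : DiscGroup N 1) (τ : ℍ) : ℂ :=
  integralM N fun z => f z * twistedTheta N D r φ h τ z

/-- The twisted Kudla–Millson lift `I_{Δ,r}(τ, f)`, a function with values in `ℂ[L'/L]`. -/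
def liftKM (N : ℕ) (D r : ℤ) (f : ℍ → ℂ) (τ : ℍ) : DiscGroup N 1 → ℂ :=
  fun h => lift N D r (phiKM N D) f h τ

/-- The twisted Maass lift `I^M_{Δ,r}(τ, f)`, a function with values in `ℂ[L'/L]`. -/
def liftMaass (N : ℕ) (D r : ℤ) (f : ℍ → ℂ) (τ : ℍ) : DiscGroup N 1 → ℂ :=
  fun h => lift N D r (phiSiegel N D) f h τ

/-- The theta series with kernel `φ` converge absolutely, the theta integral of `f` over
`M` converges absolutely, and the resulting lift is real differentiable in `τ`. -/
def LiftConverges (N : ℕ) (D r : ℤ) (φ : Mat → ℍ → ℍ → ℂ) (f : ℍ → ℂ) : Prop :=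
  (∀ (δ : DiscGroup N D) (τ z : ℍ),
    Summable fun X : {X : dualL N // cls N D X = δ} => φ (X.1 : Mat) τ z) ∧
  (∀ (h : DiscGroup N 1) (τ : ℍ), IntegrableM N fun z => f z * twistedTheta N D r φ h τ z) ∧
  ∀ (h : DiscGroup N 1) (τ : ℍ), DifferentiableAt ℝ (lift N D r φ f h ∘ ofComplex) (τ : ℂ)

/-! ## Differential operators and Maass cusp forms -/

/-- `∂F/∂τ̄ = ½ (∂/∂u + i ∂/∂v) F` for a function on the upper half plane. -/
def dbar (F : ℍ → ℂ) (τ : ℍ) : ℂ :=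
  1 / 2 * (fderiv ℝ (F ∘ ofComplex) (τ : ℂ) 1
    + Complex.I * fderiv ℝ (F ∘ ofComplex) (τ : ℂ) Complex.I)

/-- The operator `ξ_k F = 2i v^k conj(∂F/∂τ̄)`, on functions with values in `ℂ[ι]` and applied
to each component. -/
def xi {ι : Type*} (k : ℝ) (F : ℍ → ι → ℂ) (τ : ℍ) : ι → ℂ :=
  fun h => 2 * Complex.I * ((τ.im ^ k : ℝ) : ℂ) * conj (dbar (fun w => F w h) τ)

/-- The Laplace operator `Ω f = y² (∂²f/∂x² + ∂²f/∂y²)`. -/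
def hypLaplacian (f : ℍ → ℂ) (z : ℍ) : ℂ :=
  ((z.im ^ 2 : ℝ) : ℂ) * Laplacian.laplacian (f ∘ ofComplex) (z : ℂ)

/-- `f` is invariant under `Γ₀(N)`. -/
def IsInvariant (N : ℕ) (f : ℍ → ℂ) : Prop := ∀ γ ∈ Gamma0 N, ∀ z : ℍ, f (γ • z) = f z

/-- `f` tends to zero at least like a negative power of `y` at every cusp. -/
def DecaysAtCusps (f : ℍ → ℂ) : Prop :=
  ∀ σ : SL(2, ℤ), ∃ ε : ℝ, 0 < ε ∧
    (fun z : ℍ => f (σ • z)) =O[atImInfty] fun z : ℍ => z.im ^ (-ε)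

/-- Maass cusp forms of weight `0` for `Γ₀(N)` with Laplace eigenvalue `α`. The width of each
cusp divides `N`, so that the last condition says that the constant terms vanish. -/
structure IsMaassCuspForm (N : ℕ) (α : ℂ) (f : ℍ → ℂ) : Prop where
  contDiff : ContDiffOn ℝ 2 (f ∘ ofComplex) {z : ℂ | 0 < z.im}
  invariant : IsInvariant N f
  eigen : ∀ z : ℍ, hypLaplacian f z = α * f z
  moderate : ∀ σ : SL(2, ℤ), ∃ A : ℝ,
    (fun z : ℍ => f (σ • z)) =O[atImInfty] fun z : ℍ => z.im ^ A
  cuspidal : ∀ (σ : SL(2, ℤ)) (z : ℍ), ∫ x in (0 : ℝ)..(N : ℝ), f (σ • (x +ᵥ z)) = 0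

end TwistedLift

end

noncomputable section

namespace TwistedLift

/-! ## Coordinates on the quadratic space -/

/-! Write P = (X, λ(z)), M = (X,X)_z = P² - (X,X) and κ = π/|Δ|. Both lifts are combinations of
lifts of kernels p(X,z) exp(κ(i s u (X,X) - v M)) with s = ±1 and p a polynomial in P² and (X,X).
Summed over L', with integer coefficients coming from the genus character, these series are O(y) at
every cusp. This linear growth, a decay y^(-ε) of f and the density y^(-2) give absolute convergence
and allow differentiation under sum and integral (`exists_gaussian_bound`,
`integrable_decay_mul_theta`, `hasFDerivAt_lift_kernel`).

The first identity is then a computation in each term. The operator ∂/∂τ̄ applied to the Siegel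
kernel brings in (X,X) and M only through the sum M + (X,X) = P². The result is the conjugate of the
Kudla–Millson kernel, because conjugation only reverses the sign of the frequency in u
(`xi_half_liftMaass`).

For the second identity, ∂/∂τ̄ of the Kudla–Millson kernel is, up to a factor depending only on v,
the hyperbolic Laplacian in z of the Gaussian exp(-kM) with k = κv (`xi_three_halves_liftKM`,
`gaussian_series_regular`). It remains to move Ω from the theta function onto f, where it acts by α
(`lift_lapWeight`). This needs the Γ₀(N)-invariance of the theta function
(`twistedTheta_one_invariant`) and Green's formula on the translates of the truncated fundamental
domain. The vertical sides cancel under T (`sum_sides`), the arcs cancel under S (`sum_bottom`), and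
the top edges tend to zero after averaging the height over [R, 2R] (`tendsto_average_wron`). The
average is taken because integration by parts in y then removes every derivative of f, so that only
the size of f matters.

The decay of a Maass cusp form is proved without Fourier expansions. A maximum principle for
|g(x+d,y) - g(x,y)|², compared with an explicit barrier, shows that this difference is exponentially
small in y (`dist_sq_le_barrier`). Since the mean over a period vanishes, g itself is small
(`eigenfunction_decay`). -/

/-- The function `(X, λ(z))` of `z`, for traceless `X`. -/
def fP (N : ℕ) (X : Mat) (z : ℂ) : ℝ :=
  -(√N * ((X 1 0 * z.re ^ 2 - 2 * X 0 0 * z.re - X 0 1) / z.im + X 1 0 * z.im))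

/-- The derivative `y ∂/∂x` of `fP`. -/
def fA (N : ℕ) (X : Mat) (z : ℂ) : ℝ := -(2 * √N * (X 1 0 * z.re - X 0 0))

/-- The derivative `y ∂/∂y` of `fP`. -/
def fB (N : ℕ) (X : Mat) (z : ℂ) : ℝ :=
  √N * ((X 1 0 * z.re ^ 2 - 2 * X 0 0 * z.re - X 0 1) / z.im - X 1 0 * z.im)

/-- The majorant in coordinates. -/
def fM (N : ℕ) (X : Mat) (z : ℂ) : ℝ := (fP N X z ^ 2 + fA N X z ^ 2 + fB N X z ^ 2) / 2

theorem fM_nonneg (N : ℕ) (X : Mat) (z : ℂ) : 0 ≤ fM N X z := by unfold fM; positivity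

theorem bil_lineGen (N : ℕ) {X : Mat} (hX : X 1 1 = -X 0 0) (z : ℍ) :
    bil N X (lineGen N z) = fP N X z := by
  have hy : z.im ≠ 0 := z.im_ne_zero
  have hs : (N : ℝ) * (1 / (√N * z.im)) = √N / z.im := by
    rcases eq_or_ne (N : ℝ) 0 with h | h
    · simp [h]
    · have h' : √(N : ℝ) ≠ 0 := by positivity
      field_simp
      exact (Real.sq_sqrt (Nat.cast_nonneg N)).symm
  have : bil N X (lineGen N z) = -((N : ℝ) * (1 / (√N * z.im)) *
      (X 1 0 * Complex.normSq z - 2 * X 0 0 * z.re - X 0 1)) := by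
    simp [bil, lineGen, Matrix.trace_fin_two, Matrix.mul_apply, Fin.sum_univ_two, hX]
    ring
  rw [this, hs]
  simp only [fP, Complex.normSq_apply, coe_re, coe_im]
  field_simp
  ring

theorem bil_self (N : ℕ) {X : Mat} (hX : X 1 1 = -X 0 0) :
    bil N X X = -(2 * N * (X 0 0 ^ 2 + X 0 1 * X 1 0)) := by
  simp [bil, Matrix.trace_fin_two, Matrix.mul_apply, Fin.sum_univ_two, hX]
  ring

theorem quad_eq (N : ℕ) {X : Mat} (hX : X 1 1 = -X 0 0) : quad N X = bil N X X / 2 := by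
  rw [bil_self N hX, quad, Matrix.det_fin_two, hX]
  ring

/-- With q = γx² - 2βx - α one has P² - B² = 4Nγq, so y drops out. Subtracting A² = 4N(γx - β)²
completes the square and leaves the discriminant. -/
theorem sq_fA_add_sq_fB (N : ℕ) {X : Mat} (hX : X 1 1 = -X 0 0) {z : ℂ} (hz : 0 < z.im) :
    fA N X z ^ 2 + fB N X z ^ 2 = fP N X z ^ 2 - 2 * bil N X X := by
  have h : √(N : ℝ) ^ 2 = N := Real.sq_sqrt (Nat.cast_nonneg N)
  rw [bil_self N hX, ← h]
  simp only [fA, fB, fP]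
  field_simp
  ring

theorem fM_eq (N : ℕ) {X : Mat} (hX : X 1 1 = -X 0 0) {z : ℂ} (hz : 0 < z.im) :
    fM N X z = fP N X z ^ 2 - bil N X X := by
  have := sq_fA_add_sq_fB N hX hz
  unfold fM
  linarith

theorem majorant_eq (N : ℕ) {X : Mat} (hX : X 1 1 = -X 0 0) (z : ℍ) :
    majorant N X z = fM N X z := by
  rw [majorant, bil_lineGen N hX, fM_eq N hX z.im_pos]

/-- In the coordinates P, A, B the form (X,X) is ½(P² - A² - B²), of signature (1,2), while the
majorant is ½(P² + A² + B²). -/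
theorem abs_bil_le (N : ℕ) {X : Mat} (hX : X 1 1 = -X 0 0) {z : ℂ} (hz : 0 < z.im) :
    |bil N X X| ≤ fM N X z := by
  have h := sq_fA_add_sq_fB N hX hz
  unfold fM
  rw [abs_le]
  constructor <;> nlinarith [sq_nonneg (fP N X z), sq_nonneg (fA N X z), sq_nonneg (fB N X z)]

/-! ## The action of the modular group -/

/-- The action of `SL₂(ℤ)` on real matrices by conjugation. -/
def conjAct (σ : SL(2, ℤ)) (X : Mat) : Mat :=
  (σ : Matrix (Fin 2) (Fin 2) ℤ).map Int.cast * X *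
    ((σ⁻¹ : SL(2, ℤ)) : Matrix (Fin 2) (Fin 2) ℤ).map Int.cast

theorem map_mul_map_inv (σ : SL(2, ℤ)) :
    (σ : Matrix (Fin 2) (Fin 2) ℤ).map (Int.cast : ℤ → ℝ) *
      ((σ⁻¹ : SL(2, ℤ)) : Matrix (Fin 2) (Fin 2) ℤ).map Int.cast = 1 := by
  have : ((σ * σ⁻¹ : SL(2, ℤ)) : Matrix (Fin 2) (Fin 2) ℤ).map (Int.castRingHom ℝ) = 1 := by
    rw [mul_inv_cancel]; simp
  rwa [Matrix.SpecialLinearGroup.coe_mul, Matrix.map_mul] at this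

theorem conjAct_mul (σ τ : SL(2, ℤ)) (X : Mat) :
    conjAct (σ * τ) X = conjAct σ (conjAct τ X) := by
  have h : ∀ a b : SL(2, ℤ), ((a * b : SL(2, ℤ)) : Matrix (Fin 2) (Fin 2) ℤ).map (Int.cast : ℤ → ℝ)
      = (a : Matrix (Fin 2) (Fin 2) ℤ).map Int.cast *
        (b : Matrix (Fin 2) (Fin 2) ℤ).map Int.cast := fun a b => by
    rw [Matrix.SpecialLinearGroup.coe_mul]
    exact Matrix.map_mul (f := Int.castRingHom ℝ)
  simp only [conjAct, mul_inv_rev, h, Matrix.mul_assoc]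

@[simp] theorem conjAct_one (X : Mat) : conjAct 1 X = X := by simp [conjAct]

theorem conjAct_inv_conjAct (σ : SL(2, ℤ)) (X : Mat) : conjAct σ⁻¹ (conjAct σ X) = X := by
  rw [← conjAct_mul]; simp

theorem conjAct_conjAct_inv (σ : SL(2, ℤ)) (X : Mat) : conjAct σ (conjAct σ⁻¹ X) = X := by
  rw [← conjAct_mul]; simp

theorem conjAct_sub (σ : SL(2, ℤ)) (X Y : Mat) :
    conjAct σ (X - Y) = conjAct σ X - conjAct σ Y := by
  simp [conjAct, mul_sub, sub_mul]

theorem conjAct_zsmul (σ : SL(2, ℤ)) (n : ℤ) (X : Mat) :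
    conjAct σ (n • X) = n • conjAct σ X := by
  simp only [conjAct, Matrix.mul_smul, Matrix.smul_mul]

theorem bil_conjAct (N : ℕ) (σ : SL(2, ℤ)) (X Y : Mat) :
    bil N (conjAct σ X) (conjAct σ Y) = bil N X Y := by
  have h := map_mul_map_inv σ⁻¹
  rw [inv_inv] at h
  simp only [bil, conjAct]
  set g := (σ : Matrix (Fin 2) (Fin 2) ℤ).map (Int.cast : ℤ → ℝ)
  set g' := ((σ⁻¹ : SL(2, ℤ)) : Matrix (Fin 2) (Fin 2) ℤ).map (Int.cast : ℤ → ℝ)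
  have : g * X * g' * (g * Y * g') = g * (X * Y * g') := by
    calc g * X * g' * (g * Y * g') = g * X * (g' * g) * Y * g' := by simp only [Matrix.mul_assoc]
      _ = g * (X * Y * g') := by rw [h]; simp only [Matrix.mul_assoc, Matrix.one_mul]
  rw [this, Matrix.trace_mul_comm, Matrix.mul_assoc, h, Matrix.mul_one]

theorem quad_conjAct (N : ℕ) (σ : SL(2, ℤ)) (X : Mat) : quad N (conjAct σ X) = quad N X := by
  have h := congrArg Matrix.det (map_mul_map_inv σ)
  rw [Matrix.det_mul, Matrix.det_one] at h
  simp only [quad, conjAct, Matrix.det_mul]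
  linear_combination (N * X.det) * h

theorem det_entries (σ : SL(2, ℤ)) :
    (σ 0 0 : ℝ) * σ 1 1 - σ 0 1 * σ 1 0 = 1 := by
  have h := σ.det_coe
  rw [Matrix.det_fin_two] at h
  exact_mod_cast h

theorem conjAct_apply (σ : SL(2, ℤ)) {X : Mat} (hX : X 1 1 = -X 0 0) :
    conjAct σ X = !![X 0 0 * (σ 0 0 * σ 1 1 + σ 0 1 * σ 1 0) + X 1 0 * σ 0 1 * σ 1 1
        - X 0 1 * σ 0 0 * σ 1 0,
      X 0 1 * σ 0 0 ^ 2 - 2 * X 0 0 * σ 0 0 * σ 0 1 - X 1 0 * σ 0 1 ^ 2;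
      X 1 0 * σ 1 1 ^ 2 + 2 * X 0 0 * σ 1 0 * σ 1 1 - X 0 1 * σ 1 0 ^ 2,
      -(X 0 0 * (σ 0 0 * σ 1 1 + σ 0 1 * σ 1 0) + X 1 0 * σ 0 1 * σ 1 1
        - X 0 1 * σ 0 0 * σ 1 0)] := by
  ext i j
  fin_cases i <;> fin_cases j <;>
  simp [conjAct, Matrix.mul_apply, Fin.sum_univ_two, Matrix.SpecialLinearGroup.coe_inv,
    Matrix.adjugate_fin_two, hX] <;> ring

theorem conjAct_traceless (σ : SL(2, ℤ)) {X : Mat} (hX : X 1 1 = -X 0 0) :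
    conjAct σ X 1 1 = -conjAct σ X 0 0 := by
  rw [conjAct_apply σ hX]; simp

/-- This is the equivariance λ(σz) = σλ(z)σ⁻¹, checked on P = -√N (γ|z|² - 2βx - α)/y from the
formulas for the real part, imaginary part and modulus of σz. -/
theorem fP_conjAct (N : ℕ) (σ : SL(2, ℤ)) {X : Mat} (hX : X 1 1 = -X 0 0) (z : ℍ) :
    fP N (conjAct σ X) (σ • z : ℍ) = fP N X z := by
  have hw : ((σ • z : ℍ) : ℂ) * ((σ 1 0 : ℝ) * (z : ℂ) + (σ 1 1 : ℝ))
      = (σ 0 0 : ℝ) * (z : ℂ) + (σ 0 1 : ℝ) := by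
    have h0 := denom_ne_zero (σ : GL (Fin 2) ℝ) z
    have h1 : ((σ 1 0 : ℝ) : ℂ) * (z : ℂ) + ((σ 1 1 : ℝ) : ℂ) ≠ 0 := by simpa [denom] using h0
    have h2 := coe_specialLinearGroup_apply σ z
    simp only [algebraMap_int_eq, eq_intCast] at h2
    rw [h2]
    exact div_mul_cancel₀ _ h1
  set w : ℂ := ((σ • z : ℍ) : ℂ)
  have hwi : 0 < w.im := (σ • z).im_pos
  have hzi : 0 < (z : ℂ).im := z.im_pos
  have hre := congrArg Complex.re hw
  have him := congrArg Complex.im hw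
  have hdet := det_entries σ
  simp only [Complex.mul_re, Complex.add_re, Complex.add_im, Complex.mul_im, Complex.ofReal_re,
    Complex.ofReal_im, zero_mul, sub_zero, add_zero] at hre him
  rw [conjAct_apply σ hX]
  simp only [fP, Matrix.of_apply, Matrix.cons_val_zero, Matrix.cons_val_one, Matrix.cons_val',
    Matrix.cons_val_fin_one]
  generalize (σ 0 0 : ℝ) = a at *
  generalize (σ 0 1 : ℝ) = b at *
  generalize (σ 1 0 : ℝ) = c at *
  generalize (σ 1 1 : ℝ) = d at *
  generalize (z : ℂ).re = x at *
  generalize (z : ℂ).im = y at *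
  have hn : 0 < (c * x + d) ^ 2 + (c * y) ^ 2 := by
    by_contra! h
    have h1 : c * x + d = 0 := by nlinarith [sq_nonneg (c * x + d), sq_nonneg (c * y)]
    have h2 : c * y = 0 := by nlinarith [sq_nonneg (c * x + d), sq_nonneg (c * y)]
    have h3 : c = 0 := by simpa [hzi.ne'] using h2
    subst h3
    simp only [zero_mul, zero_add] at h1
    subst h1
    simp at hdet
  have e1 : w.im = y / ((c * x + d) ^ 2 + (c * y) ^ 2) := by
    rw [eq_div_iff hn.ne']
    linear_combination (c * x + d) * him - c * y * hre + y * hdet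
  have e2 : w.re = ((a * x + b) * (c * x + d) + a * c * y ^ 2) /
      ((c * x + d) ^ 2 + (c * y) ^ 2) := by
    rw [eq_div_iff hn.ne']
    linear_combination (c * x + d) * hre + c * y * him
  generalize X 0 0 = β
  generalize X 0 1 = α
  generalize X 1 0 = γ
  have e3 : ∀ γ β α x y : ℝ, 0 < y → (γ * x ^ 2 - 2 * β * x - α) / y + γ * y =
      (γ * (x ^ 2 + y ^ 2) - 2 * β * x - α) / y := fun γ β α x y hy => by
    field_simp; ring
  rw [e3 _ _ _ _ _ hwi, e3 _ _ _ _ _ hzi]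
  have e4 : w.re ^ 2 + w.im ^ 2 = ((a * x + b) ^ 2 + (a * y) ^ 2) /
      ((c * x + d) ^ 2 + (c * y) ^ 2) := by
    rw [e1, e2, div_pow, div_pow, ← add_div, div_eq_div_iff (by positivity) hn.ne']
    linear_combination (-((c * x + d) ^ 2 + (c * y) ^ 2) * y ^ 2 * (a * d - b * c + 1)) * hdet
  rw [e4, e2, e1]
  congr 2
  -- The factor (ad - bc)² = 1 makes both sides homogeneous in a, b, c, d, so that what remains is
  -- an unconstrained polynomial identity.
  have e5 : γ * (x ^ 2 + y ^ 2) - 2 * β * x - α =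
      (γ * (x ^ 2 + y ^ 2) - 2 * β * x - α) * (a * d - b * c) ^ 2 := by rw [hdet]; ring
  rw [e5]
  have hn' := hn.ne'
  generalize hnd : (c * x + d) ^ 2 + (c * y) ^ 2 = n at *
  field_simp
  rw [← hnd]
  ring

/-! ## Bounds for theta series -/

theorem fM_conjAct (N : ℕ) (σ : SL(2, ℤ)) {X : Mat} (hX : X 1 1 = -X 0 0) (z : ℍ) :
    fM N (conjAct σ X) (σ • z : ℍ) = fM N X z := by
  rw [fM_eq N (conjAct_traceless σ hX) (σ • z).im_pos, fM_eq N hX z.im_pos, bil_conjAct,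
    fP_conjAct N σ hX]

theorem fP_smul (N : ℕ) (σ : SL(2, ℤ)) {X : Mat} (hX : X 1 1 = -X 0 0) (z : ℍ) :
    fP N X (σ • z : ℍ) = fP N (conjAct σ⁻¹ X) z := by
  conv_lhs => rw [← conjAct_conjAct_inv σ X]
  exact fP_conjAct N σ (conjAct_traceless _ hX) z

theorem fM_smul (N : ℕ) (σ : SL(2, ℤ)) {X : Mat} (hX : X 1 1 = -X 0 0) (z : ℍ) :
    fM N X (σ • z : ℍ) = fM N (conjAct σ⁻¹ X) z := by
  conv_lhs => rw [← conjAct_conjAct_inv σ X]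
  exact fM_conjAct N σ (conjAct_traceless _ hX) z

theorem dualL_traceless {N : ℕ} (X : dualL N) : (X : Mat) 1 1 = -(X : Mat) 0 0 := by
  obtain ⟨_, a, b, c, rfl⟩ := X
  simp [formVec]

/-- The majorant is N times (γy)² + H² + 2(β - xγ)² with H = (α + 2βx - γx²)/y. This is a triangular
change of the variables γ, β, α/y, whose inverse is bounded for |x| ≤ x₁ and y ≥ y₁. The weight y⁻²
on α² is the source of the linear growth of the theta series. -/
theorem exists_fM_lower_bound {N : ℕ} (hN : 0 < N) (x₁ : ℝ) {y₁ : ℝ} (hy₁ : 0 < y₁) :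
    ∃ c : ℝ, 0 < c ∧ ∀ (X : Mat) (z : ℂ), |z.re| ≤ x₁ → y₁ ≤ z.im →
      c * (X 0 1 ^ 2 / z.im ^ 2 + X 0 0 ^ 2 + X 1 0 ^ 2) ≤ fM N X z := by
  have hN' : (0 : ℝ) < N := by exact_mod_cast hN
  set a₁ : ℝ := 1 + 12 * x₁ ^ 2 / y₁ ^ 2 with ha₁
  set a₂ : ℝ := 1 + 3 * x₁ ^ 4 / y₁ ^ 2 with ha₂
  have h1 : 0 < a₁ := by positivity
  have h2 : 0 < a₂ := by positivity
  set K : ℝ := 3 + 2 * a₁ + (2 * x₁ ^ 2 * a₁ + a₂) / y₁ ^ 2 with hK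
  have hKpos : 0 < K := by positivity
  refine ⟨N / K, by positivity, fun X z hx hy => ?_⟩
  have hy0 : 0 < z.im := hy₁.trans_le hy
  have key : fM N X z = N * ((X 1 0 * z.im) ^ 2
      + ((X 0 1 + 2 * X 0 0 * z.re - X 1 0 * z.re ^ 2) / z.im) ^ 2
      + 2 * (X 0 0 - z.re * X 1 0) ^ 2) := by
    have h : √(N : ℝ) ^ 2 = N := Real.sq_sqrt (Nat.cast_nonneg N)
    rw [← h]
    simp only [fM, fA, fB, fP]
    field_simp
    ring
  rw [key]
  generalize X 0 1 = α
  generalize X 0 0 = β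
  generalize X 1 0 = γ
  generalize z.re = x at *
  generalize z.im = y at *
  have hx2 : x ^ 2 ≤ x₁ ^ 2 := sq_le_sq' (by linarith [(abs_le.1 hx).1]) (abs_le.1 hx).2
  have hx4 : x ^ 4 ≤ x₁ ^ 4 := by
    have := pow_le_pow_left₀ (sq_nonneg x) hx2 2
    nlinarith
  have hy2 : y₁ ^ 2 ≤ y ^ 2 := pow_le_pow_left₀ hy₁.le hy 2
  set H := (α + 2 * β * x - γ * x ^ 2) / y with hH
  have eα : α / y = H - 2 * β * x / y + γ * x ^ 2 / y := by rw [hH]; field_simp; ring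
  have b1 : (α / y) ^ 2 ≤ 3 * H ^ 2 + 3 * (2 * β * x / y) ^ 2 + 3 * (γ * x ^ 2 / y) ^ 2 := by
    rw [eα]
    nlinarith [sq_nonneg (H + 2 * β * x / y), sq_nonneg (H - γ * x ^ 2 / y),
      sq_nonneg (2 * β * x / y + γ * x ^ 2 / y)]
  have b2 : (2 * β * x / y) ^ 2 ≤ 4 * x₁ ^ 2 / y₁ ^ 2 * β ^ 2 := by
    have : (2 * β * x / y) ^ 2 = 4 * x ^ 2 / y ^ 2 * β ^ 2 := by ring
    rw [this]; gcongr
  have b3 : (γ * x ^ 2 / y) ^ 2 ≤ x₁ ^ 4 / y₁ ^ 2 * γ ^ 2 := by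
    have : (γ * x ^ 2 / y) ^ 2 = x ^ 4 / y ^ 2 * γ ^ 2 := by ring
    rw [this]; gcongr
  have b4 : β ^ 2 ≤ 2 * (β - x * γ) ^ 2 + 2 * x₁ ^ 2 * γ ^ 2 := by
    nlinarith [sq_nonneg (β - 2 * x * γ), mul_le_mul_of_nonneg_right hx2 (sq_nonneg γ)]
  have b5 : γ ^ 2 ≤ (γ * y) ^ 2 / y₁ ^ 2 := by
    rw [le_div_iff₀ (by positivity), mul_pow]; gcongr
  have b6 : α ^ 2 / y ^ 2 + β ^ 2 + γ ^ 2 ≤ 3 * H ^ 2 + a₁ * β ^ 2 + a₂ * γ ^ 2 := by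
    have : α ^ 2 / y ^ 2 = (α / y) ^ 2 := by rw [div_pow]
    rw [this, ha₁, ha₂]
    linarith [b1, b2, b3, show 3 * (4 * x₁ ^ 2 / y₁ ^ 2 * β ^ 2) = 12 * x₁ ^ 2 / y₁ ^ 2 * β ^ 2 by
      ring, show 3 * (x₁ ^ 4 / y₁ ^ 2 * γ ^ 2) = 3 * x₁ ^ 4 / y₁ ^ 2 * γ ^ 2 by ring]
  have b7 : α ^ 2 / y ^ 2 + β ^ 2 + γ ^ 2 ≤ K * ((γ * y) ^ 2 + H ^ 2 + 2 * (β - x * γ) ^ 2) := by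
    have c1 := mul_le_mul_of_nonneg_left b4 h1.le
    have c2 := mul_le_mul_of_nonneg_left b5 (show 0 ≤ 2 * x₁ ^ 2 * a₁ + a₂ by positivity)
    have c3 : 0 ≤ (2 * x₁ ^ 2 * a₁ + a₂) / y₁ ^ 2 := by positivity
    rw [hK]
    have e : (2 * x₁ ^ 2 * a₁ + a₂) * ((γ * y) ^ 2 / y₁ ^ 2) =
        (2 * x₁ ^ 2 * a₁ + a₂) / y₁ ^ 2 * (γ * y) ^ 2 := by ring
    rw [e] at c2
    generalize (2 * x₁ ^ 2 * a₁ + a₂) / y₁ ^ 2 = κ at *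
    have hp1 := sq_nonneg (γ * y)
    have hp2 := sq_nonneg H
    have hp3 := sq_nonneg (β - x * γ)
    generalize (γ * y) ^ 2 = p1 at *
    generalize H ^ 2 = p2 at *
    generalize (β - x * γ) ^ 2 = p3 at *
    have d : 0 ≤ (3 + 2 * a₁) * p1 + (2 * a₁ + κ) * p2 + (6 + 2 * a₁ + 2 * κ) * p3 := by
      positivity
    clear_value a₁ a₂
    linarith
  calc N / K * (α ^ 2 / y ^ 2 + β ^ 2 + γ ^ 2)
      ≤ N / K * (K * ((γ * y) ^ 2 + H ^ 2 + 2 * (β - x * γ) ^ 2)) := by gcongr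
    _ = N * ((γ * y) ^ 2 + H ^ 2 + 2 * (β - x * γ) ^ 2) := by field_simp

/-! ### Gaussian sums over the integers and over the dual lattice. -/

theorem summable_exp_neg_mul_sq {a : ℝ} (ha : 0 < a) :
    Summable fun n : ℤ => Real.exp (-(a * (n : ℝ) ^ 2)) := by
  have h := (summable_jacobiTheta₂_term_iff 0 (Complex.I * (a / Real.pi : ℝ))).2 (by
    simp; positivity)
  refine h.norm.congr fun n => ?_
  rw [norm_jacobiTheta₂_term]
  congr 1
  simp
  field_simp

/-- Poisson summation turns the sum into √(π/a)·y times a dual Gaussian sum that decreases in y, and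
so is bounded by its value at y₁. -/
theorem exists_tsum_exp_neg_div_sq_le {a y₁ : ℝ} (ha : 0 < a) (hy₁ : 0 < y₁) :
    ∃ C : ℝ, ∀ y : ℝ, y₁ ≤ y →
      ∑' n : ℤ, Real.exp (-(a * ((n : ℝ) ^ 2 / y ^ 2))) ≤ C * y := by
  have hb : 0 < Real.pi ^ 2 * y₁ ^ 2 / a := by positivity
  refine ⟨√(Real.pi / a) * ∑' n : ℤ, Real.exp (-(Real.pi ^ 2 * y₁ ^ 2 / a * (n : ℝ) ^ 2)),
    fun y hy => ?_⟩
  have hy0 : 0 < y := hy₁.trans_le hy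
  have ha' : 0 < a / (Real.pi * y ^ 2) := by positivity
  have h := Real.tsum_exp_neg_mul_int_sq ha'
  have e1 : ∀ n : ℤ, -Real.pi * (a / (Real.pi * y ^ 2)) * (n : ℝ) ^ 2
      = -(a * ((n : ℝ) ^ 2 / y ^ 2)) := fun n => by field_simp
  have e2 : ∀ n : ℤ, -Real.pi / (a / (Real.pi * y ^ 2)) * (n : ℝ) ^ 2
      = -(Real.pi ^ 2 * y ^ 2 / a * (n : ℝ) ^ 2) := fun n => by field_simp
  have e3 : (1 : ℝ) / (a / (Real.pi * y ^ 2)) ^ (1 / 2 : ℝ) = √(Real.pi / a) * y := by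
    rw [← Real.sqrt_eq_rpow, one_div, ← Real.sqrt_inv, inv_div, mul_div_right_comm,
      Real.sqrt_mul (by positivity), Real.sqrt_sq hy0.le]
  simp only [e1, e2, e3] at h
  rw [h, mul_right_comm]
  refine mul_le_mul_of_nonneg_right (mul_le_mul_of_nonneg_left ?_ (by positivity)) hy0.le
  refine Summable.tsum_le_tsum (fun n => ?_) (summable_exp_neg_mul_sq (by positivity))
    (summable_exp_neg_mul_sq hb)
  gcongr

/-- A general σ in SL₂(ℤ) need not preserve the dual lattice, but it keeps all entries in (1/2N)ℤ.
Sums over L' seen from any cusp are therefore dominated by sums over ℤ³. -/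
theorem exists_coords {N : ℕ} (hN : 0 < N) (σ : SL(2, ℤ)) :
    ∃ T : dualL N → ℤ × ℤ × ℤ, Function.Injective T ∧ ∀ X : dualL N,
      conjAct σ X 0 1 = (T X).1 / (2 * N) ∧ conjAct σ X 0 0 = (T X).2.1 / (2 * N) ∧
      conjAct σ X 1 0 = (T X).2.2 / (2 * N) := by
  have hN' : (N : ℝ) ≠ 0 := by exact_mod_cast hN.ne'
  have h : ∀ X : dualL N, ∃ t : ℤ × ℤ × ℤ, conjAct σ X 0 1 = t.1 / (2 * N) ∧
      conjAct σ X 0 0 = t.2.1 / (2 * N) ∧ conjAct σ X 1 0 = t.2.2 / (2 * N) := by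
    intro X
    have hX := conjAct_apply σ (dualL_traceless X)
    obtain ⟨X, a, b, c, rfl⟩ := X
    rw [hX]
    refine ⟨((-2 * a) * σ 0 0 ^ 2 - 2 * b * σ 0 0 * σ 0 1 - 2 * N * c * σ 0 1 ^ 2,
      b * (σ 0 0 * σ 1 1 + σ 0 1 * σ 1 0) + 2 * N * c * σ 0 1 * σ 1 1 + 2 * a * σ 0 0 * σ 1 0,
      2 * N * c * σ 1 1 ^ 2 + 2 * b * σ 1 0 * σ 1 1 + 2 * a * σ 1 0 ^ 2), ?_, ?_, ?_⟩ <;>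
    · simp [formVec]
      field_simp
      try ring
  choose T hT using h
  refine ⟨T, fun X Y hXY => ?_, hT⟩
  have h00 : conjAct σ X 0 0 = conjAct σ Y 0 0 := by rw [(hT X).2.1, (hT Y).2.1, hXY]
  have h01 : conjAct σ X 0 1 = conjAct σ Y 0 1 := by rw [(hT X).1, (hT Y).1, hXY]
  have h10 : conjAct σ X 1 0 = conjAct σ Y 1 0 := by rw [(hT X).2.2, (hT Y).2.2, hXY]
  have h11 : conjAct σ X 1 1 = conjAct σ Y 1 1 := by
    rw [conjAct_traceless σ (dualL_traceless X), conjAct_traceless σ (dualL_traceless Y), h00]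
  have : conjAct σ X = conjAct σ Y := by
    ext i j; fin_cases i <;> fin_cases j <;> assumption
  apply Subtype.ext
  rw [← conjAct_inv_conjAct σ X, this, conjAct_inv_conjAct]

/-- A bound for the values of the Gaussian of the majorant that is summable over the dual
lattice, locally uniformly in `z` and with sum growing at most linearly in `y`. -/
theorem exists_gaussian_bound {N : ℕ} (hN : 0 < N) (σ : SL(2, ℤ)) {t : ℝ} (ht : 0 < t) (x₁ : ℝ)
    {y₁ : ℝ} (hy₁ : 0 < y₁) :
    ∃ (g : ℝ → dualL N → ℝ) (C : ℝ),
      (∀ y, y₁ ≤ y → Summable (g y) ∧ ∑' X, g y X ≤ C * y) ∧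
      ∀ (X : dualL N) (z : ℂ) (y : ℝ), |z.re| ≤ x₁ → y₁ ≤ z.im → z.im ≤ y →
        Real.exp (-(t * fM N (conjAct σ X) z)) ≤ g y X := by
  have hN' : (0 : ℝ) < N := by exact_mod_cast hN
  obtain ⟨c, hc, hcb⟩ := exists_fM_lower_bound hN x₁ hy₁
  obtain ⟨T, hT, hTX⟩ := exists_coords hN σ
  set a : ℝ := t * c / (4 * N ^ 2) with ha
  have ha0 : 0 < a := by positivity
  obtain ⟨C, hC⟩ := exists_tsum_exp_neg_div_sq_le ha0 hy₁
  set e : ℤ → ℝ := fun n => Real.exp (-(a * (n : ℝ) ^ 2)) with he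
  have hes : Summable e := summable_exp_neg_mul_sq ha0
  have hes' : ∀ y, y₁ ≤ y → Summable fun n : ℤ => Real.exp (-(a * ((n : ℝ) ^ 2 / y ^ 2))) := by
    intro y hy
    have hy0 : 0 < y := hy₁.trans_le hy
    refine (summable_exp_neg_mul_sq (a := a / y ^ 2) (by positivity)).congr fun n => ?_
    congr 2; ring
  set G : ℝ → ℤ × ℤ × ℤ → ℝ := fun y n =>
    Real.exp (-(a * ((n.1 : ℝ) ^ 2 / y ^ 2))) * (e n.2.1 * e n.2.2) with hG
  have hee : Summable fun n : ℤ × ℤ => e n.1 * e n.2 :=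
    hes.mul_of_nonneg hes (fun _ => (Real.exp_pos _).le) fun _ => (Real.exp_pos _).le
  have hGs : ∀ y, y₁ ≤ y → Summable (G y) := fun y hy =>
    (hes' y hy).mul_of_nonneg hee (fun _ => (Real.exp_pos _).le) fun _ => by positivity
  have hGnn : ∀ y n, 0 ≤ G y n := fun y n => by positivity
  refine ⟨fun y X => G y (T X), C * ∑' n : ℤ × ℤ, e n.1 * e n.2, fun y hy =>
    ⟨(hGs y hy).comp_injective hT, ?_⟩, ?_⟩
  · calc ∑' X, G y (T X) ≤ ∑' n, G y n :=
        ((hGs y hy).comp_injective hT).tsum_le_tsum_of_inj T hT (fun n _ => hGnn y n)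
          (fun X => le_rfl) (hGs y hy)
      _ = (∑' n : ℤ, Real.exp (-(a * ((n : ℝ) ^ 2 / y ^ 2)))) * ∑' n : ℤ × ℤ, e n.1 * e n.2 :=
        ((hes' y hy).tsum_mul_tsum hee (hGs y hy)).symm
      _ ≤ C * y * ∑' n : ℤ × ℤ, e n.1 * e n.2 := by
        refine mul_le_mul_of_nonneg_right (hC y hy) (tsum_nonneg fun _ => by positivity)
      _ = _ := by ring
  · intro X z y hx hy hzy
    have hy0 : 0 < z.im := hy₁.trans_le hy
    have h := hcb (conjAct σ X) z hx hy
    obtain ⟨h1, h2, h3⟩ := hTX X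
    rw [h1, h2, h3] at h
    simp only [hG, he, ← Real.exp_add]
    apply Real.exp_le_exp.2
    -- The dominating term increases with y, so a single y serves all heights between y₁ and y; this
    -- is what makes the bound locally uniform.
    have h4 : ((T X).1 : ℝ) ^ 2 / y ^ 2 ≤ ((T X).1 : ℝ) ^ 2 / z.im ^ 2 := by gcongr
    have h5 := mul_le_mul_of_nonneg_left h4 ha0.le
    have h6 := mul_le_mul_of_nonneg_left h ht.le
    have h7 : t * (c * (((T X).1 / (2 * N) : ℝ) ^ 2 / z.im ^ 2 + ((T X).2.1 / (2 * N) : ℝ) ^ 2 +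
        ((T X).2.2 / (2 * N) : ℝ) ^ 2)) = a * (((T X).1 : ℝ) ^ 2 / z.im ^ 2) +
        (a * ((T X).2.1 : ℝ) ^ 2 + a * ((T X).2.2 : ℝ) ^ 2) := by
      rw [ha]; field_simp; ring
    linarith

/-! ## Integration over the standard fundamental domain -/

/-- The coordinates `(x, y)` on the upper half plane. -/
def coordsH (z : ℍ) : ℝ × ℝ := (z.re, z.im)

/-- The standard fundamental domain in the coordinates `(x, y)`. -/
def fdCoords : Set (ℝ × ℝ) := {p | 0 < p.2 ∧ 1 ≤ p.1 ^ 2 + p.2 ^ 2 ∧ |p.1| ≤ 1 / 2}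

theorem measurableEmbedding_coordsH : MeasurableEmbedding coordsH :=
  Complex.measurableEquivRealProd.measurableEmbedding.comp measurableEmbedding_coe

theorem image_coordsH_fd : coordsH '' ModularGroup.fd = fdCoords := by
  ext ⟨x, y⟩
  constructor
  · rintro ⟨z, ⟨h1, h2⟩, h⟩
    simp only [coordsH, Prod.mk.injEq] at h
    obtain ⟨rfl, rfl⟩ := h
    refine ⟨z.im_pos, ?_, h2⟩
    rw [Complex.normSq_apply] at h1
    simpa [sq] using h1
  · rintro ⟨h0, h1, h2⟩
    refine ⟨⟨⟨x, y⟩, h0⟩, ⟨?_, h2⟩, rfl⟩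
    rw [Complex.normSq_apply]
    simpa [sq] using h1

theorem measurableSet_fd : MeasurableSet ModularGroup.fd := ModularGroup.isClosed_fd.measurableSet

theorem measurePreserving_coordsH :
    MeasurePreserving coordsH ((volume.comap UpperHalfPlane.coe).restrict ModularGroup.fd)
      (volume.restrict fdCoords) := by
  have h1 : MeasurePreserving UpperHalfPlane.coe (volume.comap UpperHalfPlane.coe)
      (volume.restrict (Set.range UpperHalfPlane.coe)) :=
    ⟨measurable_coe, by rw [measurableEmbedding_coe.map_comap]⟩
  have h2 := h1.restrict_image_emb measurableEmbedding_coe ModularGroup.fd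
  rw [Measure.restrict_restrict (measurableEmbedding_coe.measurableSet_image.2 measurableSet_fd),
    Set.inter_eq_left.2 (Set.image_subset_range _ _)] at h2
  have h3 := (Complex.volume_preserving_equiv_real_prod.restrict_image_emb
    Complex.measurableEquivRealProd.measurableEmbedding (UpperHalfPlane.coe '' ModularGroup.fd)).comp
    h2
  rw [Set.image_image] at h3
  have h4 : (fun z : ℍ => Complex.measurableEquivRealProd (z : ℂ)) = coordsH := rfl
  rw [h4, image_coordsH_fd] at h3
  exact h3

theorem restrict_fd_eq : (volume : Measure ℍ).restrict ModularGroup.fd =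
    ((volume.comap UpperHalfPlane.coe).restrict ModularGroup.fd).withDensity
      fun z ↦ ↑((1 / NNReal.mk z.im z.im_pos.le : NNReal) ^ 2) := by
  rw [volume_def, restrict_withDensity measurableSet_fd]

theorem measurable_density :
    Measurable fun z : ℍ ↦ (1 / NNReal.mk z.im z.im_pos.le : NNReal) ^ 2 := by
  refine Measurable.pow_const (Measurable.div measurable_const ?_) 2
  exact (continuous_im.measurable).subtype_mk

theorem integrableOn_fd_iff (F : ℍ → ℂ) : IntegrableOn F ModularGroup.fd ↔
    IntegrableOn (fun p : ℝ × ℝ => (1 / p.2 ^ 2) • F (ofComplex ⟨p.1, p.2⟩)) fdCoords := by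
  rw [IntegrableOn, restrict_fd_eq, integrable_withDensity_iff_integrable_smul measurable_density,
    IntegrableOn, ← measurePreserving_coordsH.integrable_comp_emb measurableEmbedding_coordsH]
  refine integrable_congr (Eventually.of_forall fun z => ?_)
  have : ofComplex ⟨z.re, z.im⟩ = z := by
    conv_rhs => rw [← ofComplex_apply z]
    rfl
  simp only [Function.comp_apply, coordsH, this, NNReal.smul_def]
  simp

theorem setIntegral_fd (F : ℍ → ℂ) : ∫ z in ModularGroup.fd, F z =
    ∫ p in fdCoords, (1 / p.2 ^ 2) • F (ofComplex ⟨p.1, p.2⟩) := by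
  rw [restrict_fd_eq, integral_withDensity_eq_integral_smul measurable_density,
    ← measurePreserving_coordsH.integral_comp measurableEmbedding_coordsH]
  refine integral_congr_ae (Eventually.of_forall fun z => ?_)
  have : ofComplex ⟨z.re, z.im⟩ = z := by
    conv_rhs => rw [← ofComplex_apply z]
    rfl
  simp only [coordsH, this, NNReal.smul_def]
  simp

theorem half_lt_im_of_mem_fdCoords {p : ℝ × ℝ} (hp : p ∈ fdCoords) : 1 / 2 < p.2 := by
  obtain ⟨h0, h1, h2⟩ := hp
  have : p.1 ^ 2 ≤ (1 / 2) ^ 2 := sq_le_sq' (by linarith [(abs_le.1 h2).1]) (abs_le.1 h2).2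
  nlinarith

theorem measurableSet_fdCoords : MeasurableSet fdCoords := by
  rw [← image_coordsH_fd]
  exact measurableEmbedding_coordsH.measurableSet_image.2 measurableSet_fd

theorem half_lt_im_of_mem_fd {z : ℍ} (hz : z ∈ ModularGroup.fd) : 1 / 2 < z.im := by
  have : coordsH z ∈ fdCoords := image_coordsH_fd ▸ Set.mem_image_of_mem _ hz
  exact half_lt_im_of_mem_fdCoords this

/-- The density y⁻² turns the integrand into y^(-1-ε) on a strip bounded away from the real line.
The exponent 1 - ε is the growth of theta combined with the decay of f. -/
theorem integrableOn_fd_rpow {ε : ℝ} (hε : 0 < ε) :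
    IntegrableOn (fun z : ℍ => z.im ^ (1 - ε)) ModularGroup.fd := by
  have h : IntegrableOn (fun z : ℍ => ((z.im ^ (1 - ε) : ℝ) : ℂ)) ModularGroup.fd := by
    rw [integrableOn_fd_iff]
    have h1 : IntegrableOn (fun p : ℝ × ℝ => ((1 : ℝ) * p.2 ^ (-1 - ε) : ℝ))
        (Set.Icc (-(1 / 2) : ℝ) (1 / 2) ×ˢ Set.Ioi (1 / 2 : ℝ)) := by
      rw [IntegrableOn, Measure.volume_eq_prod, ← Measure.prod_restrict]
      exact Integrable.mul_prod (f := fun _ : ℝ => (1 : ℝ)) (g := fun y : ℝ => y ^ (-1 - ε))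
        (by simp) (integrableOn_Ioi_rpow_of_lt (by linarith) (by norm_num))
    have h2 := (h1.mono_set (s := fdCoords) fun p hp =>
      ⟨abs_le.1 hp.2.2, half_lt_im_of_mem_fdCoords hp⟩).ofReal (𝕜 := ℂ)
    refine IntegrableOn.congr_fun h2 (fun p hp => ?_) measurableSet_fdCoords
    have hp2 : 0 < p.2 := hp.1
    rw [ofComplex_apply_of_im_pos (z := ⟨p.1, p.2⟩) hp2, show (-1 - ε) = (1 - ε) - 2 by ring,
      Real.rpow_sub hp2]
    simp [UpperHalfPlane.im]
    field_simp
  exact h.norm.congr (Eventually.of_forall fun z => by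
    simp [abs_of_nonneg (Real.rpow_nonneg z.im_pos.le _)])

theorem continuous_SL_smul (σ : SL(2, ℤ)) : Continuous fun z : ℍ => σ • z :=
  continuous_const_smul (σ : GL (Fin 2) ℝ)

/-! ## Decay on the fundamental domain -/

/-- The asymptotic bound holds above some height; the part of the fundamental domain below it is
compact, and there continuity suffices. -/
theorem exists_decay_on_fd {f : ℍ → ℂ} (hf : Continuous f) (hd : DecaysAtCusps f) (σ : SL(2, ℤ)) :
    ∃ ε C : ℝ, 0 < ε ∧ 0 ≤ C ∧
      ∀ z ∈ ModularGroup.fd, ‖f (σ • z)‖ ≤ C * z.im ^ (-ε) := by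
  obtain ⟨ε, hε, h⟩ := hd σ
  obtain ⟨c, hc⟩ := h.bound
  obtain ⟨A, hA⟩ := (atImInfty_mem _).1 hc
  have hcont : Continuous fun z : ℍ => ‖f (σ • z)‖ / z.im ^ (-ε) := by
    refine ((hf.comp (continuous_SL_smul σ)).norm).div ?_ fun z =>
      (Real.rpow_pos_of_pos z.im_pos _).ne'
    exact continuous_im.rpow_const fun z => Or.inl z.im_ne_zero
  obtain ⟨M, hM⟩ := (ModularGroup.isCompact_truncatedFundamentalDomain A).bddAbove_image
    hcont.continuousOn
  refine ⟨ε, max (max c M) 0, hε, le_max_right _ _, fun z hz => ?_⟩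
  have hpos := Real.rpow_pos_of_pos z.im_pos (-ε)
  rcases le_total A z.im with h1 | h1
  · have := hA z h1
    simp only [Set.mem_ofPred_eq, Real.norm_eq_abs, abs_of_pos hpos] at this
    refine this.trans (mul_le_mul_of_nonneg_right ?_ hpos.le)
    exact (le_max_left _ _).trans (le_max_left _ _)
  · have := hM (Set.mem_image_of_mem _ ⟨hz, h1⟩)
    simp only [div_le_iff₀ hpos] at this
    refine this.trans (mul_le_mul_of_nonneg_right ?_ hpos.le)
    exact (le_max_right _ _).trans (le_max_left _ _)

/-! ## The theta series as sums over the dual lattice -/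

theorem IsFundamentalDiscriminant.ne_zero {D : ℤ} (hD : IsFundamentalDiscriminant D) : D ≠ 0 := by
  rintro rfl
  rcases hD with ⟨h, -⟩ | ⟨m, hm, h, -⟩ <;> omega

/-- Shifting a, b, c by multiples of 2NΔ moves the vector by an element of ΔL, so the residues
modulo 2N|Δ| represent every class. -/
theorem finite_discGroup {N : ℕ} (hN : 0 < N) {D : ℤ} (hD : D ≠ 0) : Finite (DiscGroup N D) := by
  have hN' : (N : ℝ) ≠ 0 := by exact_mod_cast hN.ne'
  set M : ℕ := 2 * N * D.natAbs with hM
  have hMpos : 0 < M := by have := Int.natAbs_pos.2 hD; positivity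
  have : NeZero M := ⟨hMpos.ne'⟩
  let F : Fin M × Fin M × Fin M → DiscGroup N D := fun t =>
    cls N D ⟨formVec N (t.1 : ℕ) (t.2.1 : ℕ) (t.2.2 : ℕ), _, _, _, rfl⟩
  refine Finite.of_surjective F fun δ => ?_
  obtain ⟨⟨X, a, b, c, rfl⟩, rfl⟩ := QuotientAddGroup.mk_surjective δ
  have hM0 : (M : ℤ) ≠ 0 := by exact_mod_cast hMpos.ne'
  have hmod : ∀ n : ℤ, ∃ (i : Fin M) (k : ℤ), n = (i : ℕ) + (2 * N * D) * k := by
    intro n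
    have h1 := Int.emod_nonneg n hM0
    have h2 := Int.emod_lt_of_pos n (by exact_mod_cast hMpos : (0 : ℤ) < M)
    refine ⟨⟨(n % M).toNat, by omega⟩, D.sign * (n / M), ?_⟩
    have h3 := Int.emod_add_mul_ediv n M
    have h4 : (M : ℤ) = 2 * N * D * D.sign := by
      rw [hM, mul_assoc _ D, Int.mul_sign_self]; push_cast; rfl
    simp only [Int.toNat_of_nonneg h1]
    rw [← mul_assoc, ← h4]
    exact h3.symm
  obtain ⟨i, k, hi⟩ := hmod a
  obtain ⟨j, l, hj⟩ := hmod b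
  obtain ⟨m, n, hm⟩ := hmod c
  refine ⟨(i, j, m), ?_⟩
  refine QuotientAddGroup.eq.2 ?_
  rw [AddSubgroup.mem_addSubgroupOf]
  refine ⟨_, ⟨2 * N * k, l, 2 * N * n, rfl⟩, ?_⟩
  subst hi hj hm
  ext p q
  fin_cases p <;> fin_cases q <;> simp [formVec] <;> field_simp <;> ring

theorem exists_norm_psi_le {N : ℕ} (hN : 0 < N) {D : ℤ} (hD : D ≠ 0) (r : ℤ) (h : DiscGroup N 1) :
    ∃ C : ℝ, 0 ≤ C ∧ ∀ δ, ‖psi N D r h δ‖ ≤ C := by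
  have := finite_discGroup hN hD
  obtain ⟨C, hC⟩ := (Set.finite_range fun δ => ‖psi N D r h δ‖).bddAbove
  exact ⟨max C 0, le_max_right _ _, fun δ => (hC ⟨δ, rfl⟩).trans (le_max_left _ _)⟩

theorem conj_psi (N : ℕ) (D r : ℤ) (h : DiscGroup N 1) (δ : DiscGroup N D) :
    conj (psi N D r h δ) = psi N D r h δ := by
  unfold psi; split_ifs <;> simp

/-- The coefficient of `X` in the twisted theta series. -/
def wt (N : ℕ) (D r : ℤ) (h : DiscGroup N 1) (X : dualL N) : ℂ := psi N D r h (cls N D X)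

theorem summable_wt_mul {N : ℕ} (hN : 0 < N) {D : ℤ} (hD : D ≠ 0) (r : ℤ) (h : DiscGroup N 1)
    {g : dualL N → ℂ} (hg : Summable fun X => ‖g X‖) :
    Summable fun X => ‖wt N D r h X * g X‖ := by
  obtain ⟨C, hC, hb⟩ := exists_norm_psi_le hN hD r h
  refine (hg.mul_left C).of_nonneg_of_le (fun _ => norm_nonneg _) fun X => ?_
  rw [norm_mul]
  exact mul_le_mul_of_nonneg_right (hb _) (norm_nonneg _)

/-- Summing over the fibres of L' → L'/ΔL merges the finitely many theta series into one series over
L' with bounded coefficients. All later analysis is done on that series. -/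
theorem twistedTheta_eq_tsum {N : ℕ} (hN : 0 < N) {D : ℤ} (hD : D ≠ 0) (r : ℤ) (h : DiscGroup N 1)
    (φ : Mat → ℍ → ℍ → ℂ) (τ z : ℍ) (hs : Summable fun X : dualL N => ‖φ X τ z‖) :
    twistedTheta N D r φ h τ z = ∑' X : dualL N, wt N D r h X * φ X τ z := by
  have := finite_discGroup hN hD
  have := Fintype.ofFinite (DiscGroup N D)
  have h1 := (summable_wt_mul hN hD r h hs).of_norm.hasSum.tsum_fiberwise (cls N D)
  rw [← h1.tsum_eq, tsum_fintype, twistedTheta, finsum_eq_sum_of_fintype]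
  refine Finset.sum_congr rfl fun δ _ => ?_
  rw [theta, ← tsum_mul_left]
  exact tsum_congr fun X => by rw [wt, show cls N D X.1 = δ from X.2]

/-! ## Differentiation of exponential series and of their integrals -/

/-- The function `e^{iau - bv}` of `w = u + iv`. -/
def expUV (a b : ℝ) (w : ℂ) : ℂ := Complex.exp (Complex.I * (a * w.re : ℝ) - (b * w.im : ℝ))

theorem norm_expUV (a b : ℝ) (w : ℂ) : ‖expUV a b w‖ = Real.exp (-(w.im * b)) := by
  rw [expUV, Complex.norm_exp]
  simp [mul_comm]

theorem conj_expUV (a b : ℝ) (w : ℂ) : conj (expUV a b w) = expUV (-a) b w := by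
  rw [expUV, expUV, ← Complex.exp_conj]
  simp

theorem hasFDerivAt_expUV (a b : ℝ) (w : ℂ) :
    HasFDerivAt (expUV a b) (Complex.reCLM.smulRight (Complex.I * a * expUV a b w) +
      Complex.imCLM.smulRight (-b * expUV a b w)) w := by
  have h1 : HasFDerivAt (fun w : ℂ => Complex.I * (a * w.re : ℝ) - (b * w.im : ℝ))
      (Complex.reCLM.smulRight (Complex.I * a) + Complex.imCLM.smulRight (-b : ℂ)) w := by
    have e : (fun w : ℂ => Complex.I * (a * w.re : ℝ) - (b * w.im : ℝ)) =
        (Complex.reCLM.smulRight (Complex.I * a) + Complex.imCLM.smulRight (-b : ℂ) :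
          ℂ →L[ℝ] ℂ) := by
      ext w; simp; ring
    rw [e]
    exact ContinuousLinearMap.hasFDerivAt _
  have h2 := h1.cexp
  refine h2.congr_fderiv ?_
  ext v
  simp [expUV]
  ring

/-- Half of the exponent absorbs the linear factor that a derivative in τ produces. -/
theorem mul_exp_neg_le {t b : ℝ} (ht : 0 < t) : b * Real.exp (-(t * b)) ≤
    2 / t * Real.exp (-(t / 2 * b)) := by
  have h1 : t / 2 * b ≤ Real.exp (t / 2 * b) := by linarith [Real.add_one_le_exp (t / 2 * b)]
  have h2 : Real.exp (-(t * b)) = Real.exp (-(t / 2 * b)) * Real.exp (-(t / 2 * b)) := by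
    rw [← Real.exp_add]; congr 1; ring
  have h3 : Real.exp (t / 2 * b) * Real.exp (-(t / 2 * b)) = 1 := by
    rw [← Real.exp_add]; simp
  have h4 : b ≤ 2 / t * Real.exp (t / 2 * b) := by
    rw [div_mul_eq_mul_div, le_div_iff₀ ht]; linarith
  calc b * Real.exp (-(t * b)) ≤ 2 / t * Real.exp (t / 2 * b) * Real.exp (-(t * b)) := by gcongr
    _ = 2 / t * (Real.exp (t / 2 * b) * Real.exp (-(t / 2 * b))) * Real.exp (-(t / 2 * b)) := by
      rw [h2]; ring
    _ = _ := by rw [h3, mul_one]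

section series

variable {ι : Type*} {κ : ι → ℂ} {a b : ι → ℝ}

theorem norm_mul_expUV_le (hb : ∀ i, 0 ≤ b i) {t : ℝ} {w : ℂ} (hw : t ≤ w.im) (i : ι) :
    ‖κ i * expUV (a i) (b i) w‖ ≤ ‖κ i‖ * Real.exp (-(t * b i)) := by
  rw [norm_mul, norm_expUV]
  have := mul_le_mul_of_nonneg_right hw (hb i)
  gcongr

theorem norm_mul_mul_expUV_le (hb : ∀ i, 0 ≤ b i) {t : ℝ} (ht : 0 < t) {w : ℂ} (hw : t ≤ w.im)
    {c : ι → ℂ} (hc : ∀ i, ‖c i‖ ≤ b i) (i : ι) :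
    ‖κ i * (c i * expUV (a i) (b i) w)‖ ≤ 2 / t * (‖κ i‖ * Real.exp (-(t / 2 * b i))) := by
  rw [norm_mul, norm_mul, norm_expUV]
  have h := mul_le_mul_of_nonneg_right hw (hb i)
  calc ‖κ i‖ * (‖c i‖ * Real.exp (-(w.im * b i)))
      ≤ ‖κ i‖ * (b i * Real.exp (-(t * b i))) := by
        refine mul_le_mul_of_nonneg_left (mul_le_mul (hc i) ?_ (Real.exp_pos _).le (hb i))
          (norm_nonneg _)
        exact Real.exp_le_exp.2 (by linarith)
    _ ≤ ‖κ i‖ * (2 / t * Real.exp (-(t / 2 * b i))) := by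
        exact mul_le_mul_of_nonneg_left (mul_exp_neg_le ht) (norm_nonneg _)
    _ = _ := by ring

theorem hasFDerivAt_tsum_expUV (hab : ∀ i, |a i| ≤ b i)
    (hs : ∀ t : ℝ, 0 < t → Summable fun i => ‖κ i‖ * Real.exp (-(t * b i)))
    {w : ℂ} (hw : 0 < w.im) :
    HasFDerivAt (fun w : ℂ => ∑' i, κ i * expUV (a i) (b i) w)
      (Complex.reCLM.smulRight (∑' i, κ i * (Complex.I * a i * expUV (a i) (b i) w)) +
       Complex.imCLM.smulRight (∑' i, κ i * (-b i * expUV (a i) (b i) w))) w := by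
  have hb : ∀ i, 0 ≤ b i := fun i => (abs_nonneg _).trans (hab i)
  have hc1 : ∀ i, ‖Complex.I * (a i : ℂ)‖ ≤ b i := fun i => by simpa using hab i
  have hc2 : ∀ i, ‖(-b i : ℂ)‖ ≤ b i := fun i => by simp [abs_of_nonneg (hb i)]
  set t := w.im / 2 with ht
  have ht0 : 0 < t := by positivity
  have htw : t < w.im := by linarith
  have hsum : Summable fun i => 2 / t * (‖κ i‖ * Real.exp (-(t / 2 * b i))) :=
    (hs _ (by positivity)).mul_left _
  have h1 := hasFDerivAt_tsum_of_isPreconnected (𝕜 := ℝ) (x₀ := w) (x := w)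
    (f := fun i (w : ℂ) => κ i * expUV (a i) (b i) w)
    (f' := fun i (w : ℂ) => Complex.reCLM.smulRight (κ i * (Complex.I * a i * expUV (a i) (b i) w))
      + Complex.imCLM.smulRight (κ i * (-b i * expUV (a i) (b i) w)))
    (u := fun i => 2 / t * (‖κ i‖ * Real.exp (-(t / 2 * b i))) +
      2 / t * (‖κ i‖ * Real.exp (-(t / 2 * b i))))
    (s := {w : ℂ | t < w.im}) (hsum.add hsum)
    (isOpen_lt continuous_const Complex.continuous_im)
    (convex_halfSpace_im_gt t).isPreconnected (fun i w _ => ?_) (fun i w hw => ?_) htw ?_ htw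
  · refine h1.congr_fderiv ?_
    have s1 : Summable fun i => κ i * (Complex.I * a i * expUV (a i) (b i) w) :=
      Summable.of_norm_bounded hsum fun i => norm_mul_mul_expUV_le hb ht0 htw.le hc1 i
    have s2 : Summable fun i => κ i * (-b i * expUV (a i) (b i) w) :=
      Summable.of_norm_bounded hsum fun i => norm_mul_mul_expUV_le hb ht0 htw.le hc2 i
    have m1 := (s1.hasSum.mapL (ContinuousLinearMap.smulRightL ℝ ℂ ℂ Complex.reCLM))
    have m2 := (s2.hasSum.mapL (ContinuousLinearMap.smulRightL ℝ ℂ ℂ Complex.imCLM))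
    exact (m1.add m2).tsum_eq
  · have := (hasFDerivAt_expUV (a i) (b i) w).const_mul (κ i)
    refine this.congr_fderiv ?_
    ext v
    simp
    ring
  · refine (norm_add_le _ _).trans (add_le_add ?_ ?_)
    · rw [ContinuousLinearMap.norm_smulRight_apply, Complex.reCLM_norm, one_mul]
      exact norm_mul_mul_expUV_le hb ht0 (le_of_lt hw) hc1 i
    · rw [ContinuousLinearMap.norm_smulRight_apply, Complex.imCLM_norm, one_mul]
      exact norm_mul_mul_expUV_le hb ht0 (le_of_lt hw) hc2 i
  · exact Summable.of_norm_bounded (hs t ht0) fun i => norm_mul_expUV_le hb htw.le i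

end series

/-- Dominated convergence on the half plane Im w' > t with t = Im w / 2. Since the frequencies are
bounded by the decay rates, both partial derivatives are controlled by the absolute series with
exponent t/2, whose integrability is assumed for every positive exponent. -/
theorem hasFDerivAt_integral_tsum_expUV {ι Z : Type*} [Countable ι] [MeasurableSpace Z]
    {μ : Measure Z} {g : Z → ℂ} {κ : ι → Z → ℂ} {a : ι → ℝ} {b : ι → Z → ℝ}
    (hg : Measurable g) (hκ : ∀ i, Measurable (κ i)) (hbm : ∀ i, Measurable (b i))
    (hab : ∀ i z, |a i| ≤ b i z)
    (hs : ∀ t : ℝ, 0 < t → ∀ z, Summable fun i => ‖κ i z‖ * Real.exp (-(t * b i z)))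
    (hi : ∀ t : ℝ, 0 < t →
      Integrable (fun z => ‖g z‖ * ∑' i, ‖κ i z‖ * Real.exp (-(t * b i z))) μ)
    {w : ℂ} (hw : 0 < w.im) :
    HasFDerivAt (fun w : ℂ => ∫ z, g z * ∑' i, κ i z * expUV (a i) (b i z) w ∂μ)
      (Complex.reCLM.smulRight
        (∫ z, g z * ∑' i, κ i z * (Complex.I * a i * expUV (a i) (b i z) w) ∂μ) +
       Complex.imCLM.smulRight
        (∫ z, g z * ∑' i, κ i z * (-b i z * expUV (a i) (b i z) w) ∂μ)) w := by
  have hb : ∀ i z, 0 ≤ b i z := fun i z => (abs_nonneg _).trans (hab i z)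
  have hc1 : ∀ z i, ‖Complex.I * (a i : ℂ)‖ ≤ b i z := fun z i => by simpa using hab i z
  have hc2 : ∀ z i, ‖(-b i z : ℂ)‖ ≤ b i z := fun z i => by simp [abs_of_nonneg (hb i z)]
  have hem : ∀ (w : ℂ) i, Measurable fun z => expUV (a i) (b i z) w := fun w i => by
    unfold expUV
    have := hbm i
    fun_prop
  have hFm : ∀ w : ℂ, Measurable fun z => g z * ∑' i, κ i z * expUV (a i) (b i z) w := fun w =>
    hg.mul (Measurable.tsum fun i => (hκ i).mul (hem w i))
  set t := w.im / 2 with ht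
  have ht0 : 0 < t := by positivity
  have htw : t < w.im := by linarith
  set U : ℂ → Z → ℂ := fun w z => ∑' i, κ i z * (Complex.I * a i * expUV (a i) (b i z) w) with hU
  set V : ℂ → Z → ℂ := fun w z => ∑' i, κ i z * (-b i z * expUV (a i) (b i z) w) with hV
  have hUm : ∀ w, Measurable fun z => g z * U w z := fun w =>
    hg.mul (Measurable.tsum fun i => (hκ i).mul ((hem w i).const_mul _))
  have hVm : ∀ w, Measurable fun z => g z * V w z := fun w =>
    hg.mul (Measurable.tsum fun i => (hκ i).mul
      (((Complex.measurable_ofReal.comp (hbm i)).neg).mul (hem w i)))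
  set B : Z → ℝ := fun z => 2 / t * (‖g z‖ * ∑' i, ‖κ i z‖ * Real.exp (-(t / 2 * b i z))) with hB
  have hBi : Integrable B μ := (hi _ (by positivity)).const_mul _
  have hsum : ∀ z, Summable fun i => 2 / t * (‖κ i z‖ * Real.exp (-(t / 2 * b i z))) := fun z =>
    (hs _ (by positivity) z).mul_left _
  have hUb : ∀ z w, t ≤ w.im → ‖g z * U w z‖ ≤ B z := fun z w hw => by
    rw [norm_mul, hB]
    calc ‖g z‖ * ‖U w z‖ ≤ ‖g z‖ * ∑' i, 2 / t * (‖κ i z‖ * Real.exp (-(t / 2 * b i z))) := by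
          gcongr
          exact tsum_of_norm_bounded (hsum z).hasSum fun i =>
            norm_mul_mul_expUV_le (κ := fun i => κ i z) (a := a) (fun i => hb i z) ht0 hw (hc1 z) i
      _ = _ := by rw [tsum_mul_left]; ring
  have hVb : ∀ z w, t ≤ w.im → ‖g z * V w z‖ ≤ B z := fun z w hw => by
    rw [norm_mul, hB]
    calc ‖g z‖ * ‖V w z‖ ≤ ‖g z‖ * ∑' i, 2 / t * (‖κ i z‖ * Real.exp (-(t / 2 * b i z))) := by
          gcongr
          exact tsum_of_norm_bounded (hsum z).hasSum fun i =>
            norm_mul_mul_expUV_le (κ := fun i => κ i z) (a := a) (fun i => hb i z) ht0 hw (hc2 z) i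
      _ = _ := by rw [tsum_mul_left]; ring
  have hUi : Integrable (fun z => g z * U w z) μ :=
    hBi.mono' (hUm w).aestronglyMeasurable (Eventually.of_forall fun z => hUb z w htw.le)
  have hVi : Integrable (fun z => g z * V w z) μ :=
    hBi.mono' (hVm w).aestronglyMeasurable (Eventually.of_forall fun z => hVb z w htw.le)
  set F' : ℂ → Z → ℂ →L[ℝ] ℂ := fun w z => Complex.reCLM.smulRight (g z * U w z) +
    Complex.imCLM.smulRight (g z * V w z) with hF'
  have i1 : Integrable (fun z => Complex.reCLM.smulRight (g z * U w z)) μ :=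
    (ContinuousLinearMap.smulRightL ℝ ℂ ℂ Complex.reCLM).integrable_comp hUi
  have i2 : Integrable (fun z => Complex.imCLM.smulRight (g z * V w z)) μ :=
    (ContinuousLinearMap.smulRightL ℝ ℂ ℂ Complex.imCLM).integrable_comp hVi
  have hF'm : AEStronglyMeasurable (F' w) μ := by
    exact i1.aestronglyMeasurable.add i2.aestronglyMeasurable
  have key := hasFDerivAt_integral_of_dominated_of_fderiv_le (𝕜 := ℝ) (μ := μ) (x₀ := w)
    (F := fun w z => g z * ∑' i, κ i z * expUV (a i) (b i z) w) (F' := F')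
    (bound := fun z => B z + B z) (s := {w : ℂ | t < w.im})
    ((isOpen_lt continuous_const Complex.continuous_im).mem_nhds htw)
    (Eventually.of_forall fun w => (hFm w).aestronglyMeasurable) ?_ hF'm
    (Eventually.of_forall fun z w hw => ?_) (hBi.add hBi)
    (Eventually.of_forall fun z w hw => ?_)
  · refine key.congr_fderiv ?_
    rw [hF', integral_add i1 i2]
    congr 1
    · exact ((ContinuousLinearMap.smulRightL ℝ ℂ ℂ Complex.reCLM).integral_comp_comm hUi)
    · exact ((ContinuousLinearMap.smulRightL ℝ ℂ ℂ Complex.imCLM).integral_comp_comm hVi)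
  · refine (hi t ht0).mono' (hFm w).aestronglyMeasurable (Eventually.of_forall fun z => ?_)
    rw [norm_mul]
    gcongr
    exact tsum_of_norm_bounded (hs t ht0 z).hasSum fun i =>
      norm_mul_expUV_le (κ := fun i => κ i z) (a := a) (fun i => hb i z) htw.le i
  · refine (norm_add_le _ _).trans (add_le_add ?_ ?_)
    · rw [ContinuousLinearMap.norm_smulRight_apply, Complex.reCLM_norm, one_mul]
      exact hUb z w (le_of_lt hw)
    · rw [ContinuousLinearMap.norm_smulRight_apply, Complex.imCLM_norm, one_mul]
      exact hVb z w (le_of_lt hw)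
  · have h := (hasFDerivAt_tsum_expUV (κ := fun i => κ i z) (a := a) (b := fun i => b i z)
      (fun i => hab i z) (fun t ht => hs t ht z) (ht0.trans hw)).const_mul (g z)
    refine h.congr_fderiv ?_
    ext v
    simp [hF', hU, hV]
    ring

/-! ## Gaussian kernels with weights -/

/-- The constant `π / |Δ|`. -/
def piDiv (D : ℤ) : ℝ := Real.pi / |(D : ℝ)|

theorem piDiv_pos {D : ℤ} (hD : D ≠ 0) : 0 < piDiv D := by
  have : 0 < |(D : ℝ)| := abs_pos.2 (by exact_mod_cast hD)
  exact div_pos Real.pi_pos this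

/-- The kernel `p(X, z) exp((π / |Δ|)(i s u (X, X) - v (X, X)_z))`. -/
def kernel (N : ℕ) (D : ℤ) (s : ℝ) (p : Mat → ℍ → ℝ) (X : Mat) (τ z : ℍ) : ℂ :=
  (p X z : ℂ) * expUV (s * (piDiv D * bil N X X)) (piDiv D * majorant N X z) τ

instance (N : ℕ) : Countable (dualL N) := by
  refine Function.Surjective.countable
    (f := fun t : ℤ × ℤ × ℤ => (⟨formVec N t.1 t.2.1 t.2.2, _, _, _, rfl⟩ : dualL N)) ?_
  rintro ⟨_, a, b, c, rfl⟩
  exact ⟨(a, b, c), rfl⟩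

/-- Weights that are dominated by every exponential of the majorant. -/
structure IsWeight (N : ℕ) (p : Mat → ℍ → ℝ) : Prop where
  measurable : ∀ X : dualL N, Measurable (p X)
  bound : ∀ t : ℝ, 0 < t → ∃ C : ℝ, 0 ≤ C ∧ ∀ (X : dualL N) (z : ℍ),
    |p X z| ≤ C * Real.exp (t * majorant N X z)

theorem majorant_nonneg {N : ℕ} (X : dualL N) (z : ℍ) : 0 ≤ majorant N X z := by
  rw [majorant_eq N (dualL_traceless X)]; exact fM_nonneg _ _ _

theorem measurable_bil_lineGen {N : ℕ} (X : dualL N) :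
    Measurable fun z : ℍ => bil N X (lineGen N z) := by
  simp only [bil_lineGen N (dualL_traceless X), fP]
  fun_prop

theorem abs_bil_le_majorant {N : ℕ} (X : dualL N) (z : ℍ) :
    |bil N (X : Mat) X| ≤ majorant N X z := by
  rw [majorant_eq N (dualL_traceless X)]
  exact abs_bil_le N (dualL_traceless X) z.im_pos

theorem isWeight_const (N : ℕ) (c : ℝ) : IsWeight N fun _ _ => c where
  measurable _ := measurable_const
  bound t ht := ⟨|c|, abs_nonneg _, fun X z => by
    have := Real.one_le_exp (mul_nonneg ht.le (majorant_nonneg X z))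
    nlinarith [abs_nonneg c]⟩

theorem isWeight_majorant (N : ℕ) : IsWeight N (majorant N) where
  measurable X := by
    unfold majorant
    have := measurable_bil_lineGen X
    fun_prop
  bound t ht := ⟨1 / t, by positivity, fun X z => by
    have h := Real.add_one_le_exp (t * majorant N X z)
    rw [abs_of_nonneg (majorant_nonneg X z), div_mul_eq_mul_div, one_mul, le_div_iff₀ ht]
    linarith⟩

theorem isWeight_bil (N : ℕ) : IsWeight N fun X _ => bil N X X where
  measurable _ := measurable_const
  bound t ht := by
    obtain ⟨C, hC, h⟩ := (isWeight_majorant N).bound t ht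
    exact ⟨C, hC, fun X z => (abs_bil_le_majorant X z).trans ((le_abs_self _).trans (h X z))⟩

theorem IsWeight.mul {N : ℕ} {p q : Mat → ℍ → ℝ} (hp : IsWeight N p) (hq : IsWeight N q) :
    IsWeight N fun X z => p X z * q X z where
  measurable X := (hp.measurable X).mul (hq.measurable X)
  bound t ht := by
    obtain ⟨C, hC, h⟩ := hp.bound (t / 2) (by positivity)
    obtain ⟨C', hC', h'⟩ := hq.bound (t / 2) (by positivity)
    refine ⟨C * C', by positivity, fun X z => ?_⟩
    rw [abs_mul]
    refine (mul_le_mul (h X z) (h' X z) (abs_nonneg _) (by positivity)).trans_eq ?_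
    rw [mul_mul_mul_comm, ← Real.exp_add]
    congr 2; ring

theorem IsWeight.add {N : ℕ} {p q : Mat → ℍ → ℝ} (hp : IsWeight N p) (hq : IsWeight N q) :
    IsWeight N fun X z => p X z + q X z where
  measurable X := (hp.measurable X).add (hq.measurable X)
  bound t ht := by
    obtain ⟨C, hC, h⟩ := hp.bound t ht
    obtain ⟨C', hC', h'⟩ := hq.bound t ht
    refine ⟨C + C', by positivity, fun X z => ?_⟩
    rw [add_mul]
    exact (abs_add_le _ _).trans (add_le_add (h X z) (h' X z))

theorem isWeight_sq (N : ℕ) : IsWeight N fun X z => bil N X (lineGen N z) ^ 2 := by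
  have h := (isWeight_majorant N).add (isWeight_bil N)
  have e : (fun (X : Mat) (z : ℍ) => majorant N X z + bil N X X) =
      fun X z => bil N X (lineGen N z) ^ 2 := by
    ext X z; unfold majorant; ring
  rwa [e] at h

/-- The weight is bounded by a constant times half of the Gaussian's exponent, so polynomial factors
in front of the Gaussian cost only a constant. -/
theorem exists_weight_bound {N : ℕ} (hN : 0 < N) {p : Mat → ℍ → ℝ} (hp : IsWeight N p)
    (σ : SL(2, ℤ)) {t : ℝ} (ht : 0 < t) (x₁ : ℝ) {y₁ : ℝ} (hy₁ : 0 < y₁) :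
    ∃ (g : ℝ → dualL N → ℝ) (C : ℝ),
      (∀ y, y₁ ≤ y → Summable (g y) ∧ ∑' X, g y X ≤ C * y) ∧
      ∀ (X : dualL N) (z : ℍ), |z.re| ≤ x₁ → y₁ ≤ z.im →
        |p X (σ • z)| * Real.exp (-(t * majorant N X (σ • z))) ≤ g z.im X := by
  obtain ⟨C, hC, h⟩ := hp.bound (t / 2) (by positivity)
  obtain ⟨g, C', hg, hg'⟩ := exists_gaussian_bound hN σ⁻¹ (half_pos ht) x₁ hy₁
  refine ⟨fun y X => C * g y X, C * C', fun y hy => ⟨(hg y hy).1.mul_left C, ?_⟩, ?_⟩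
  · rw [tsum_mul_left, mul_assoc]
    exact mul_le_mul_of_nonneg_left (hg y hy).2 hC
  · intro X z hx hy
    have h1 := hg' X z z.im hx hy le_rfl
    rw [← fM_smul N σ (dualL_traceless X), ← majorant_eq N (dualL_traceless X)] at h1
    refine le_trans ?_ (mul_le_mul_of_nonneg_left h1 hC)
    calc |p X (σ • z)| * Real.exp (-(t * majorant N X (σ • z)))
        ≤ C * Real.exp (t / 2 * majorant N X (σ • z)) *
          Real.exp (-(t * majorant N X (σ • z))) := by
          gcongr; exact h X _
      _ = _ := by rw [mul_assoc, ← Real.exp_add]; congr 2; ring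

theorem summable_weight {N : ℕ} (hN : 0 < N) {p : Mat → ℍ → ℝ} (hp : IsWeight N p)
    {t : ℝ} (ht : 0 < t) (z : ℍ) :
    Summable fun X : dualL N => |p X z| * Real.exp (-(t * majorant N X z)) := by
  obtain ⟨g, C, hg, h⟩ := exists_weight_bound hN hp 1 ht |z.re| z.im_pos
  simp only [one_smul] at h
  exact (hg z.im le_rfl).1.of_nonneg_of_le (fun _ => by positivity) fun X => h X z le_rfl le_rfl

theorem norm_kernel (N : ℕ) (D : ℤ) (s : ℝ) (p : Mat → ℍ → ℝ) (X : Mat) (τ z : ℍ) :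
    ‖kernel N D s p X τ z‖ = |p X z| * Real.exp (-(τ.im * piDiv D * majorant N X z)) := by
  rw [kernel, norm_mul, norm_expUV, Complex.norm_real, Real.norm_eq_abs, mul_assoc]
  rfl

theorem summable_norm_kernel {N : ℕ} (hN : 0 < N) {D : ℤ} (hD : D ≠ 0) (s : ℝ)
    {p : Mat → ℍ → ℝ} (hp : IsWeight N p) (τ z : ℍ) :
    Summable fun X : dualL N => ‖kernel N D s p X τ z‖ := by
  simp only [norm_kernel]
  exact summable_weight hN hp (mul_pos τ.im_pos (piDiv_pos hD)) z

theorem twistedTheta_kernel {N : ℕ} (hN : 0 < N) {D : ℤ} (hD : D ≠ 0) (r : ℤ) (h : DiscGroup N 1)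
    (s : ℝ) {p : Mat → ℍ → ℝ} (hp : IsWeight N p) (τ z : ℍ) :
    twistedTheta N D r (kernel N D s p) h τ z =
      ∑' X : dualL N, wt N D r h X * kernel N D s p X τ z :=
  twistedTheta_eq_tsum hN hD r h _ τ z (summable_norm_kernel hN hD s hp τ z)

theorem measurable_kernel {N : ℕ} (D : ℤ) (s : ℝ) {p : Mat → ℍ → ℝ} (hp : IsWeight N p)
    (X : dualL N) (τ : ℍ) : Measurable fun z => kernel N D s p X τ z := by
  unfold kernel expUV
  have h1 := hp.measurable X
  have h2 := (isWeight_majorant N).measurable X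
  fun_prop

theorem exists_theta_bound {N : ℕ} (hN : 0 < N) {D : ℤ} (hD : D ≠ 0) (r : ℤ) (h : DiscGroup N 1)
    {p : Mat → ℍ → ℝ} (hp : IsWeight N p) (σ : SL(2, ℤ)) {t : ℝ} (ht : 0 < t) :
    ∃ C : ℝ, ∀ z ∈ ModularGroup.fd,
      ∑' X : dualL N, ‖wt N D r h X * p X (σ • z)‖ * Real.exp (-(t * majorant N X (σ • z)))
        ≤ C * z.im := by
  obtain ⟨Cψ, hCψ, hψ⟩ := exists_norm_psi_le hN hD r h
  obtain ⟨g, C, hg, hgb⟩ := exists_weight_bound hN hp σ ht (1 / 2) one_half_pos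
  refine ⟨Cψ * C, fun z hz => ?_⟩
  have hy := (half_lt_im_of_mem_fd hz).le
  have hb : ∀ X : dualL N, ‖wt N D r h X * p X (σ • z)‖ *
      Real.exp (-(t * majorant N X (σ • z))) ≤ Cψ * g z.im X := fun X => by
    rw [norm_mul, Complex.norm_real, Real.norm_eq_abs, mul_assoc]
    exact mul_le_mul (hψ _) (hgb X z hz.2 hy) (by positivity) hCψ
  have hs := (hg z.im hy).1.mul_left Cψ
  calc _ ≤ ∑' X, Cψ * g z.im X :=
        (hs.of_nonneg_of_le (fun _ => by positivity) hb).tsum_le_tsum hb hs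
    _ ≤ Cψ * C * z.im := by
        rw [tsum_mul_left, mul_assoc]
        exact mul_le_mul_of_nonneg_left (hg z.im hy).2 hCψ

theorem summable_wt_weight {N : ℕ} (hN : 0 < N) {D : ℤ} (hD : D ≠ 0) (r : ℤ) (h : DiscGroup N 1)
    {p : Mat → ℍ → ℝ} (hp : IsWeight N p) {t : ℝ} (ht : 0 < t) (z : ℍ) :
    Summable fun X : dualL N => ‖wt N D r h X * p X z‖ * Real.exp (-(t * majorant N X z)) := by
  refine (summable_wt_mul hN hD r h (g := fun X => p X z * Real.exp (-(t * majorant N X z)))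
    ?_).congr fun X => ?_
  · refine (summable_weight hN hp ht z).congr fun X => ?_
    rw [norm_mul, Complex.norm_real, Real.norm_eq_abs, Complex.norm_real, Real.norm_eq_abs,
      Real.abs_exp]
  · simp only [norm_mul, Complex.norm_real, Real.norm_eq_abs, Real.abs_exp]
    ring

theorem integrable_decay_mul_theta {N : ℕ} (hN : 0 < N) {D : ℤ} (hD : D ≠ 0) (r : ℤ)
    (h : DiscGroup N 1) {p : Mat → ℍ → ℝ} (hp : IsWeight N p) {f : ℍ → ℂ} (hf : Continuous f)
    (hd : DecaysAtCusps f) (σ : SL(2, ℤ)) {t : ℝ} (ht : 0 < t) :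
    IntegrableOn (fun z : ℍ => ‖f (σ • z)‖ * ∑' X : dualL N,
      ‖wt N D r h X * p X (σ • z)‖ * Real.exp (-(t * majorant N X (σ • z)))) ModularGroup.fd := by
  obtain ⟨ε, Cf, hε, hCf, hb⟩ := exists_decay_on_fd hf hd σ
  obtain ⟨C, hC⟩ := exists_theta_bound hN hD r h hp σ ht
  have hm1 : Measurable fun z : ℍ => σ • z := (continuous_SL_smul σ).measurable
  have hm : Measurable fun z : ℍ => ‖f (σ • z)‖ * ∑' X : dualL N,
      ‖wt N D r h X * p X (σ • z)‖ * Real.exp (-(t * majorant N X (σ • z))) := by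
    refine (hf.measurable.comp hm1).norm.mul (Measurable.tsum fun X => ?_)
    have h1 := (hp.measurable X).comp hm1
    have h2 := ((isWeight_majorant N).measurable X).comp hm1
    exact ((Complex.measurable_ofReal.comp h1).const_mul _).norm.mul
      (Real.measurable_exp.comp (h2.const_mul t).neg)
  refine ((integrableOn_fd_rpow hε).const_mul (Cf * C)).mono' hm.aestronglyMeasurable ?_
  refine (ae_restrict_iff' measurableSet_fd).2 (Eventually.of_forall fun z hz => ?_)
  have hy : 0 < z.im := z.im_pos
  have h0 : 0 ≤ ∑' X : dualL N, ‖wt N D r h X * p X (σ • z)‖ *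
      Real.exp (-(t * majorant N X (σ • z))) := tsum_nonneg fun _ => by positivity
  rw [Real.norm_eq_abs, abs_of_nonneg (by positivity)]
  calc _ ≤ (Cf * z.im ^ (-ε)) * (C * z.im) :=
        mul_le_mul (hb z hz) (hC z hz) h0 (by positivity)
    _ = Cf * C * z.im ^ (1 - ε) := by
        rw [sub_eq_add_neg, Real.rpow_add hy, Real.rpow_one]; ring

theorem wt_mul_kernel (N : ℕ) (D r : ℤ) (h : DiscGroup N 1) (s : ℝ) (p : Mat → ℍ → ℝ)
    (X : dualL N) (τ z : ℍ) : wt N D r h X * kernel N D s p X τ z =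
      wt N D r h X * p X z * expUV (s * (piDiv D * bil N (X : Mat) X))
        (piDiv D * majorant N X z) τ := by
  rw [kernel, mul_assoc]

theorem integrableM_kernel {N : ℕ} (hN : 0 < N) {D : ℤ} (hD : D ≠ 0) (r : ℤ) (h : DiscGroup N 1)
    (s : ℝ) {p : Mat → ℍ → ℝ} (hp : IsWeight N p) {f : ℍ → ℂ} (hf : Continuous f)
    (hd : DecaysAtCusps f) (τ : ℍ) :
    IntegrableM N fun z => f z * twistedTheta N D r (kernel N D s p) h τ z := by
  intro c
  simp only [twistedTheta_kernel hN hD r h s hp]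
  have hm1 : Measurable fun z : ℍ => c.out⁻¹ • z := (continuous_SL_smul _).measurable
  refine (integrable_decay_mul_theta hN hD r h hp hf hd c.out⁻¹
    (mul_pos τ.im_pos (piDiv_pos hD))).mono' ?_ (Eventually.of_forall fun z => ?_)
  · refine Measurable.aestronglyMeasurable ?_
    refine (hf.measurable.comp hm1).mul (Measurable.tsum fun X => ?_)
    exact ((measurable_kernel D s hp X τ).comp hm1).const_mul _
  · rw [norm_mul]
    gcongr
    refine tsum_of_norm_bounded (summable_wt_weight hN hD r h hp
      (mul_pos τ.im_pos (piDiv_pos hD)) _).hasSum fun X => ?_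
    rw [norm_mul, norm_kernel, norm_mul, Complex.norm_real, Real.norm_eq_abs, mul_assoc,
      mul_assoc]

theorem finite_quotient {N : ℕ} (hN : 0 < N) : Finite (SL(2, ℤ) ⧸ Gamma0 N) := by
  have : NeZero N := ⟨hN.ne'⟩
  infer_instance

/-- Differentiation in u multiplies the weight by iκs(X,X), and in v by -κ(X,X)_z. The derivatives
are again lifts of the same kind, and the calculus of both lifts becomes algebra of weights. The
condition |s| ≤ 1 keeps the frequency below the decay rate. -/
theorem hasFDerivAt_lift_kernel {N : ℕ} (hN : 0 < N) {D : ℤ} (hD : D ≠ 0) (r : ℤ)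
    (h : DiscGroup N 1) {s : ℝ} (hs : |s| ≤ 1) {p : Mat → ℍ → ℝ} (hp : IsWeight N p) {f : ℍ → ℂ}
    (hf : Continuous f) (hd : DecaysAtCusps f) (τ : ℍ) :
    HasFDerivAt (lift N D r (kernel N D s p) f h ∘ ofComplex)
      (Complex.reCLM.smulRight (Complex.I * (s * piDiv D) *
          lift N D r (kernel N D s fun X z => p X z * bil N X X) f h τ) +
       Complex.imCLM.smulRight (-piDiv D *
          lift N D r (kernel N D s fun X z => p X z * majorant N X z) f h τ)) (τ : ℂ) := by
  have := finite_quotient hN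
  have := Fintype.ofFinite (SL(2, ℤ) ⧸ Gamma0 N)
  have hκ := piDiv_pos hD
  have hτ : 0 < (τ : ℂ).im := τ.im_pos
  have key : ∀ c : SL(2, ℤ) ⧸ Gamma0 N, _ := fun c =>
    hasFDerivAt_integral_tsum_expUV (μ := volume.restrict ModularGroup.fd)
      (g := fun z : ℍ => f (c.out⁻¹ • z))
      (κ := fun (X : dualL N) (z : ℍ) => wt N D r h X * p X (c.out⁻¹ • z))
      (a := fun X => s * (piDiv D * bil N (X : Mat) X))
      (b := fun X z => piDiv D * majorant N X (c.out⁻¹ • z))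
      (hf.comp (continuous_SL_smul _)).measurable
      (fun X => (Complex.measurable_ofReal.comp
        ((hp.measurable X).comp (continuous_SL_smul _).measurable)).const_mul _)
      (fun X => (((isWeight_majorant N).measurable X).comp
        (continuous_SL_smul _).measurable).const_mul _)
      (fun X z => by
        rw [abs_mul, abs_mul, abs_of_pos hκ]
        have h1 := mul_le_mul_of_nonneg_left (abs_bil_le_majorant X (c.out⁻¹ • z)) hκ.le
        have h2 : 0 ≤ piDiv D * |bil N (X : Mat) X| := by positivity
        nlinarith)
      (fun t ht z => by
        simpa only [mul_assoc] using summable_wt_weight hN hD r h hp (mul_pos ht hκ) (c.out⁻¹ • z))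
      (fun t ht => by
        have h1 := integrable_decay_mul_theta hN hD r h hp hf hd c.out⁻¹ (mul_pos ht hκ)
        simp only [mul_assoc] at h1 ⊢
        exact h1) hτ
  have hsum := HasFDerivAt.fun_sum (u := Finset.univ) fun c _ => key c
  refine (hsum.congr_of_eventuallyEq ?_).congr_fderiv ?_
  · filter_upwards [isOpen_upperHalfPlaneSet.mem_nhds hτ] with w hw
    have hw' : ((ofComplex w : ℍ) : ℂ) = w := by rw [ofComplex_apply_of_im_pos hw]
    simp only [Function.comp_apply, TwistedLift.lift, integralM, finsum_eq_sum_of_fintype,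
      twistedTheta_kernel hN hD r h s hp, wt_mul_kernel, hw']
  · simp only [TwistedLift.lift, integralM, finsum_eq_sum_of_fintype,
      twistedTheta_kernel hN hD r h s (hp.mul (isWeight_bil N)),
      twistedTheta_kernel hN hD r h s (hp.mul (isWeight_majorant N)), Finset.sum_add_distrib]
    congr 1
    · ext v
      simp only [sum_apply, ContinuousLinearMap.smulRight_apply,
        Finset.mul_sum, Finset.smul_sum]
      refine Finset.sum_congr rfl fun c _ => ?_
      rw [← integral_const_mul]
      refine congrArg _ (integral_congr_ae (Eventually.of_forall fun z => ?_))
      simp only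
      conv_rhs => rw [mul_left_comm, ← tsum_mul_left]
      congr 1
      refine tsum_congr fun X => ?_
      simp only [kernel]
      push_cast
      ring
    · ext v
      simp only [sum_apply, ContinuousLinearMap.smulRight_apply,
        Finset.mul_sum, Finset.smul_sum]
      refine Finset.sum_congr rfl fun c _ => ?_
      rw [← integral_const_mul]
      refine congrArg _ (integral_congr_ae (Eventually.of_forall fun z => ?_))
      simp only
      conv_rhs => rw [mul_left_comm, ← tsum_mul_left]
      congr 1
      refine tsum_congr fun X => ?_
      simp only [kernel]
      push_cast
      ring

/-! ## The Siegel and Kudla–Millson kernels -/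

theorem phiSiegel_eq (N : ℕ) (D : ℤ) (X : Mat) (τ z : ℍ) :
    phiSiegel N D X τ z = √τ.im * kernel N D (-1) (fun _ _ => 1) X τ z := by
  simp only [phiSiegel, kernel, expUV, piDiv, coe_re, coe_im, Complex.ofReal_one, one_mul]
  congr 2
  push_cast
  ring_nf
  rw [Complex.I_sq]
  ring

/-- The factor exp(2πi Q_Δ τ) has modulus exp(-κv(X,X)) and the Schwartz function contributes
exp(-κv(P² - 2(X,X))); together they decay like exp(-κv(X,X)_z). -/
theorem phiKM_eq (N : ℕ) (D : ℤ) {X : Mat} (hX : X 1 1 = -X 0 0) (τ z : ℍ) :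
    phiKM N D X τ z = (τ.im / |(D : ℝ)| : ℝ) *
        kernel N D 1 (fun X z => bil N X (lineGen N z) ^ 2) X τ z +
      (-(1 / (2 * Real.pi)) : ℝ) * kernel N D 1 (fun _ _ => 1) X τ z := by
  have hsq : √τ.im ^ 2 = τ.im := Real.sq_sqrt τ.im_pos.le
  have h1 : ∀ Y, bil N (√τ.im • X) Y = √τ.im * bil N X Y := fun Y => by simp [bil]; ring
  have h2 : bil N (√τ.im • X) (√τ.im • X) = τ.im * bil N X X := by
    conv_rhs => rw [← hsq]
    simp [bil]; ring
  have h4 : bigR N (√τ.im • X) z =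
      τ.im * (1 / 2 * bil N X (lineGen N z) ^ 2 - bil N X X) := by
    rw [bigR, h2, h1, mul_pow, hsq]; ring
  have h3 : Complex.exp (2 * Real.pi * Complex.I * (quad N X / |(D : ℝ)| : ℝ) * (τ : ℂ)) *
      (Real.exp (-(2 * Real.pi * bigR N (√τ.im • X) z / |(D : ℝ)|)) : ℂ) =
      expUV (1 * (piDiv D * bil N X X)) (piDiv D * majorant N X z) τ := by
    rw [expUV, Complex.ofReal_exp, ← Complex.exp_add, quad_eq N hX]
    congr 1
    simp only [h4, majorant, piDiv, coe_re, coe_im]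
    conv_lhs => rw [← Complex.re_add_im (τ : ℂ)]
    simp only [coe_re, coe_im]
    push_cast
    ring_nf
    rw [Complex.I_sq]
    ring
  rw [phiKM, phi0]
  simp only [kernel, h1, mul_pow, hsq, ← h3]
  push_cast
  ring

theorem IsWeight.const_mul {N : ℕ} {p : Mat → ℍ → ℝ} (hp : IsWeight N p) (c : ℝ) :
    IsWeight N fun X z => c * p X z := (isWeight_const N c).mul hp

theorem kernel_const_mul (N : ℕ) (D : ℤ) (s c : ℝ) (p : Mat → ℍ → ℝ) (X : Mat) (τ z : ℍ) :
    kernel N D s (fun X z => c * p X z) X τ z = c * kernel N D s p X τ z := by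
  simp only [kernel]; push_cast; ring

theorem kernel_add (N : ℕ) (D : ℤ) (s : ℝ) (p q : Mat → ℍ → ℝ) (X : Mat) (τ z : ℍ) :
    kernel N D s (fun X z => p X z + q X z) X τ z =
      kernel N D s p X τ z + kernel N D s q X τ z := by
  simp only [kernel]; push_cast; ring

theorem twistedTheta_congr {N : ℕ} {D r : ℤ} {h : DiscGroup N 1} {φ φ' : Mat → ℍ → ℍ → ℂ} {τ z : ℍ}
    (he : ∀ X : dualL N, φ X τ z = φ' X τ z) :
    twistedTheta N D r φ h τ z = twistedTheta N D r φ' h τ z := by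
  refine finsum_congr fun δ => ?_
  rw [theta, theta]
  exact congrArg _ (tsum_congr fun X => he X.1)

theorem lift_congr {N : ℕ} {D r : ℤ} {h : DiscGroup N 1} {φ φ' : Mat → ℍ → ℍ → ℂ} {f : ℍ → ℂ}
    {τ : ℍ} (he : ∀ (X : dualL N) (z : ℍ), φ X τ z = φ' X τ z) :
    lift N D r φ f h τ = lift N D r φ' f h τ := by
  have e : ∀ z, twistedTheta N D r φ h τ z = twistedTheta N D r φ' h τ z := fun z =>
    finsum_congr fun δ => by
      rw [theta, theta]
      exact congrArg _ (tsum_congr fun X => he X.1 z)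
  simp only [TwistedLift.lift, e]

/-! ### Linearity and complex conjugation of the lifts. -/

section linear

variable {N : ℕ} (hN : 0 < N) {D : ℤ} (hD : D ≠ 0) (r : ℤ) (h : DiscGroup N 1) (s : ℝ)
  {p q : Mat → ℍ → ℝ}

theorem twistedTheta_kernel_const_mul (hN : 0 < N) (hD : D ≠ 0) (hp : IsWeight N p) (c : ℝ)
    (τ z : ℍ) : twistedTheta N D r (kernel N D s fun X z => c * p X z) h τ z =
      c * twistedTheta N D r (kernel N D s p) h τ z := by
  rw [twistedTheta_kernel hN hD r h s hp, twistedTheta_kernel hN hD r h s (hp.const_mul c),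
    ← tsum_mul_left]
  refine tsum_congr fun X => ?_
  rw [kernel_const_mul]; ring

theorem twistedTheta_kernel_add (hN : 0 < N) (hD : D ≠ 0) (hp : IsWeight N p) (hq : IsWeight N q)
    (τ z : ℍ) : twistedTheta N D r (kernel N D s fun X z => p X z + q X z) h τ z =
      twistedTheta N D r (kernel N D s p) h τ z + twistedTheta N D r (kernel N D s q) h τ z := by
  rw [twistedTheta_kernel hN hD r h s hp, twistedTheta_kernel hN hD r h s hq,
    twistedTheta_kernel hN hD r h s (hp.add hq), ← Summable.tsum_add]
  · refine tsum_congr fun X => ?_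
    rw [kernel_add]; ring
  · exact (summable_wt_mul hN hD r h (summable_norm_kernel hN hD s hp τ z)).of_norm
  · exact (summable_wt_mul hN hD r h (summable_norm_kernel hN hD s hq τ z)).of_norm

theorem lift_kernel_const_mul (hN : 0 < N) (hD : D ≠ 0) (hp : IsWeight N p) (c : ℝ)
    (f : ℍ → ℂ) (τ : ℍ) : lift N D r (kernel N D s fun X z => c * p X z) f h τ =
      c * lift N D r (kernel N D s p) f h τ := by
  have := finite_quotient hN
  have := Fintype.ofFinite (SL(2, ℤ) ⧸ Gamma0 N)
  simp only [TwistedLift.lift, integralM, finsum_eq_sum_of_fintype, Finset.mul_sum,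
    twistedTheta_kernel_const_mul r h s hN hD hp, ← integral_const_mul]
  refine Finset.sum_congr rfl fun c _ => congrArg _ (funext fun z => ?_)
  ring

theorem lift_kernel_add (hN : 0 < N) (hD : D ≠ 0) (hp : IsWeight N p) (hq : IsWeight N q)
    {f : ℍ → ℂ} (hf : Continuous f) (hd : DecaysAtCusps f) (τ : ℍ) :
    lift N D r (kernel N D s fun X z => p X z + q X z) f h τ =
      lift N D r (kernel N D s p) f h τ + lift N D r (kernel N D s q) f h τ := by
  have := finite_quotient hN
  have := Fintype.ofFinite (SL(2, ℤ) ⧸ Gamma0 N)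
  simp only [TwistedLift.lift, integralM, finsum_eq_sum_of_fintype, ← Finset.sum_add_distrib,
    twistedTheta_kernel_add r h s hN hD hp hq]
  refine Finset.sum_congr rfl fun c _ => ?_
  rw [← integral_add (integrableM_kernel hN hD r h s hp hf hd τ c)
    (integrableM_kernel hN hD r h s hq hf hd τ c)]
  refine congrArg _ (funext fun z => ?_)
  ring

theorem conj_twistedTheta_kernel (hN : 0 < N) (hD : D ≠ 0) (hp : IsWeight N p) (τ z : ℍ) :
    conj (twistedTheta N D r (kernel N D s p) h τ z) =
      twistedTheta N D r (kernel N D (-s) p) h τ z := by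
  rw [twistedTheta_kernel hN hD r h s hp, twistedTheta_kernel hN hD r h (-s) hp, Complex.conj_tsum]
  refine tsum_congr fun X => ?_
  rw [map_mul, wt, conj_psi, kernel, kernel, map_mul, conj_expUV, Complex.conj_ofReal, neg_mul]

/-- Coefficients and weights are real, so conjugation only changes the sign of the frequency in u.
This exchanges the exponentials of the Siegel (s = -1) and Kudla–Millson (s = 1) kernels. -/
theorem conj_lift_kernel (hN : 0 < N) (hD : D ≠ 0) (hp : IsWeight N p) (f : ℍ → ℂ) (τ : ℍ) :
    conj (lift N D r (kernel N D s p) f h τ) =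
      lift N D r (kernel N D (-s) p) (fun z => conj (f z)) h τ := by
  have := finite_quotient hN
  have := Fintype.ofFinite (SL(2, ℤ) ⧸ Gamma0 N)
  simp only [TwistedLift.lift, integralM, finsum_eq_sum_of_fintype, map_sum]
  refine Finset.sum_congr rfl fun c _ => ?_
  rw [← integral_conj]
  refine congrArg _ (funext fun z => ?_)
  rw [map_mul, conj_twistedTheta_kernel r h s hN hD hp]

end linear

/-! ### The derivatives of the two lifts in τ and the first identity. -/

section lifts

variable {N : ℕ} {D : ℤ} (r : ℤ) (h : DiscGroup N 1)

theorem twistedTheta_phiSiegel (τ z : ℍ) :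
    twistedTheta N D r (phiSiegel N D) h τ z =
      twistedTheta N D r (kernel N D (-1) fun _ _ => √τ.im * 1) h τ z := by
  refine twistedTheta_congr fun X => ?_
  rw [phiSiegel_eq, kernel_const_mul]

theorem twistedTheta_phiKM (τ z : ℍ) :
    twistedTheta N D r (phiKM N D) h τ z =
      twistedTheta N D r (kernel N D 1 fun X z =>
        (τ.im / |(D : ℝ)|) * bil N X (lineGen N z) ^ 2 + (-(1 / (2 * Real.pi))) * 1) h τ z := by
  refine twistedTheta_congr fun X => ?_
  rw [phiKM_eq N D (dualL_traceless X), kernel_add, kernel_const_mul, kernel_const_mul]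

theorem lift_phiSiegel (hN : 0 < N) (hD : D ≠ 0) (f : ℍ → ℂ) (τ : ℍ) :
    lift N D r (phiSiegel N D) f h τ =
      √τ.im * lift N D r (kernel N D (-1) fun _ _ => 1) f h τ := by
  rw [← lift_kernel_const_mul r h _ hN hD (isWeight_const N 1)]
  simp only [TwistedLift.lift, twistedTheta_phiSiegel r h]

theorem lift_phiKM (hN : 0 < N) (hD : D ≠ 0) {f : ℍ → ℂ} (hf : Continuous f)
    (hd : DecaysAtCusps f) (τ : ℍ) :
    lift N D r (phiKM N D) f h τ =
      (τ.im / |(D : ℝ)| : ℝ) *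
        lift N D r (kernel N D 1 fun X z => bil N X (lineGen N z) ^ 2) f h τ +
      (-(1 / (2 * Real.pi)) : ℝ) * lift N D r (kernel N D 1 fun _ _ => 1) f h τ := by
  rw [← lift_kernel_const_mul r h _ hN hD (isWeight_const N 1),
    ← lift_kernel_const_mul r h _ hN hD (isWeight_sq N),
    ← lift_kernel_add r h _ hN hD ((isWeight_sq N).const_mul _) ((isWeight_const N 1).const_mul _)
      hf hd]
  simp only [TwistedLift.lift, twistedTheta_phiKM r h]

theorem hasFDerivAt_sqrt_im {w : ℂ} (hw : 0 < w.im) :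
    HasFDerivAt (fun w : ℂ => (√w.im : ℂ)) (Complex.imCLM.smulRight (1 / (2 * √w.im) : ℂ)) w := by
  have h1 := (Complex.imCLM.hasFDerivAt (x := w)).sqrt (by simpa using hw.ne')
  have h2 := Complex.ofRealCLM.hasFDerivAt.comp w h1
  refine h2.congr_fderiv ?_
  ext v
  simp
  ring

theorem hasFDerivAt_lift_phiSiegel (hN : 0 < N) (hD : D ≠ 0) {f : ℍ → ℂ} (hf : Continuous f)
    (hd : DecaysAtCusps f) (τ : ℍ) :
    HasFDerivAt (lift N D r (phiSiegel N D) f h ∘ ofComplex)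
      (Complex.reCLM.smulRight (-(Complex.I * √τ.im * piDiv D *
          lift N D r (kernel N D (-1) fun X _ => bil N X X) f h τ)) +
       Complex.imCLM.smulRight (1 / (2 * √τ.im) * lift N D r (kernel N D (-1) fun _ _ => 1) f h τ -
        √τ.im * piDiv D * lift N D r (kernel N D (-1) (majorant N)) f h τ)) (τ : ℂ) := by
  have hτ : 0 < (τ : ℂ).im := τ.im_pos
  have h1 := (hasFDerivAt_sqrt_im hτ).mul
    (hasFDerivAt_lift_kernel hN hD r h (s := -1) (by simp) (isWeight_const N 1) hf hd τ)
  refine (h1.congr_of_eventuallyEq ?_).congr_fderiv ?_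
  · filter_upwards [isOpen_upperHalfPlaneSet.mem_nhds hτ] with w hw
    simp only [Function.comp_apply, Pi.mul_apply, lift_phiSiegel r h hN hD, ofComplex_apply_of_im_pos hw]
    rfl
  · ext v
    simp
    ring

theorem hasFDerivAt_lift_phiKM (hN : 0 < N) (hD : D ≠ 0) {f : ℍ → ℂ} (hf : Continuous f)
    (hd : DecaysAtCusps f) (τ : ℍ) :
    HasFDerivAt (lift N D r (phiKM N D) f h ∘ ofComplex)
      (Complex.reCLM.smulRight (Complex.I * piDiv D * (
          (τ.im / |(D : ℝ)| : ℝ) * lift N D r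
            (kernel N D 1 fun X z => bil N X (lineGen N z) ^ 2 * bil N X X) f h τ -
          (1 / (2 * Real.pi) : ℝ) * lift N D r (kernel N D 1 fun X _ => bil N X X) f h τ)) +
       Complex.imCLM.smulRight ((1 / |(D : ℝ)| : ℝ) *
          lift N D r (kernel N D 1 fun X z => bil N X (lineGen N z) ^ 2) f h τ - piDiv D * (
          (τ.im / |(D : ℝ)| : ℝ) * lift N D r
            (kernel N D 1 fun X z => bil N X (lineGen N z) ^ 2 * majorant N X z) f h τ -
          (1 / (2 * Real.pi) : ℝ) * lift N D r (kernel N D 1 (majorant N)) f h τ))) (τ : ℂ) := by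
  have hτ : 0 < (τ : ℂ).im := τ.im_pos
  have h0 : HasFDerivAt (fun w : ℂ => ((w.im / |(D : ℝ)| : ℝ) : ℂ))
      (Complex.imCLM.smulRight ((1 / |(D : ℝ)| : ℝ) : ℂ)) (τ : ℂ) := by
    have e : (fun w : ℂ => ((w.im / |(D : ℝ)| : ℝ) : ℂ)) =
        (Complex.imCLM.smulRight ((1 / |(D : ℝ)| : ℝ) : ℂ) : ℂ →L[ℝ] ℂ) := by
      ext w; simp [div_eq_mul_inv]
    rw [e]
    exact ContinuousLinearMap.hasFDerivAt _
  have h1 := (h0.mul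
    (hasFDerivAt_lift_kernel hN hD r h (s := 1) (by simp) (isWeight_sq N) hf hd τ)).add
    ((hasFDerivAt_lift_kernel hN hD r h (s := 1) (by simp) (isWeight_const N 1) hf hd τ).const_mul
      ((-(1 / (2 * Real.pi)) : ℝ) : ℂ))
  refine (h1.congr_of_eventuallyEq ?_).congr_fderiv ?_
  · filter_upwards [isOpen_upperHalfPlaneSet.mem_nhds hτ] with w hw
    simp only [Function.comp_apply, Pi.add_apply, Pi.mul_apply, lift_phiKM r h hN hD hf hd,
      ofComplex_apply_of_im_pos hw]
    rfl
  · ext v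
    simp
    ring

theorem dbar_eq {F : ℍ → ℂ} {τ : ℍ} {A B : ℂ} (hF : HasFDerivAt (F ∘ ofComplex)
    (Complex.reCLM.smulRight A + Complex.imCLM.smulRight B) (τ : ℂ)) :
    dbar F τ = 1 / 2 * (A + Complex.I * B) := by
  rw [dbar, hF.fderiv]
  simp

theorem continuous_conj_comp {f : ℍ → ℂ} (hf : Continuous f) : Continuous fun z => conj (f z) :=
  Complex.continuous_conj.comp hf

theorem DecaysAtCusps.conj {f : ℍ → ℂ} (hd : DecaysAtCusps f) :
    DecaysAtCusps fun z => conj (f z) := fun σ => by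
  obtain ⟨ε, hε, h⟩ := hd σ
  exact ⟨ε, hε, (Asymptotics.isBigO_norm_left.1 (by
    simpa only [RCLike.norm_conj] using h.norm_left))⟩

theorem liftConverges_phiSiegel (hN : 0 < N) (hD : D ≠ 0) {f : ℍ → ℂ} (hf : Continuous f)
    (hd : DecaysAtCusps f) : LiftConverges N D r (phiSiegel N D) f := by
  refine ⟨fun δ τ z => ?_, fun h τ => ?_, fun h τ =>
    (hasFDerivAt_lift_phiSiegel r h hN hD hf hd τ).differentiableAt⟩
  · simp only [phiSiegel_eq]
    exact ((summable_norm_kernel hN hD (-1) (isWeight_const N 1) τ z).of_norm.subtype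
      {X | cls N D X = δ}).mul_left _
  · simp only [twistedTheta_phiSiegel r h]
    exact integrableM_kernel hN hD r h (-1) ((isWeight_const N 1).const_mul _) hf hd τ

theorem liftConverges_phiKM (hN : 0 < N) (hD : D ≠ 0) {f : ℍ → ℂ} (hf : Continuous f)
    (hd : DecaysAtCusps f) : LiftConverges N D r (phiKM N D) f := by
  refine ⟨fun δ τ z => ?_, fun h τ => ?_, fun h τ =>
    (hasFDerivAt_lift_phiKM r h hN hD hf hd τ).differentiableAt⟩
  · have e : ∀ X : {X : dualL N // cls N D X = δ}, _ := fun X =>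
      phiKM_eq N D (dualL_traceless X.1) τ z
    simp only [e]
    exact (((summable_norm_kernel hN hD 1 (isWeight_sq N) τ z).of_norm.subtype
      {X | cls N D X = δ}).mul_left _).add
      (((summable_norm_kernel hN hD 1 (isWeight_const N 1) τ z).of_norm.subtype
      {X | cls N D X = δ}).mul_left _)
  · simp only [twistedTheta_phiKM r h]
    exact integrableM_kernel hN hD r h 1 (((isWeight_sq N).const_mul _).add
      ((isWeight_const N 1).const_mul _)) hf hd τ

theorem xi_half_liftMaass (hN : 0 < N) (hD : D ≠ 0) {f : ℍ → ℂ} (hf : Continuous f)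
    (hd : DecaysAtCusps f) (τ : ℍ) :
    xi (1 / 2) (liftMaass N D r f) τ =
      (-(Real.pi : ℂ)) • liftKM N D r (fun z => conj (f z)) τ := by
  ext h
  have hv : √τ.im ≠ 0 := (Real.sqrt_pos.2 τ.im_pos).ne'
  have hsq : √τ.im * √τ.im = τ.im := Real.mul_self_sqrt τ.im_pos.le
  have hvc : (√τ.im : ℂ) ≠ 0 := by exact_mod_cast hv
  have hsqc : (√τ.im : ℂ) * √τ.im = τ.im := by exact_mod_cast hsq
  -- In ∂/∂τ̄ the u-derivative gives (X,X) and the v-derivative gives (X,X)_z with the same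
  -- coefficient, and their sum is P². The derivative of √v supplies the constant term of the
  -- Kudla–Millson polynomial.
  have hP : lift N D r (kernel N D (-1) fun X z => bil N X (lineGen N z) ^ 2) f h τ =
      lift N D r (kernel N D (-1) (majorant N)) f h τ +
      lift N D r (kernel N D (-1) fun X _ => bil N X X) f h τ := by
    rw [← lift_kernel_add r h _ hN hD (isWeight_majorant N) (isWeight_bil N) hf hd]
    refine lift_congr fun X z => ?_
    simp only [kernel, majorant]
    push_cast
    ring
  have c1 := conj_lift_kernel r h (-1) hN hD (isWeight_sq N) f τ
  have c2 := conj_lift_kernel r h (-1) hN hD (isWeight_const N 1) f τ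
  rw [neg_neg] at c1 c2
  simp only [xi, Pi.smul_apply, smul_eq_mul, liftMaass, liftKM]
  rw [dbar_eq (hasFDerivAt_lift_phiSiegel r h hN hD hf hd τ),
    lift_phiKM r h hN hD (continuous_conj_comp hf) hd.conj, ← c1, ← c2, hP, ← Real.sqrt_eq_rpow]
  generalize lift N D r (kernel N D (-1) (majorant N)) f h τ = a
  generalize lift N D r (kernel N D (-1) fun X _ => bil N X X) f h τ = b
  generalize lift N D r (kernel N D (-1) fun _ _ => 1) f h τ = c
  have hpi : (Real.pi : ℂ) ≠ 0 := by exact_mod_cast Real.pi_ne_zero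
  simp only [map_mul, map_add, map_sub, map_neg, map_div₀, map_one, map_ofNat, Complex.conj_I,
    Complex.conj_ofReal, piDiv]
  push_cast
  rw [← hsqc]
  field_simp
  ring_nf
  simp only [Complex.I_sq]
  ring

/-- The polynomial by which the Laplace operator acts on `exp (-k (X, X)_z)`. -/
def lapWeight (N : ℕ) (k : ℝ) (X : Mat) (z : ℍ) : ℝ :=
  4 * k ^ 2 * (bil N X (lineGen N z) ^ 2 * (bil N X (lineGen N z) ^ 2 - 2 * bil N X X)) -
    2 * k * (3 * bil N X (lineGen N z) ^ 2 - 2 * bil N X X)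

theorem isWeight_lapWeight (N : ℕ) (k : ℝ) : IsWeight N (lapWeight N k) := by
  have h := (((isWeight_sq N).mul ((isWeight_sq N).add ((isWeight_bil N).const_mul (-2)))).const_mul
    (4 * k ^ 2)).add ((((isWeight_sq N).const_mul 3).add ((isWeight_bil N).const_mul (-2))).const_mul
    (-(2 * k)))
  convert h using 3
  simp only [lapWeight]
  ring

/-- Here ∂/∂τ̄ brings in (X,X)_z - (X,X) = P² - 2(X,X). Up to the factor i/2, the polynomial it
leaves is P²/|Δ| - κ(vP²/|Δ| - 1/2π)(P² - 2(X,X)), and -4πv times this is `lapWeight` at k = κv. The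
identity holds before any eigenvalue equation is used. -/
theorem xi_three_halves_liftKM (hN : 0 < N) (hD : D ≠ 0) {f : ℍ → ℂ} (hf : Continuous f)
    (hd : DecaysAtCusps f) (τ : ℍ) :
    xi (3 / 2) (liftKM N D r f) τ h = -(1 / (4 * Real.pi)) * √τ.im *
      conj (lift N D r (kernel N D 1 (lapWeight N (piDiv D * τ.im))) f h τ) := by
  have hv : √τ.im ≠ 0 := (Real.sqrt_pos.2 τ.im_pos).ne'
  have hpi : (Real.pi : ℂ) ≠ 0 := by exact_mod_cast Real.pi_ne_zero
  have hDc : ((|(D : ℝ)| : ℝ) : ℂ) ≠ 0 := by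
    exact_mod_cast abs_ne_zero.2 (by exact_mod_cast hD)
  have w1 := isWeight_sq N
  have w2 := (isWeight_sq N).mul (isWeight_bil N)
  have w3 := (isWeight_sq N).mul (isWeight_majorant N)
  have w4 := isWeight_bil N
  have w5 := isWeight_majorant N
  set A := piDiv D * (τ.im / |(D : ℝ)|) with hA
  set B := piDiv D * (1 / (2 * Real.pi)) with hB
  have hR : lift N D r (kernel N D 1 (lapWeight N (piDiv D * τ.im))) f h τ =
      (-(4 * Real.pi * τ.im) : ℝ) * (
        (1 / |(D : ℝ)| : ℝ) * lift N D r (kernel N D 1 fun X z => bil N X (lineGen N z) ^ 2) f h τ +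
        (A * lift N D r (kernel N D 1 fun X z => bil N X (lineGen N z) ^ 2 * bil N X X) f h τ +
        ((-A : ℝ) * lift N D r
          (kernel N D 1 fun X z => bil N X (lineGen N z) ^ 2 * majorant N X z) f h τ +
        ((-B : ℝ) * lift N D r (kernel N D 1 fun X _ => bil N X X) f h τ +
        B * lift N D r (kernel N D 1 (majorant N)) f h τ)))) := by
    rw [← lift_kernel_const_mul r h _ hN hD w1, ← lift_kernel_const_mul r h _ hN hD w2,
      ← lift_kernel_const_mul r h _ hN hD w3, ← lift_kernel_const_mul r h _ hN hD w4,
      ← lift_kernel_const_mul r h _ hN hD w5,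
      ← lift_kernel_add r h _ hN hD (w4.const_mul _) (w5.const_mul _) hf hd,
      ← lift_kernel_add r h _ hN hD (w3.const_mul _) ((w4.const_mul _).add (w5.const_mul _)) hf hd,
      ← lift_kernel_add r h _ hN hD (w2.const_mul _) ((w3.const_mul _).add
        ((w4.const_mul _).add (w5.const_mul _))) hf hd,
      ← lift_kernel_add r h _ hN hD (w1.const_mul _) ((w2.const_mul _).add ((w3.const_mul _).add
        ((w4.const_mul _).add (w5.const_mul _)))) hf hd,
      ← lift_kernel_const_mul r h _ hN hD ((w1.const_mul _).add ((w2.const_mul _).add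
        ((w3.const_mul _).add ((w4.const_mul _).add (w5.const_mul _)))))]
    refine lift_congr fun X z => ?_
    simp only [kernel]
    congr 2
    have hDr : |(D : ℝ)| ≠ 0 := abs_ne_zero.2 (by exact_mod_cast hD)
    have := Real.pi_ne_zero
    simp only [lapWeight, majorant, hA, hB, piDiv]
    field_simp
    ring
  have hpow : τ.im ^ (3 / 2 : ℝ) = τ.im * √τ.im := by
    rw [Real.sqrt_eq_rpow, ← Real.rpow_one_add' τ.im_pos.le (by norm_num)]
    norm_num
  simp only [xi, liftKM]
  rw [dbar_eq (hasFDerivAt_lift_phiKM r h hN hD hf hd τ), hR, hpow]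
  generalize lift N D r (kernel N D 1 (majorant N)) f h τ = l1
  generalize lift N D r (kernel N D 1 fun X _ => bil N X X) f h τ = l2
  generalize lift N D r (kernel N D 1 fun X z => bil N X (lineGen N z) ^ 2 * majorant N X z) f h τ
    = l3
  generalize lift N D r (kernel N D 1 fun X z => bil N X (lineGen N z) ^ 2 * bil N X X) f h τ = l4
  generalize lift N D r (kernel N D 1 fun X z => bil N X (lineGen N z) ^ 2) f h τ = l5
  simp only [map_mul, map_add, map_sub, map_div₀, map_one, map_ofNat, Complex.conj_I,
    Complex.conj_ofReal, hA, hB]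
  push_cast
  field_simp
  ring_nf
  simp only [Complex.I_sq]
  ring

end lifts

/-! ## A maximum principle and the decay of periodic eigenfunctions with zero mean -/

/-- If c were positive, ψ - (c/4)t² would still have positive second derivative, hence a local
minimum at 0, and ψ would exceed ψ(0) at nearby points. -/
theorem second_deriv_nonpos_of_isLocalMax {ψ ψ' : ℝ → ℝ} {c : ℝ}
    (h1 : ∀ᶠ t in nhds 0, HasDerivAt ψ (ψ' t) t) (h2 : HasDerivAt ψ' c 0)
    (hm : IsLocalMax ψ 0) : c ≤ 0 := by
  by_contra! hc
  have h0 : ψ' 0 = 0 := hm.hasDerivAt_eq_zero h1.self_of_nhds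
  set χ : ℝ → ℝ := fun t => ψ t - c / 4 * t ^ 2 with hχ
  have hd : ∀ᶠ t in nhds 0, HasDerivAt χ (ψ' t - c / 2 * t) t := h1.mono fun t ht => by
    refine (ht.sub (((hasDerivAt_id t).pow 2).const_mul (c / 4))).congr_deriv ?_
    simp; ring
  have hd0 : deriv χ 0 = 0 := by rw [hd.self_of_nhds.deriv, h0]; simp
  have hdd : deriv (deriv χ) 0 = c / 2 := by
    have e : deriv χ =ᶠ[nhds 0] fun t => ψ' t - c / 2 * t := hd.mono fun t ht => ht.deriv
    rw [e.deriv_eq]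
    refine ((h2.sub ((hasDerivAt_id (0 : ℝ)).const_mul (c / 2))).congr_deriv ?_).deriv
    ring
  have hmin := isLocalMin_of_deriv_deriv_pos (f := χ) (x₀ := 0) (by rw [hdd]; positivity) hd0
    hd.self_of_nhds.continuousAt
  have hev := hmin.and hm
  obtain ⟨δ, hδ, hball⟩ := Metric.eventually_nhds_iff.1 hev
  obtain ⟨ha, hb⟩ := hball (y := δ / 2) (by
    rw [Real.dist_eq, sub_zero, abs_of_pos (by positivity)]; linarith)
  simp only [hχ] at ha
  have : 0 < c / 4 * (δ / 2) ^ 2 := by positivity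
  linarith

/-- The second derivative of |F|² is 2 Re(F̄F'') + 2|F'|², and the last term may be discarded
because it is nonnegative. -/
theorem second_deriv_test_normSq {F F' : ℝ → ℂ} {F'' : ℂ} {b b' : ℝ → ℝ} {b'' : ℝ}
    (hF : ∀ᶠ t in nhds 0, HasDerivAt F (F' t) t) (hF' : HasDerivAt F' F'' 0)
    (hb : ∀ᶠ t in nhds 0, HasDerivAt b (b' t) t) (hb' : HasDerivAt b' b'' 0)
    (hm : IsLocalMax (fun t => Complex.normSq (F t) - b t) 0) :
    2 * (conj (F 0) * F'').re ≤ b'' := by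
  have re : ∀ {G : ℝ → ℂ} {G' : ℂ} {t : ℝ}, HasDerivAt G G' t →
      HasDerivAt (fun t => (G t).re) G'.re t := fun hG =>
    (Complex.reCLM.hasFDerivAt.comp_hasDerivAt _ hG)
  have im : ∀ {G : ℝ → ℂ} {G' : ℂ} {t : ℝ}, HasDerivAt G G' t →
      HasDerivAt (fun t => (G t).im) G'.im t := fun hG =>
    (Complex.imCLM.hasFDerivAt.comp_hasDerivAt _ hG)
  have h1 : ∀ᶠ t in nhds 0, HasDerivAt (fun t => Complex.normSq (F t) - b t)
      (2 * ((F t).re * (F' t).re + (F t).im * (F' t).im) - b' t) t := by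
    filter_upwards [hF, hb] with t hFt hbt
    simp only [Complex.normSq_apply]
    refine ((((re hFt).mul (re hFt)).add ((im hFt).mul (im hFt))).sub hbt).congr_deriv ?_
    ring
  have hF0 := hF.self_of_nhds
  have h2 : HasDerivAt (fun t => 2 * ((F t).re * (F' t).re + (F t).im * (F' t).im) - b' t)
      (2 * (((F' 0).re * (F' 0).re + (F 0).re * F''.re) +
        ((F' 0).im * (F' 0).im + (F 0).im * F''.im)) - b'') 0 :=
    (((((re hF0).mul (re hF')).add ((im hF0).mul (im hF'))).const_mul 2).sub hb')
  have h3 := second_deriv_nonpos_of_isLocalMax h1 h2 hm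
  simp only [Complex.mul_re, Complex.conj_re, Complex.conj_im]
  nlinarith [mul_self_nonneg (F' 0).re, mul_self_nonneg (F' 0).im]

/-- The open upper half plane as a subset of `ℂ`. -/
def upperSet : Set ℂ := {z : ℂ | 0 < z.im}

theorem isOpen_upperSet : IsOpen upperSet := isOpen_lt continuous_const Complex.continuous_im

section

variable {g : ℂ → ℂ} (hg : ContDiffOn ℝ 2 g upperSet)

include hg

theorem hasFDerivAt_of_contDiffOn {z : ℂ} (hz : z ∈ upperSet) :
    HasFDerivAt g (fderiv ℝ g z) z :=
  ((hg.contDiffAt (isOpen_upperSet.mem_nhds hz)).differentiableAt (by norm_num)).hasFDerivAt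

theorem contDiffOn_fderiv : ContDiffOn ℝ 1 (fderiv ℝ g) upperSet :=
  ((contDiffOn_succ_iff_fderiv_of_isOpen (n := 1) isOpen_upperSet).1 hg).2.2

theorem hasFDerivAt_fderiv {z : ℂ} (hz : z ∈ upperSet) :
    HasFDerivAt (fderiv ℝ g) (fderiv ℝ (fderiv ℝ g) z) z :=
  (((contDiffOn_fderiv hg).contDiffAt (isOpen_upperSet.mem_nhds hz)).differentiableAt
    (by norm_num)).hasFDerivAt

theorem hasDerivAt_line {p v : ℂ} {t : ℝ} (hz : p + t * v ∈ upperSet) :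
    HasDerivAt (fun t : ℝ => g (p + t * v)) (fderiv ℝ g (p + t * v) v) t := by
  have h1 : HasDerivAt (fun t : ℝ => p + t * v) v t := by
    simpa using ((Complex.ofRealCLM.hasDerivAt (x := t)).mul_const v).const_add p
  exact (hasFDerivAt_of_contDiffOn hg hz).comp_hasDerivAt t h1

theorem hasDerivAt_line_fderiv {p v : ℂ} {t : ℝ} (hz : p + t * v ∈ upperSet) :
    HasDerivAt (fun t : ℝ => fderiv ℝ g (p + t * v) v)
      (fderiv ℝ (fderiv ℝ g) (p + t * v) v v) t := by
  have h1 : HasDerivAt (fun t : ℝ => p + t * v) v t := by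
    simpa using ((Complex.ofRealCLM.hasDerivAt (x := t)).mul_const v).const_add p
  have h2 := (hasFDerivAt_fderiv hg hz).comp_hasDerivAt t h1
  exact (ContinuousLinearMap.apply ℝ ℂ v).hasFDerivAt.comp_hasDerivAt t h2

end

theorem laplacian_eq_fderiv (g : ℂ → ℂ) (z : ℂ) : Laplacian.laplacian g z =
    fderiv ℝ (fderiv ℝ g) z 1 1 + fderiv ℝ (fderiv ℝ g) z Complex.I Complex.I := by
  rw [InnerProductSpace.laplacian_eq_iteratedFDeriv_complexPlane]
  simp [iteratedFDeriv_two_apply]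

/-! ### The barrier and the two-point maximum principle. -/

/-- A barrier function. -/
def barrier (κ y₀ M ε : ℝ) (d y : ℝ) : ℝ :=
  Real.cos (κ * d - Real.pi / 4) *
    (M * Real.exp (-(κ * (y - y₀))) + ε * Real.exp (κ * (y - y₀)))

/-- The derivative of `barrier` in the second variable. -/
def barrierY (κ y₀ M ε : ℝ) (d y : ℝ) : ℝ :=
  κ * (Real.cos (κ * d - Real.pi / 4) *
    (-(M * Real.exp (-(κ * (y - y₀)))) + ε * Real.exp (κ * (y - y₀))))

/-- The derivative of `barrier` in the first variable. -/
def barrierD (κ y₀ M ε : ℝ) (d y : ℝ) : ℝ :=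
  -κ * (Real.sin (κ * d - Real.pi / 4) *
    (M * Real.exp (-(κ * (y - y₀))) + ε * Real.exp (κ * (y - y₀))))

section barrier

variable (κ y₀ M ε d y : ℝ)

theorem hasDerivAt_barrier_y : HasDerivAt (barrier κ y₀ M ε d) (barrierY κ y₀ M ε d y) y := by
  have h1 : HasDerivAt (fun y => κ * (y - y₀)) κ y := by
    simpa using ((hasDerivAt_id y).sub_const y₀).const_mul κ
  have h2 : HasDerivAt (fun y => -(κ * (y - y₀))) (-κ) y := h1.neg
  refine (((h2.exp.const_mul M).add (h1.exp.const_mul ε)).const_mul _).congr_deriv ?_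
  simp only [barrierY]
  ring

theorem hasDerivAt_barrierY :
    HasDerivAt (barrierY κ y₀ M ε d) (κ ^ 2 * barrier κ y₀ M ε d y) y := by
  have h1 : HasDerivAt (fun y => κ * (y - y₀)) κ y := by
    simpa using ((hasDerivAt_id y).sub_const y₀).const_mul κ
  have h2 : HasDerivAt (fun y => -(κ * (y - y₀))) (-κ) y := h1.neg
  refine ((((h2.exp.const_mul M).fun_neg.add (h1.exp.const_mul ε)).const_mul _).const_mul
    κ).congr_deriv ?_
  simp only [barrier]
  ring

theorem hasDerivAt_barrier_d :
    HasDerivAt (fun d => barrier κ y₀ M ε d y) (barrierD κ y₀ M ε d y) d := by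
  have h1 : HasDerivAt (fun d => κ * d - Real.pi / 4) κ d := by
    simpa using ((hasDerivAt_id d).const_mul κ).sub_const (Real.pi / 4)
  refine (h1.cos.mul_const _).congr_deriv ?_
  simp only [barrierD]
  ring

theorem hasDerivAt_barrierD :
    HasDerivAt (fun d => barrierD κ y₀ M ε d y) (-κ ^ 2 * barrier κ y₀ M ε d y) d := by
  have h1 : HasDerivAt (fun d => κ * d - Real.pi / 4) κ d := by
    simpa using ((hasDerivAt_id d).const_mul κ).sub_const (Real.pi / 4)
  refine ((h1.sin.mul_const _).const_mul (-κ)).congr_deriv ?_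
  simp only [barrier]
  ring

end barrier

theorem half_le_cos {x : ℝ} (h : |x| ≤ Real.pi / 4) : 1 / 2 ≤ Real.cos x := by
  rw [← Real.cos_abs, ← Real.cos_pi_div_three]
  apply Real.cos_le_cos_of_nonneg_of_le_pi (abs_nonneg _) <;> linarith [Real.pi_pos]

/-- The quotient of the squared two-point difference by the barrier is maximized over (d, b, y). A
maximum above 1 cannot lie at d = 0 or d = P, where periodicity makes the difference vanish, nor at
y = y₀ or y = Y, by the boundary bounds. At an interior maximum the second derivative test
contradicts the eigenvalue equation once κ²y₀² > 2|α|. The choice κ = π/2P keeps the angle κd - π/4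
within ±π/4, so the cosine is at least ½; this is why the boundary bounds carry the factor ½. -/
theorem dist_sq_le_barrier {g : ℂ → ℂ} (hg : ContDiffOn ℝ 2 g upperSet) {α : ℂ}
    (heig : ∀ z ∈ upperSet, Laplacian.laplacian g z = α / z.im ^ 2 * g z)
    {P : ℝ} (hP : 0 < P) (hper : ∀ z ∈ upperSet, g (z + P) = g z)
    {κ : ℝ} (hκ : κ = Real.pi / (2 * P)) {y₀ Y : ℝ} (hy₀ : 0 < y₀) (hα : 2 * ‖α‖ < κ ^ 2 * y₀ ^ 2)
    {M ε : ℝ} (hM : 0 < M) (hε : 0 < ε)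
    (h0 : ∀ a b : ℝ, Complex.normSq (g ⟨a, y₀⟩ - g ⟨b, y₀⟩) ≤ M / 2)
    (hY : ∀ a b : ℝ, Complex.normSq (g ⟨a, Y⟩ - g ⟨b, Y⟩) ≤ ε / 2 * Real.exp (κ * (Y - y₀)))
    {b d y : ℝ} (hd : d ∈ Set.Icc 0 P) (hy : y ∈ Set.Icc y₀ Y) :
    Complex.normSq (g ⟨b + d, y⟩ - g ⟨b, y⟩) ≤ barrier κ y₀ M ε d y := by
  have hκ0 : 0 < κ := by rw [hκ]; have := Real.pi_pos; positivity
  have hcos : ∀ d ∈ Set.Icc 0 P, 1 / 2 ≤ Real.cos (κ * d - Real.pi / 4) := fun d hd => by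
    apply half_le_cos
    have h1 : κ * d ≤ Real.pi / 2 := by
      calc κ * d ≤ κ * P := by gcongr; exact hd.2
        _ = Real.pi / 2 := by rw [hκ]; field_simp
    have h2 : 0 ≤ κ * d := mul_nonneg hκ0.le hd.1
    rw [abs_le]; constructor <;> linarith
  have hBpos : ∀ d ∈ Set.Icc 0 P, ∀ y, 0 < barrier κ y₀ M ε d y := fun d hd y =>
    mul_pos (by linarith [hcos d hd]) (by positivity)
  by_contra! hlt
  -- the maximum of the quotient on a compact set
  have hperG : ∀ y, 0 < y → Function.Periodic (fun x : ℝ => g ⟨x, y⟩) P := fun y hy x => by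
    have := hper ⟨x, y⟩ hy
    simp only
    rw [← this]
    congr 1
    apply Complex.ext <;> simp
  set Q : ℝ × ℝ × ℝ → ℝ := fun t =>
    Complex.normSq (g ⟨t.2.1 + t.1, t.2.2⟩ - g ⟨t.2.1, t.2.2⟩) / barrier κ y₀ M ε t.1 t.2.2 with hQ
  set K : Set (ℝ × ℝ × ℝ) := Set.Icc 0 P ×ˢ Set.Icc 0 P ×ˢ Set.Icc y₀ Y with hK
  have hKc : IsCompact K := isCompact_Icc.prod (isCompact_Icc.prod isCompact_Icc)
  have hgc : ContinuousOn g upperSet := hg.continuousOn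
  have hQc : ContinuousOn Q K := by
    have hin : ∀ (x : ℝ × ℝ × ℝ → ℝ), Continuous x →
        ContinuousOn (fun t : ℝ × ℝ × ℝ => g ⟨x t, t.2.2⟩) K := fun x hx => by
      refine hgc.comp (Continuous.continuousOn ?_) fun t ht => hy₀.trans_le ht.2.2.1
      have e : (fun t : ℝ × ℝ × ℝ => (⟨x t, t.2.2⟩ : ℂ)) =
          fun t => (x t : ℂ) + t.2.2 * Complex.I := by
        ext t; apply Complex.ext <;> simp
      rw [e]
      fun_prop
    refine ContinuousOn.div (Complex.continuous_normSq.comp_continuousOn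
      ((hin (fun t => t.2.1 + t.1) (by fun_prop)).sub (hin (fun t => t.2.1) (by fun_prop)))) ?_
      fun t ht => (hBpos _ ht.1 _).ne'
    unfold barrier
    fun_prop
  -- By periodicity the base point b may be taken in [0, P], so the maximum over the compact set K
  -- controls all real b.
  have hred : ∀ b d y : ℝ, 0 < y → ∃ b' ∈ Set.Icc 0 P,
      g ⟨b' + d, y⟩ - g ⟨b', y⟩ = g ⟨b + d, y⟩ - g ⟨b, y⟩ := fun b d y hy => by
    have h1 : Function.Periodic (fun x : ℝ => g ⟨x + d, y⟩ - g ⟨x, y⟩) P := fun x => by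
      have e1 := hperG y hy (x + d)
      have e2 := hperG y hy x
      simp only at e1 e2 ⊢
      rw [e2, add_right_comm, e1]
    obtain ⟨b', hb', h2⟩ := h1.exists_mem_Ico₀ hP b
    exact ⟨b', Set.Ico_subset_Icc_self hb', h2.symm⟩
  have hy0 : 0 < y := hy₀.trans_le hy.1
  obtain ⟨b', hb', hb'e⟩ := hred b d y hy0
  obtain ⟨⟨d₁, b₁, y₁⟩, ⟨hd₁, hb₁, hy₁⟩, hmax⟩ :=
    hKc.exists_isMaxOn ⟨(d, b', y), hd, hb', hy⟩ hQc
  set t := Q (d₁, b₁, y₁) with ht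
  have ht1 : 1 < t := by
    have h1 := hmax (show (d, b', y) ∈ K from ⟨hd, hb', hy⟩)
    refine lt_of_lt_of_le ?_ h1
    simp only [hQ]
    rwa [one_lt_div (hBpos d hd y), hb'e]
  have hle : ∀ d ∈ Set.Icc 0 P, ∀ b, ∀ y ∈ Set.Icc y₀ Y,
      Complex.normSq (g ⟨b + d, y⟩ - g ⟨b, y⟩) ≤ t * barrier κ y₀ M ε d y := fun d hd b y hy => by
    obtain ⟨b', hb', hb'e⟩ := hred b d y (hy₀.trans_le hy.1)
    have h1 := hmax (show (d, b', y) ∈ K from ⟨hd, hb', hy⟩)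
    rw [← hb'e, ← div_le_iff₀ (hBpos d hd y)]
    exact h1
  have heq : Complex.normSq (g ⟨b₁ + d₁, y₁⟩ - g ⟨b₁, y₁⟩) = t * barrier κ y₀ M ε d₁ y₁ := by
    rw [ht, hQ]
    exact (div_mul_cancel₀ _ (hBpos d₁ hd₁ y₁).ne').symm
  have hpos : 0 < t * barrier κ y₀ M ε d₁ y₁ := mul_pos (by linarith) (hBpos d₁ hd₁ y₁)
  have hy₁0 : 0 < y₁ := hy₀.trans_le hy₁.1
  have hBlt : barrier κ y₀ M ε d₁ y₁ < Complex.normSq (g ⟨b₁ + d₁, y₁⟩ - g ⟨b₁, y₁⟩) := by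
    rw [heq]
    nlinarith [hBpos d₁ hd₁ y₁]
  -- the maximum lies in the interior
  have hd₁' : d₁ ∈ Set.Ioo 0 P := by
    refine ⟨hd₁.1.lt_of_ne ?_, hd₁.2.lt_of_ne ?_⟩
    · rintro rfl
      rw [← heq] at hpos
      simp at hpos
    · rintro rfl
      rw [← heq] at hpos
      have := hperG y₁ hy₁0 b₁
      simp only at this
      rw [this] at hpos
      simp at hpos
  have hcd := hcos d₁ hd₁
  have hy₁' : y₁ ∈ Set.Ioo y₀ Y := by
    refine ⟨hy₁.1.lt_of_ne ?_, hy₁.2.lt_of_ne ?_⟩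
    · rintro rfl
      refine absurd (h0 (b₁ + d₁) b₁) (not_le.2 (lt_of_le_of_lt ?_ hBlt))
      simp only [barrier, sub_self, mul_zero, neg_zero, Real.exp_zero, mul_one]
      nlinarith
    · rintro rfl
      refine absurd (hY (b₁ + d₁) b₁) (not_le.2 (lt_of_le_of_lt ?_ hBlt))
      simp only [barrier]
      have e1 := Real.exp_pos (κ * (y₁ - y₀))
      have e2 := Real.exp_pos (-(κ * (y₁ - y₀)))
      have e3 : 0 < M * Real.exp (-(κ * (y₁ - y₀))) := by positivity
      have e4 : 0 < ε * Real.exp (κ * (y₁ - y₀)) := by positivity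
      nlinarith
  -- the second derivative test in three directions
  set p : ℂ := ⟨b₁ + d₁, y₁⟩ with hp
  set q : ℂ := ⟨b₁, y₁⟩ with hq
  have hpu : ∀ s : ℝ, p + s * 1 ∈ upperSet := fun s => by simp [upperSet, hp, hy₁0]
  have hqu : ∀ s : ℝ, q + s * 1 ∈ upperSet := fun s => by simp [upperSet, hq, hy₁0]
  have ep : p + ((0 : ℝ) : ℂ) * 1 = p := by simp
  have eq : q + ((0 : ℝ) : ℂ) * 1 = q := by simp
  have epI : p + ((0 : ℝ) : ℂ) * Complex.I = p := by simp
  have eqI : q + ((0 : ℝ) : ℂ) * Complex.I = q := by simp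
  have evd : ∀ᶠ s : ℝ in nhds 0, d₁ + s ∈ Set.Icc 0 P := by
    have : Tendsto (fun s : ℝ => d₁ + s) (nhds 0) (nhds (d₁ + 0)) :=
      (continuous_const.add continuous_id).tendsto 0
    rw [add_zero] at this
    exact this.eventually (Icc_mem_nhds hd₁'.1 hd₁'.2)
  have evd' : ∀ᶠ s : ℝ in nhds 0, d₁ - s ∈ Set.Icc 0 P := by
    have : Tendsto (fun s : ℝ => d₁ - s) (nhds 0) (nhds (d₁ - 0)) :=
      (continuous_const.sub continuous_id).tendsto 0
    rw [sub_zero] at this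
    exact this.eventually (Icc_mem_nhds hd₁'.1 hd₁'.2)
  have evy : ∀ᶠ s : ℝ in nhds 0, y₁ + s ∈ Set.Icc y₀ Y := by
    have : Tendsto (fun s : ℝ => y₁ + s) (nhds 0) (nhds (y₁ + 0)) :=
      (continuous_const.add continuous_id).tendsto 0
    rw [add_zero] at this
    exact this.eventually (Icc_mem_nhds hy₁'.1 hy₁'.2)
  -- Only the point p moves horizontally: d grows while b is fixed.
  have t1 := second_deriv_test_normSq (F := fun s : ℝ => g (p + s * 1) - g q)
    (F' := fun s => fderiv ℝ g (p + s * 1) 1)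
    (b := fun s => t * barrier κ y₀ M ε (d₁ + s) y₁)
    (b' := fun s => t * barrierD κ y₀ M ε (d₁ + s) y₁)
    (b'' := t * (-κ ^ 2 * barrier κ y₀ M ε d₁ y₁))
    (Eventually.of_forall fun s => (hasDerivAt_line hg (hpu s)).sub_const _)
    (hasDerivAt_line_fderiv hg (hpu 0))
    (Eventually.of_forall fun s => ((hasDerivAt_barrier_d κ y₀ M ε _ y₁).comp_const_add
      d₁ s).const_mul t)
    (by
      have := ((hasDerivAt_barrierD κ y₀ M ε (d₁ + 0) y₁).comp_const_add d₁ 0).const_mul t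
      simpa only [add_zero] using this)
    (by
      filter_upwards [evd] with s hs
      have h1 := hle _ hs b₁ y₁ hy₁
      have h2 : p + (s : ℂ) * 1 = ⟨b₁ + (d₁ + s), y₁⟩ := by
        apply Complex.ext <;> simp [hp]; ring
      simp only [h2, ep, add_zero]
      linarith)
  -- Only the point q moves: b grows and d shrinks so that b + d is fixed.
  have t2 := second_deriv_test_normSq (F := fun s : ℝ => g p - g (q + s * 1))
    (F' := fun s => -fderiv ℝ g (q + s * 1) 1)
    (b := fun s => t * barrier κ y₀ M ε (d₁ - s) y₁)
    (b' := fun s => t * (-barrierD κ y₀ M ε (d₁ - s) y₁))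
    (b'' := t * (-κ ^ 2 * barrier κ y₀ M ε d₁ y₁))
    (Eventually.of_forall fun s => (hasDerivAt_line hg (hqu s)).const_sub _)
    (hasDerivAt_line_fderiv hg (hqu 0)).neg
    (Eventually.of_forall fun s => ((hasDerivAt_barrier_d κ y₀ M ε _ y₁).comp_const_sub
      d₁ s).const_mul t)
    (by
      have := (((hasDerivAt_barrierD κ y₀ M ε (d₁ - 0) y₁).comp_const_sub d₁ 0).fun_neg).const_mul t
      simpa only [sub_zero, neg_neg] using this)
    (by
      filter_upwards [evd'] with s hs
      have h1 := hle _ hs (b₁ + s) y₁ hy₁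
      have h2 : q + (s : ℂ) * 1 = ⟨b₁ + s, y₁⟩ := by
        apply Complex.ext <;> simp [hq]
      have h3 : p = ⟨b₁ + s + (d₁ - s), y₁⟩ := by
        apply Complex.ext <;> simp [hp]
      rw [← h2, ← h3] at h1
      simp only [eq, sub_zero]
      linarith)
  have hyu : ∀ᶠ s : ℝ in nhds 0, p + s * Complex.I ∈ upperSet ∧ q + s * Complex.I ∈ upperSet := by
    filter_upwards [evy] with s hs
    have : 0 < y₁ + s := hy₀.trans_le hs.1
    exact ⟨by simpa [upperSet, hp] using this, by simpa [upperSet, hq] using this⟩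
  -- Both points rise together. Moving p and q separately in x has counted the concavity -κ² of the
  -- barrier twice, against a single +κ² from the y-direction.
  have t3 := second_deriv_test_normSq (F := fun s : ℝ => g (p + s * Complex.I) - g (q + s * Complex.I))
    (F' := fun s => fderiv ℝ g (p + s * Complex.I) Complex.I -
      fderiv ℝ g (q + s * Complex.I) Complex.I)
    (b := fun s => t * barrier κ y₀ M ε d₁ (y₁ + s))
    (b' := fun s => t * barrierY κ y₀ M ε d₁ (y₁ + s))
    (b'' := t * (κ ^ 2 * barrier κ y₀ M ε d₁ y₁))
    (hyu.mono fun s hs => (hasDerivAt_line hg hs.1).sub (hasDerivAt_line hg hs.2))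
    ((hasDerivAt_line_fderiv hg hyu.self_of_nhds.1).sub
      (hasDerivAt_line_fderiv hg hyu.self_of_nhds.2))
    (Eventually.of_forall fun s => ((hasDerivAt_barrier_y κ y₀ M ε d₁ _).comp_const_add
      y₁ s).const_mul t)
    (by
      have := ((hasDerivAt_barrierY κ y₀ M ε d₁ (y₁ + 0)).comp_const_add y₁ 0).const_mul t
      simpa only [add_zero] using this)
    (by
      filter_upwards [evy] with s hs
      have h1 := hle d₁ hd₁ b₁ _ hs
      have h2 : p + (s : ℂ) * Complex.I = ⟨b₁ + d₁, y₁ + s⟩ := by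
        apply Complex.ext <;> simp [hp]
      have h3 : q + (s : ℂ) * Complex.I = ⟨b₁, y₁ + s⟩ := by
        apply Complex.ext <;> simp [hq]
      simp only [epI, eqI, h2, h3, add_zero]
      linarith)
  have lp := heig p (by simpa using hpu 0)
  have lq := heig q (by simpa using hqu 0)
  rw [laplacian_eq_fderiv] at lp lq
  simp only [ep, eq, epI, eqI] at t1 t2 t3
  set Dz := g p - g q with hDz
  have hsum : fderiv ℝ (fderiv ℝ g) p 1 1 + -fderiv ℝ (fderiv ℝ g) q 1 1 +
      (fderiv ℝ (fderiv ℝ g) p Complex.I Complex.I - fderiv ℝ (fderiv ℝ g) q Complex.I Complex.I)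
      = α / y₁ ^ 2 * Dz := by
    have e1 : p.im = y₁ := rfl
    have e2 : q.im = y₁ := rfl
    rw [e1] at lp
    rw [e2] at lq
    linear_combination lp - lq
  -- The three tests add up to Δg(p) - Δg(q) on the left. Because p and q have the same height, this
  -- is one multiple α/y₁² of the difference.
  have htot : 2 * (conj Dz * (α / y₁ ^ 2 * Dz)).re ≤ -κ ^ 2 * Complex.normSq Dz := by
    rw [heq, ← hsum]
    simp only [mul_add, Complex.add_re]
    linarith
  have e3 : (conj Dz * (α / y₁ ^ 2 * Dz)).re = α.re / y₁ ^ 2 * Complex.normSq Dz := by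
    have : conj Dz * (α / y₁ ^ 2 * Dz) = ((Complex.normSq Dz / y₁ ^ 2 : ℝ) : ℂ) * α := by
      rw [Complex.ofReal_div, Complex.normSq_eq_conj_mul_self]
      push_cast
      ring
    rw [this, Complex.re_ofReal_mul]
    ring
  rw [e3] at htot
  have hn : 0 < Complex.normSq Dz := by rw [heq]; exact hpos
  have e4 : -‖α‖ ≤ α.re := (abs_le.1 (Complex.abs_re_le_norm α)).1
  have e5 : κ ^ 2 ≤ 2 * ‖α‖ / y₁ ^ 2 := by
    have : 2 * (-‖α‖ / y₁ ^ 2) * Complex.normSq Dz ≤ -κ ^ 2 * Complex.normSq Dz := by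
      refine le_trans ?_ htot
      rw [← mul_assoc]
      gcongr
    have := le_of_mul_le_mul_right this hn
    have e6 : 2 * (-‖α‖ / y₁ ^ 2) = -(2 * ‖α‖ / y₁ ^ 2) := by ring
    linarith
  rw [le_div_iff₀ (by positivity)] at e5
  have : κ ^ 2 * y₀ ^ 2 ≤ κ ^ 2 * y₁ ^ 2 := by
    gcongr
    exact hy₁.1
  linarith

theorem periodic_horizontal {g : ℂ → ℂ} {P : ℝ} (hper : ∀ z ∈ upperSet, g (z + P) = g z) {y : ℝ}
    (hy : 0 < y) : Function.Periodic (fun x : ℝ => g ⟨x, y⟩) P := fun x => by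
  have := hper ⟨x, y⟩ hy
  simp only
  rw [← this]
  congr 1
  apply Complex.ext <;> simp

theorem continuous_mk_left (y : ℝ) : Continuous fun x : ℝ => (⟨x, y⟩ : ℂ) := by
  have e : (fun x : ℝ => (⟨x, y⟩ : ℂ)) = fun x : ℝ => (x : ℂ) + y * Complex.I := by
    ext t; apply Complex.ext <;> simp
  rw [e]
  fun_prop

theorem continuous_horizontal {g : ℂ → ℂ} (hg : ContinuousOn g upperSet) {y : ℝ} (hy : 0 < y) :
    Continuous fun x : ℝ => g ⟨x, y⟩ := by
  rw [← continuousOn_univ]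
  exact hg.comp (continuous_mk_left y).continuousOn fun _ _ => hy

/-- Polynomial growth is beaten by the growing part of the barrier at a large height Y, however
small ε is. Letting ε tend to zero leaves only the decaying exponential, and the vanishing mean
passes from differences to g. Of the exponential decay only y⁻¹ is kept. -/
theorem eigenfunction_decay {g : ℂ → ℂ} (hg : ContDiffOn ℝ 2 g upperSet) {α : ℂ}
    (heig : ∀ z ∈ upperSet, Laplacian.laplacian g z = α / z.im ^ 2 * g z)
    {P : ℝ} (hP : 0 < P) (hper : ∀ z ∈ upperSet, g (z + P) = g z)
    (hmean : ∀ y > 0, ∫ x in (0 : ℝ)..P, g ⟨x, y⟩ = 0)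
    {C A y₁ : ℝ} (hgrowth : ∀ x y : ℝ, y₁ ≤ y → ‖g ⟨x, y⟩‖ ≤ C * y ^ A) :
    ∃ C' y₂ : ℝ, ∀ x y : ℝ, y₂ ≤ y → ‖g ⟨x, y⟩‖ ≤ C' * y⁻¹ := by
  set κ := Real.pi / (2 * P) with hκ
  have hκ0 : 0 < κ := by have := Real.pi_pos; positivity
  obtain ⟨y₀, hy₀1, hy₀', hα⟩ : ∃ y₀ : ℝ, 1 ≤ y₀ ∧ y₁ ≤ y₀ ∧ 2 * ‖α‖ < κ ^ 2 * y₀ ^ 2 := by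
    have h1 : Tendsto (fun y : ℝ => κ ^ 2 * y ^ 2) atTop atTop :=
      (tendsto_pow_atTop two_ne_zero).const_mul_atTop (by positivity)
    exact ((eventually_ge_atTop 1).and ((eventually_ge_atTop y₁).and
      (h1.eventually_gt_atTop _))).exists
  have hy₀ : 0 < y₀ := by linarith
  have hsq : ∀ y, y₀ ≤ y → ∀ a b : ℝ, Complex.normSq (g ⟨a, y⟩ - g ⟨b, y⟩) ≤
      4 * (C * y ^ A) ^ 2 := fun y hy a b => by
    rw [Complex.normSq_eq_norm_sq]
    have h1 := hgrowth a y (hy₀'.trans hy)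
    have h2 := hgrowth b y (hy₀'.trans hy)
    have h3 := norm_sub_le (g ⟨a, y⟩) (g ⟨b, y⟩)
    nlinarith [norm_nonneg (g ⟨a, y⟩ - g ⟨b, y⟩), norm_nonneg (g ⟨a, y⟩)]
  set M := 8 * (C * y₀ ^ A) ^ 2 + 1 with hM
  have hM0 : 0 < M := by positivity
  have key : ∀ b d y : ℝ, d ∈ Set.Icc 0 P → y₀ ≤ y →
      Complex.normSq (g ⟨b + d, y⟩ - g ⟨b, y⟩) ≤ M * Real.exp (-(κ * (y - y₀))) := by
    intro b d y hd hy
    refine le_of_forall_pos_le_add fun δ hδ => ?_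
    -- Chosen so that the growing part of the barrier equals at most δ at the given height y.
    set ε := δ * Real.exp (-(κ * (y - y₀))) with hε
    have hε0 : 0 < ε := by positivity
    have hlim : Tendsto (fun Y : ℝ => 4 * C ^ 2 * (Y ^ (A * 2) * Real.exp (-κ * Y))) atTop
        (nhds 0) := by
      simpa using (tendsto_rpow_mul_exp_neg_mul_atTop_nhds_zero (A * 2) κ hκ0).const_mul
        (4 * C ^ 2)
    obtain ⟨Y, hyY, hYl⟩ := ((eventually_ge_atTop y).and (hlim.eventually_lt_const
      (show 0 < ε / 2 * Real.exp (-(κ * y₀)) by positivity))).exists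
    have hY0 : 0 < Y := by linarith
    have hb := dist_sq_le_barrier (Y := Y) (ε := ε) hg heig hP hper hκ hy₀ hα hM0 hε0
      (fun a b => (hsq y₀ le_rfl a b).trans (by rw [hM]; linarith))
      (fun a b => (hsq Y (hy.trans hyY) a b).trans (by
        have e1 : (C * Y ^ A) ^ 2 = C ^ 2 * Y ^ (A * 2) := by
          rw [mul_pow, Real.rpow_mul hY0.le]; norm_cast
        have e2 : Real.exp (κ * (Y - y₀)) = Real.exp (-(κ * y₀)) / Real.exp (-κ * Y) := by
          rw [← Real.exp_sub]; congr 1; ring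
        rw [e1, e2, ← mul_div_assoc, le_div_iff₀ (Real.exp_pos _)]
        linarith)) hd ⟨hy, hyY⟩ (b := b)
    refine hb.trans ?_
    have e3 : ε * Real.exp (κ * (y - y₀)) = δ := by
      rw [hε, mul_assoc, ← Real.exp_add]; simp
    rw [barrier, e3]
    exact mul_le_of_le_one_left (by positivity) (Real.cos_le_one _)
  refine ⟨√M * (Real.exp (κ * y₀ / 2) * (2 / κ)), y₀, fun b y hy => ?_⟩
  have hy0 : 0 < y := by linarith
  have hcont := continuous_horizontal hg.continuousOn hy0
  have hdiff : ∀ d ∈ Set.Icc 0 P, ‖g ⟨b, y⟩ - g ⟨b + d, y⟩‖ ≤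
      √M * Real.exp (-(κ * (y - y₀) / 2)) := fun d hd => by
    have h1 := key b d y hd hy
    rw [Complex.normSq_eq_norm_sq, norm_sub_rev] at h1
    refine le_of_sq_le_sq ?_ (by positivity)
    rw [mul_pow, Real.sq_sqrt hM0.le, ← Real.exp_nat_mul]
    refine h1.trans_eq ?_
    congr 2
    push_cast
    ring
  have hint : ∫ x in (0 : ℝ)..P, g ⟨b + x, y⟩ = 0 := by
    rw [intervalIntegral.integral_comp_add_left (fun x => g ⟨x, y⟩) b, add_zero,
      (periodic_horizontal hper hy0).intervalIntegral_add_eq b 0, zero_add]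
    exact hmean y hy0
  -- The vanishing constant term enters here: g at a point is the average of its differences over a
  -- period.
  have hmul : P * g ⟨b, y⟩ = ∫ x in (0 : ℝ)..P, (g ⟨b, y⟩ - g ⟨b + x, y⟩) := by
    have hc : Continuous fun x : ℝ => g ⟨b + x, y⟩ :=
      hcont.comp (continuous_const.add continuous_id)
    rw [intervalIntegral.integral_sub (continuous_const.intervalIntegrable _ _)
      (hc.intervalIntegrable _ _), hint]
    simp
  have hle : P * ‖g ⟨b, y⟩‖ ≤ √M * Real.exp (-(κ * (y - y₀) / 2)) * P := by
    have h1 := intervalIntegral.norm_integral_le_of_norm_le_const (a := 0) (b := P)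
      (f := fun x => g ⟨b, y⟩ - g ⟨b + x, y⟩) (C := √M * Real.exp (-(κ * (y - y₀) / 2)))
      fun x hx => hdiff x (by rw [Set.uIoc_of_le hP.le] at hx; exact ⟨hx.1.le, hx.2⟩)
    rw [← hmul, norm_mul, Complex.norm_real, Real.norm_of_nonneg hP.le, sub_zero,
      abs_of_pos hP] at h1
    exact h1
  have h2 : ‖g ⟨b, y⟩‖ ≤ √M * Real.exp (-(κ * (y - y₀) / 2)) := by
    rw [mul_comm _ P] at hle
    exact le_of_mul_le_mul_left hle hP
  refine h2.trans ?_
  rw [mul_assoc]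
  gcongr
  have e1 : Real.exp (-(κ * (y - y₀) / 2)) = Real.exp (κ * y₀ / 2) * Real.exp (-(κ * y / 2)) := by
    rw [← Real.exp_add]; congr 1; ring
  rw [e1, mul_assoc]
  gcongr
  rw [Real.exp_neg, ← div_eq_mul_inv, le_div_iff₀ hy0, inv_mul_le_iff₀ (Real.exp_pos _)]
  have h3 : κ * y / 2 ≤ Real.exp (κ * y / 2) := by linarith [Real.add_one_le_exp (κ * y / 2)]
  calc y = κ * y / 2 * (2 / κ) := by field_simp
    _ ≤ _ := by gcongr

/-! ## Composition with Möbius transformations -/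

/-- For holomorphic φ the second derivative along v consists of the Hessian of G at φ'v and a
first-order term in φ''v². The first-order terms cancel between v = 1 and v = i, and φ' acts as a
rotation scaled by |φ'|. -/
theorem laplacian_comp {G φ φ' φ'' : ℂ → ℂ} (hG : ContDiffOn ℝ 2 G upperSet)
    (hφ : ∀ w ∈ upperSet, HasDerivAt φ (φ' w) w)
    (hφ' : ∀ w ∈ upperSet, HasDerivAt φ' (φ'' w) w) (hm : Set.MapsTo φ upperSet upperSet) :
    ContDiffOn ℝ 2 (G ∘ φ) upperSet ∧ ∀ w ∈ upperSet,
      Laplacian.laplacian (G ∘ φ) w = Complex.normSq (φ' w) * Laplacian.laplacian G (φ w) := by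
  have hφc : ContDiffOn ℝ 2 φ upperSet :=
    (DifferentiableOn.contDiffOn (fun w hw => (hφ w hw).differentiableAt.differentiableWithinAt)
      isOpen_upperSet : ContDiffOn ℂ 2 φ upperSet).restrict_scalars ℝ
  have hc : ContDiffOn ℝ 2 (G ∘ φ) upperSet := hG.comp hφc hm
  refine ⟨hc, fun w hw => ?_⟩
  have hline : ∀ v : ℂ, fderiv ℝ (fderiv ℝ (G ∘ φ)) w v v =
      fderiv ℝ (fderiv ℝ G) (φ w) (φ' w * v) (φ' w * v) + fderiv ℝ G (φ w) (φ'' w * v * v) := by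
    intro v
    have h0 : w + ((0 : ℝ) : ℂ) * v = w := by simp
    have hlin : ∀ t : ℝ, HasDerivAt (fun t : ℝ => w + t * v) v t := fun t => by
      simpa using ((Complex.ofRealCLM.hasDerivAt (x := t)).mul_const v).const_add w
    have h1 := hasDerivAt_line_fderiv hc (p := w) (v := v) (t := 0) (by rwa [h0])
    have hev : ∀ᶠ t : ℝ in nhds 0, w + t * v ∈ upperSet := by
      refine (hlin 0).continuousAt.eventually (isOpen_upperSet.mem_nhds ?_)
      simpa using hw
    have h2 : (fun t : ℝ => fderiv ℝ (G ∘ φ) (w + t * v) v) =ᶠ[nhds 0]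
        fun t => fderiv ℝ G (φ (w + t * v)) (φ' (w + t * v) * v) := by
      filter_upwards [hev] with t ht
      have h3 := (hasFDerivAt_of_contDiffOn hG (hm ht)).comp _ (hφ _ ht).complexToReal_fderiv
      rw [h3.fderiv]
      simp
    have ha : HasDerivAt (fun t : ℝ => φ (w + t * v)) (φ' w * v) 0 := by
      have := (hφ (w + ((0 : ℝ) : ℂ) * v) (by rwa [h0])).scomp (0 : ℝ) (hlin 0)
      simpa [Function.comp_def, mul_comm] using this
    have hb : HasDerivAt (fun t : ℝ => φ' (w + t * v)) (φ'' w * v) 0 := by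
      have := (hφ' (w + ((0 : ℝ) : ℂ) * v) (by rwa [h0])).scomp (0 : ℝ) (hlin 0)
      simpa [Function.comp_def, mul_comm] using this
    have hd : HasDerivAt (fun t : ℝ => fderiv ℝ G (φ (w + t * v)))
        (fderiv ℝ (fderiv ℝ G) (φ w) (φ' w * v)) 0 := by
      have h3 := hasFDerivAt_fderiv hG (hm hw)
      rw [← h0] at h3
      have := h3.comp_hasDerivAt (0 : ℝ) ha
      simpa [Function.comp_def] using this
    have h4 := (hd.clm_apply (hb.mul_const v)).congr_of_eventuallyEq h2
    rw [h0] at h1 h4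
    exact h1.unique h4
  rw [laplacian_eq_fderiv, laplacian_eq_fderiv, hline, hline]
  have hII : φ'' w * Complex.I * Complex.I = -(φ'' w * 1 * 1) := by
    rw [mul_assoc, Complex.I_mul_I]; ring
  rw [hII, map_neg]
  set B := fderiv ℝ (fderiv ℝ G) (φ w)
  set p := (φ' w).re
  set q := (φ' w).im
  have e1 : φ' w * 1 = p • (1 : ℂ) + q • Complex.I := by
    rw [mul_one]; apply Complex.ext <;> simp [p, q]
  have e2 : φ' w * Complex.I = (-q) • (1 : ℂ) + p • Complex.I := by
    apply Complex.ext <;> simp [p, q]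
  rw [e1, e2, Complex.normSq_apply]
  simp only [map_add, map_smul, _root_.add_apply, _root_.smul_apply]
  simp only [Complex.real_smul]
  push_cast
  ring

/-- A Möbius transformation as a function on `ℂ`. -/
def mobius (σ : SL(2, ℤ)) (w : ℂ) : ℂ := (σ 0 0 * w + σ 0 1) / (σ 1 0 * w + σ 1 1)

theorem coe_smul_ofComplex (σ : SL(2, ℤ)) {w : ℂ} (hw : w ∈ upperSet) :
    ((σ • ofComplex w : ℍ) : ℂ) = mobius σ w := by
  rw [coe_specialLinearGroup_apply, ofComplex_apply_of_im_pos hw]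
  simp [mobius]

theorem ofComplex_mobius (σ : SL(2, ℤ)) {w : ℂ} (hw : w ∈ upperSet) :
    ofComplex (mobius σ w) = σ • ofComplex w := by
  rw [← coe_smul_ofComplex σ hw, ofComplex_apply]

theorem denom_ne_zero' (σ : SL(2, ℤ)) {w : ℂ} (hw : w ∈ upperSet) :
    (σ 1 0 : ℂ) * w + σ 1 1 ≠ 0 := by
  have := denom_ne_zero (σ : GL (Fin 2) ℝ) (⟨w, hw⟩ : ℍ)
  simpa [denom] using this

theorem mapsTo_mobius (σ : SL(2, ℤ)) : Set.MapsTo (mobius σ) upperSet upperSet := fun w hw => by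
  rw [← coe_smul_ofComplex σ hw]
  exact (σ • ofComplex w).im_pos

theorem hasDerivAt_mobius (σ : SL(2, ℤ)) {w : ℂ} (hw : w ∈ upperSet) :
    HasDerivAt (mobius σ) (1 / (σ 1 0 * w + σ 1 1) ^ 2) w := by
  have hd := denom_ne_zero' σ hw
  have hdet : (σ 0 0 : ℂ) * σ 1 1 - σ 0 1 * σ 1 0 = 1 := by exact_mod_cast det_entries σ
  have h1 : ∀ a b : ℂ, HasDerivAt (fun w : ℂ => a * w + b) a w := fun a b => by
    simpa using ((hasDerivAt_id w).const_mul a).add_const b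
  refine ((h1 _ _).div (h1 _ _) hd).congr_deriv ?_
  congr 1
  linear_combination hdet

theorem hasDerivAt_mobius_deriv (σ : SL(2, ℤ)) {w : ℂ} (hw : w ∈ upperSet) :
    HasDerivAt (fun w : ℂ => 1 / ((σ 1 0 : ℂ) * w + σ 1 1) ^ 2)
      (-(2 * σ 1 0) / (σ 1 0 * w + σ 1 1) ^ 3) w := by
  have hd := denom_ne_zero' σ hw
  have h1 : HasDerivAt (fun w : ℂ => (σ 1 0 : ℂ) * w + σ 1 1) (σ 1 0) w := by
    simpa using ((hasDerivAt_id w).const_mul (σ 1 0 : ℂ)).add_const (σ 1 1 : ℂ)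
  refine ((hasDerivAt_const w (1 : ℂ)).div (h1.pow 2) (pow_ne_zero 2 hd)).congr_deriv ?_
  field_simp
  simp
  ring

theorem im_mobius (σ : SL(2, ℤ)) {w : ℂ} (hw : w ∈ upperSet) :
    (mobius σ w).im = w.im / Complex.normSq (σ 1 0 * w + σ 1 1) := by
  rw [← coe_smul_ofComplex σ hw]
  have := ModularGroup.im_smul_eq_div_normSq σ (ofComplex w)
  rw [coe_im, this, ofComplex_apply_of_im_pos hw]
  simp [denom, im]

/-- The Laplacian acquires |cw+d|⁻⁴ under a Möbius transformation, which is the factor by which the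
square of the imaginary part changes. The eigenvalue equation thus has the same form at every cusp.
-/
theorem IsMaassCuspForm.translate {N : ℕ} {α : ℂ} {f : ℍ → ℂ} (hf : IsMaassCuspForm N α f)
    (σ : SL(2, ℤ)) :
    ContDiffOn ℝ 2 (fun w => f (σ • ofComplex w)) upperSet ∧ ∀ w ∈ upperSet,
      Laplacian.laplacian (fun w => f (σ • ofComplex w)) w = α / w.im ^ 2 * f (σ • ofComplex w) := by
  obtain ⟨h1, h2⟩ := laplacian_comp hf.contDiff (fun w hw => hasDerivAt_mobius σ hw)
    (fun w hw => hasDerivAt_mobius_deriv σ hw) (mapsTo_mobius σ)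
  have he : Set.EqOn (fun w => f (σ • ofComplex w)) ((f ∘ ofComplex) ∘ mobius σ) upperSet :=
    fun w hw => by simp only [Function.comp_apply, ofComplex_mobius σ hw]
  refine ⟨h1.congr he, fun w hw => ?_⟩
  rw [InnerProductSpace.laplacian_congr_nhds
    (he.eventuallyEq_of_mem (isOpen_upperSet.mem_nhds hw)) |>.self_of_nhds, h2 w hw]
  have h3 := hf.eigen (ofComplex (mobius σ w))
  have h4 : ((ofComplex (mobius σ w) : ℍ) : ℂ) = mobius σ w := by
    rw [ofComplex_apply_of_im_pos (mapsTo_mobius σ hw)]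
  have hd := denom_ne_zero' σ hw
  rw [hypLaplacian, ← coe_im, h4, im_mobius σ hw, ofComplex_mobius σ hw] at h3
  have hn : (Complex.normSq ((σ 1 0 : ℂ) * w + σ 1 1) : ℂ) ≠ 0 := by
    exact_mod_cast (Complex.normSq_pos.2 hd).ne'
  have hw0 : (w.im : ℂ) ≠ 0 := by exact_mod_cast (show 0 < w.im from hw).ne'
  rw [Complex.normSq_div, Complex.normSq_one, map_pow]
  push_cast at h3 ⊢
  field_simp at h3 ⊢
  linear_combination h3

/-- Modulo N the matrix Tᴺ is the identity, hence so is every conjugate. This makes each translate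
of f periodic with period N. -/
theorem conj_T_pow_mem_Gamma0 (N : ℕ) (σ : SL(2, ℤ)) :
    σ * ModularGroup.T ^ N * σ⁻¹ ∈ Gamma0 N := by
  rw [Gamma0_mem]
  have h : ((ModularGroup.T ^ N : SL(2, ℤ)) : Matrix (Fin 2) (Fin 2) ℤ) = !![1, (N : ℤ); 0, 1] := by
    exact_mod_cast ModularGroup.coe_T_zpow N
  have : (σ * ModularGroup.T ^ N * σ⁻¹) 1 0 = -(N * σ 1 0 ^ 2) := by
    rw [Matrix.SpecialLinearGroup.coe_mul, Matrix.SpecialLinearGroup.coe_mul, h,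
      Matrix.SpecialLinearGroup.coe_inv]
    simp [Matrix.mul_apply, Fin.sum_univ_two, Matrix.adjugate_fin_two]
    ring
  rw [this]
  simp

theorem ofComplex_mk_add (x t : ℝ) {y : ℝ} (hy : 0 < y) :
    ofComplex ⟨x + t, y⟩ = t +ᵥ ofComplex ⟨x, y⟩ := by
  rw [ofComplex_apply_of_im_pos (show 0 < (⟨x + t, y⟩ : ℂ).im from hy),
    ofComplex_apply_of_im_pos (show 0 < (⟨x, y⟩ : ℂ).im from hy)]
  apply UpperHalfPlane.ext
  apply Complex.ext <;> simp [add_comm]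

theorem IsInvariant.periodic {N : ℕ} {f : ℍ → ℂ} (hf : IsInvariant N f) (σ : SL(2, ℤ)) (z : ℍ) :
    f (σ • ((N : ℝ) +ᵥ z)) = f (σ • z) := by
  have h1 : ((N : ℝ) +ᵥ z) = ModularGroup.T ^ N • z := by
    have := modular_T_zpow_smul z N
    rw [zpow_natCast] at this
    rw [this]; simp
  rw [h1, ← hf _ (conj_T_pow_mem_Gamma0 N σ) (σ • z), ← mul_smul, ← mul_smul]
  simp

theorem IsMaassCuspForm.continuous {N : ℕ} {α : ℂ} {f : ℍ → ℂ} (hf : IsMaassCuspForm N α f) :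
    Continuous f := by
  have h : f = fun z : ℍ => (f ∘ ofComplex) (z : ℂ) := by
    ext z; simp [ofComplex_apply]
  rw [h]
  exact hf.contDiff.continuousOn.comp_continuous continuous_coe fun z => z.im_pos

theorem IsMaassCuspForm.decaysAtCusps {N : ℕ} (hN : 0 < N) {α : ℂ} {f : ℍ → ℂ}
    (hf : IsMaassCuspForm N α f) : DecaysAtCusps f := by
  intro σ
  obtain ⟨A, hA⟩ := hf.moderate σ
  obtain ⟨C, hC⟩ := hA.bound
  obtain ⟨y₁, hy₁⟩ := atImInfty_mem _ |>.1 hC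
  obtain ⟨hc, he⟩ := hf.translate σ
  have hper : ∀ w ∈ upperSet, f (σ • ofComplex (w + (N : ℝ))) = f (σ • ofComplex w) := by
    intro w hw
    have h1 := ofComplex_mk_add w.re N (show 0 < w.im from hw)
    have h2 : (⟨w.re + N, w.im⟩ : ℂ) = w + (N : ℝ) := by apply Complex.ext <;> simp
    rw [← h2, h1, hf.invariant.periodic]
  obtain ⟨C', y₂, hdec⟩ := eigenfunction_decay hc he (P := N) (by positivity) hper
    (fun y hy => by
      rw [← hf.cuspidal σ (ofComplex ⟨0, y⟩)]
      congr 1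
      ext x
      rw [← ofComplex_mk_add 0 x hy, zero_add])
    -- The height y₁ supplied by the filter may be negative; the maximum with 1 ensures y > 0.
    (C := C) (A := A) (y₁ := max y₁ 1) fun x y hy => by
      have hy0 : 0 < y := by linarith [le_max_right y₁ 1]
      have h1 := hy₁ (ofComplex ⟨x, y⟩) (by
        rw [ofComplex_apply_of_im_pos (show 0 < (⟨x, y⟩ : ℂ).im from hy0)]
        exact (le_max_left _ _).trans hy)
      have h3 : (ofComplex ⟨x, y⟩ : ℍ).im = y := by
        rw [ofComplex_apply_of_im_pos (show 0 < (⟨x, y⟩ : ℂ).im from hy0)]; rfl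
      simp only [Set.mem_ofPred_eq, h3, Real.norm_of_nonneg (Real.rpow_nonneg hy0.le A)] at h1
      exact h1
  refine ⟨1, one_pos, Asymptotics.IsBigO.of_bound C' ?_⟩
  refine (atImInfty_mem _).2 ⟨y₂, fun z hz => ?_⟩
  have h1 := hdec z.re z.im hz
  have h2 : (⟨z.re, z.im⟩ : ℂ) = z := rfl
  rw [h2, ofComplex_apply] at h1
  simp only [Set.mem_ofPred_eq]
  rwa [Real.rpow_neg_one, Real.norm_of_nonneg (inv_nonneg.2 z.im_pos.le)]

/-! ## Differentiability of Gaussian series in the variable of the upper half plane -/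

/-- Functions on `ℝ³` dominated by every Gaussian with positive exponent. -/
structure IsTempered (q : ℝ × ℝ × ℝ → ℝ) : Prop where
  continuous : Continuous q
  bound : ∀ t : ℝ, 0 < t → ∃ C : ℝ, 0 ≤ C ∧ ∀ v : ℝ × ℝ × ℝ,
    |q v| ≤ C * Real.exp (t * ((v.1 ^ 2 + v.2.1 ^ 2 + v.2.2 ^ 2) / 2))

theorem isTempered_of_abs_le {q : ℝ × ℝ × ℝ → ℝ} (hq : Continuous q)
    (h : ∀ v : ℝ × ℝ × ℝ, |q v| ≤ 1 + (v.1 ^ 2 + v.2.1 ^ 2 + v.2.2 ^ 2) / 2) : IsTempered q where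
  continuous := hq
  bound t ht := ⟨1 + 1 / t, by positivity, fun v => by
    set m := (v.1 ^ 2 + v.2.1 ^ 2 + v.2.2 ^ 2) / 2 with hm
    have hm0 : 0 ≤ m := by positivity
    have h1 := Real.add_one_le_exp (t * m)
    refine (h v).trans ?_
    have h2 : m ≤ 1 / t * Real.exp (t * m) := by
      rw [div_mul_eq_mul_div, one_mul, le_div_iff₀ ht]; linarith
    have h3 := Real.one_le_exp (mul_nonneg ht.le hm0)
    linarith⟩

theorem IsTempered.mul {q q' : ℝ × ℝ × ℝ → ℝ} (h : IsTempered q) (h' : IsTempered q') :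
    IsTempered fun v => q v * q' v where
  continuous := h.continuous.mul h'.continuous
  bound t ht := by
    obtain ⟨C, hC, hb⟩ := h.bound (t / 2) (by positivity)
    obtain ⟨C', hC', hb'⟩ := h'.bound (t / 2) (by positivity)
    refine ⟨C * C', by positivity, fun v => ?_⟩
    rw [abs_mul]
    refine (mul_le_mul (hb v) (hb' v) (abs_nonneg _) (by positivity)).trans_eq ?_
    rw [mul_mul_mul_comm, ← Real.exp_add]
    congr 2
    ring

theorem IsTempered.add {q q' : ℝ × ℝ × ℝ → ℝ} (h : IsTempered q) (h' : IsTempered q') :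
    IsTempered fun v => q v + q' v where
  continuous := h.continuous.add h'.continuous
  bound t ht := by
    obtain ⟨C, hC, hb⟩ := h.bound t ht
    obtain ⟨C', hC', hb'⟩ := h'.bound t ht
    refine ⟨C + C', by positivity, fun v => (abs_add_le _ _).trans ?_⟩
    rw [add_mul]
    exact add_le_add (hb v) (hb' v)

theorem isTempered_const (c : ℝ) : IsTempered fun _ => c where
  continuous := continuous_const
  bound t ht := ⟨|c|, abs_nonneg c, fun v =>
    le_mul_of_one_le_right (abs_nonneg c) (Real.one_le_exp (by positivity))⟩

theorem isTempered_fst : IsTempered fun v => v.1 :=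
  isTempered_of_abs_le (by fun_prop) fun v => by
    rw [abs_le]; constructor <;> nlinarith [sq_nonneg v.2.1, sq_nonneg v.2.2,
      sq_nonneg (v.1 - 1), sq_nonneg (v.1 + 1)]

theorem isTempered_snd : IsTempered fun v => v.2.1 :=
  isTempered_of_abs_le (by fun_prop) fun v => by
    rw [abs_le]; constructor <;> nlinarith [sq_nonneg v.1, sq_nonneg v.2.2,
      sq_nonneg (v.2.1 - 1), sq_nonneg (v.2.1 + 1)]

theorem isTempered_thd : IsTempered fun v => v.2.2 :=
  isTempered_of_abs_le (by fun_prop) fun v => by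
    rw [abs_le]; constructor <;> nlinarith [sq_nonneg v.1, sq_nonneg v.2.1,
      sq_nonneg (v.2.2 - 1), sq_nonneg (v.2.2 + 1)]

/-! ### Weighted Gaussian series and their derivatives in z. -/

/-- A weighted Gaussian of the majorant. -/
def gTerm (N : ℕ) (k : ℝ) (q : ℝ × ℝ × ℝ → ℝ) (X : Mat) (z : ℂ) : ℝ :=
  q (fP N X z, fA N X z, fB N X z) * Real.exp (-(k * fM N X z))

/-- The series of weighted Gaussians over the conjugate of the dual lattice by `σ`. -/
def gSeries (N : ℕ) (k : ℝ) (σ : SL(2, ℤ)) (b : dualL N → ℂ) (q : ℝ × ℝ × ℝ → ℝ) (z : ℂ) : ℂ :=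
  ∑' X : dualL N, b X * gTerm N k q (conjAct σ X) z

/-- The real part, as a continuous linear endomorphism of `ℂ`. -/
def cre : ℂ →L[ℝ] ℂ := Complex.ofRealCLM.comp Complex.reCLM

/-- The imaginary part, as a continuous linear endomorphism of `ℂ`. -/
def cim : ℂ →L[ℝ] ℂ := Complex.ofRealCLM.comp Complex.imCLM

/-- An open box in the complex plane. -/
def box (x₁ y₁ y₂ : ℝ) : Set ℂ := {z | -x₁ < z.re ∧ z.re < x₁ ∧ y₁ < z.im ∧ z.im < y₂}

theorem isOpen_box (x₁ y₁ y₂ : ℝ) : IsOpen (box x₁ y₁ y₂) :=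
  (isOpen_lt continuous_const Complex.continuous_re).inter
    ((isOpen_lt Complex.continuous_re continuous_const).inter
      ((isOpen_lt continuous_const Complex.continuous_im).inter
        (isOpen_lt Complex.continuous_im continuous_const)))

theorem convex_box (x₁ y₁ y₂ : ℝ) : Convex ℝ (box x₁ y₁ y₂) :=
  (convex_halfSpace_re_gt _).inter ((convex_halfSpace_re_lt _).inter
    ((convex_halfSpace_im_gt _).inter (convex_halfSpace_im_lt _)))

theorem mem_box {z : ℂ} (hz : z ∈ upperSet) : z ∈ box (|z.re| + 1) (z.im / 2) (2 * z.im) := by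
  have hz : 0 < z.im := hz
  refine ⟨?_, ?_, ?_, ?_⟩ <;> linarith [neg_abs_le z.re, le_abs_self z.re]

theorem hasFDerivAt_re (z : ℂ) : HasFDerivAt Complex.re Complex.reCLM z :=
  Complex.reCLM.hasFDerivAt

theorem hasFDerivAt_im (z : ℂ) : HasFDerivAt Complex.im Complex.imCLM z :=
  Complex.imCLM.hasFDerivAt

section term

variable (N : ℕ) (X : Mat) {z : ℂ} (hz : z ∈ upperSet)

include hz

theorem hasFDerivAt_im_inv : HasFDerivAt (fun w : ℂ => w.im⁻¹)
    ((-(z.im ^ 2)⁻¹) • Complex.imCLM) z :=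
  (hasDerivAt_inv (ne_of_gt hz)).comp_hasFDerivAt z (hasFDerivAt_im z)

theorem hasFDerivAt_fP : HasFDerivAt (fP N X)
    (z.im⁻¹ • (fA N X z • Complex.reCLM + fB N X z • Complex.imCLM)) z := by
  have h0 : z.im ≠ 0 := ne_of_gt hz
  have h1 : HasFDerivAt (fun z : ℂ => -(√N * ((X 1 0 * z.re ^ 2 - 2 * X 0 0 * z.re - X 0 1) *
      z.im⁻¹ + X 1 0 * z.im))) _ z :=
    ((((((((hasFDerivAt_re z).pow 2).const_mul (X 1 0)).sub
    ((hasFDerivAt_re z).const_mul (2 * X 0 0))).sub_const (X 0 1)).mul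
    (hasFDerivAt_im_inv hz)).add ((hasFDerivAt_im z).const_mul (X 1 0))).const_mul √(N : ℝ)).fun_neg
  refine (h1.congr_fderiv ?_)
  ext v
  simp [fA, fB]
  field_simp
  ring

theorem hasFDerivAt_fA : HasFDerivAt (fA N X)
    (z.im⁻¹ • ((fP N X z + fB N X z) • Complex.reCLM)) z := by
  have h0 : z.im ≠ 0 := ne_of_gt hz
  have h1 : HasFDerivAt (fun z : ℂ => -(2 * √N * (X 1 0 * z.re - X 0 0))) _ z :=
    ((((hasFDerivAt_re z).const_mul (X 1 0)).sub_const (X 0 0)).const_mul (2 * √(N : ℝ))).fun_neg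
  refine (h1.congr_fderiv ?_)
  ext v
  simp [fP, fB]
  field_simp
  ring

theorem hasFDerivAt_fB : HasFDerivAt (fB N X)
    (z.im⁻¹ • (-fA N X z • Complex.reCLM + fP N X z • Complex.imCLM)) z := by
  have h0 : z.im ≠ 0 := ne_of_gt hz
  have h1 : HasFDerivAt (fun z : ℂ => √N * ((X 1 0 * z.re ^ 2 - 2 * X 0 0 * z.re - X 0 1) *
      z.im⁻¹ - X 1 0 * z.im)) _ z :=
    (((((((hasFDerivAt_re z).pow 2).const_mul (X 1 0)).sub
    ((hasFDerivAt_re z).const_mul (2 * X 0 0))).sub_const (X 0 1)).mul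
    (hasFDerivAt_im_inv hz)).sub ((hasFDerivAt_im z).const_mul (X 1 0))).const_mul √(N : ℝ)
  refine (h1.congr_fderiv ?_)
  ext v
  simp [fP, fA]
  field_simp
  ring

/-- The operators y∂/∂x and y∂/∂y send (P, A, B) to (A, P+B, -A) and (B, 0, P). Polynomials in P, A,
B times the Gaussian therefore stay in the same family, and M changes only as P² does. -/
theorem hasFDerivAt_exp_fM (k : ℝ) : HasFDerivAt (fun w => Real.exp (-(k * fM N X w)))
    (z.im⁻¹ • ((-(2 * k) * (fP N X z * fA N X z) * Real.exp (-(k * fM N X z))) • Complex.reCLM +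
      (-(2 * k) * (fP N X z * fB N X z) * Real.exp (-(k * fM N X z))) • Complex.imCLM)) z := by
  have h1 : HasFDerivAt (fun w => -(k * ((fP N X w ^ 2 + fA N X w ^ 2 + fB N X w ^ 2) * 2⁻¹))) _ z :=
    ((((((hasFDerivAt_fP N X hz).pow 2).add ((hasFDerivAt_fA N X hz).pow 2)).add
    ((hasFDerivAt_fB N X hz).pow 2)).mul_const 2⁻¹).const_mul k).fun_neg
  refine h1.exp.congr_fderiv ?_
  ext v
  simp [fM, div_eq_mul_inv]
  ring

end term

/-- The weights `q_x, q_y` describe the derivative of the Gaussian term with weight `q`. -/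
def IsGradient (k : ℝ) (q qx qy : ℝ × ℝ × ℝ → ℝ) : Prop :=
  ∀ (N : ℕ) (X : Mat), ∀ z ∈ upperSet, HasFDerivAt (gTerm N k q X)
    (z.im⁻¹ • (gTerm N k qx X z • Complex.reCLM + gTerm N k qy X z • Complex.imCLM)) z

theorem isGradient_one (k : ℝ) : IsGradient k (fun _ => 1)
    (fun v => -(2 * k) * (v.1 * v.2.1)) (fun v => -(2 * k) * (v.1 * v.2.2)) := fun N X z hz => by
  have e : gTerm N k (fun _ => 1) X = fun w => Real.exp (-(k * fM N X w)) := by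
    ext w; simp [gTerm]
  rw [e]
  exact hasFDerivAt_exp_fM N X hz k

theorem isGradient_fst_mul_snd (k : ℝ) : IsGradient k (fun v => -(2 * k) * (v.1 * v.2.1))
    (fun v => -(2 * k) * (v.2.1 * v.2.1 + v.1 * (v.2.2 + v.1) +
      -(2 * k) * ((v.1 * v.1) * (v.2.1 * v.2.1))))
    (fun v => -(2 * k) * (v.2.1 * v.2.2 + -(2 * k) * ((v.1 * v.1) * (v.2.1 * v.2.2)))) :=
  fun N X z hz => by
  refine ((((hasFDerivAt_fP N X hz).mul (hasFDerivAt_fA N X hz)).const_mul (-(2 * k))).mul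
    (hasFDerivAt_exp_fM N X hz k)).congr_fderiv ?_
  ext v
  simp [gTerm]
  ring

theorem isGradient_fst_mul_thd (k : ℝ) : IsGradient k (fun v => -(2 * k) * (v.1 * v.2.2))
    (fun v => -(2 * k) * (v.2.1 * v.2.2 + -1 * (v.1 * v.2.1) +
      -(2 * k) * ((v.1 * v.1) * (v.2.1 * v.2.2))))
    (fun v => -(2 * k) * (v.2.2 * v.2.2 + v.1 * v.1 +
      -(2 * k) * ((v.1 * v.1) * (v.2.2 * v.2.2)))) :=
  fun N X z hz => by
  refine ((((hasFDerivAt_fP N X hz).mul (hasFDerivAt_fB N X hz)).const_mul (-(2 * k))).mul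
    (hasFDerivAt_exp_fM N X hz k)).congr_fderiv ?_
  ext v
  simp [gTerm]
  ring

section series

variable {N : ℕ} (hN : 0 < N) {k : ℝ} (hk : 0 < k) (σ : SL(2, ℤ))

include hN hk

theorem exists_gTerm_bound {q : ℝ × ℝ × ℝ → ℝ} (hq : IsTempered q) (x₁ : ℝ) {y₁ : ℝ}
    (hy₁ : 0 < y₁) : ∃ (g : ℝ → dualL N → ℝ) (C : ℝ),
      (∀ y, y₁ ≤ y → Summable (g y) ∧ ∑' X, g y X ≤ C * y) ∧
      ∀ (X : dualL N) (z : ℂ) (y : ℝ), |z.re| ≤ x₁ → y₁ ≤ z.im → z.im ≤ y →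
        |gTerm N k q (conjAct σ X) z| ≤ g y X := by
  obtain ⟨C', hC', hb⟩ := hq.bound (k / 2) (by positivity)
  obtain ⟨g, C, hg, hgb⟩ := exists_gaussian_bound hN σ (half_pos hk) x₁ hy₁
  refine ⟨fun y X => C' * g y X, C' * C, fun y hy => ⟨(hg y hy).1.mul_left C', ?_⟩,
    fun X z y h1 h2 h3 => ?_⟩
  · rw [tsum_mul_left, mul_assoc]
    exact mul_le_mul_of_nonneg_left (hg y hy).2 hC'
  · refine le_trans ?_ (mul_le_mul_of_nonneg_left (hgb X z y h1 h2 h3) hC')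
    rw [gTerm, abs_mul, abs_of_pos (Real.exp_pos _)]
    refine (mul_le_mul_of_nonneg_right (hb _) (Real.exp_pos _).le).trans_eq ?_
    rw [mul_assoc, ← Real.exp_add]
    congr 2
    simp only [fM]
    ring

variable {b : dualL N → ℂ} {Cb : ℝ} (hb : ∀ X, ‖b X‖ ≤ Cb)

include hb

theorem exists_norm_gTerm_bound {q : ℝ × ℝ × ℝ → ℝ} (hq : IsTempered q) (x₁ : ℝ) {y₁ : ℝ}
    (hy₁ : 0 < y₁) : ∃ (g : ℝ → dualL N → ℝ) (C : ℝ),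
      (∀ y, y₁ ≤ y → Summable (g y) ∧ ∑' X, g y X ≤ C * y) ∧
      ∀ (X : dualL N) (z : ℂ) (y : ℝ), |z.re| ≤ x₁ → y₁ ≤ z.im → z.im ≤ y →
        ‖b X * gTerm N k q (conjAct σ X) z‖ ≤ g y X := by
  obtain ⟨g, C, hg, hgb⟩ := exists_gTerm_bound hN hk σ hq x₁ hy₁
  have hC : 0 ≤ Cb := (norm_nonneg _).trans (hb 0)
  refine ⟨fun y X => Cb * g y X, Cb * C, fun y hy => ⟨(hg y hy).1.mul_left Cb, ?_⟩,
    fun X z y h1 h2 h3 => ?_⟩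
  · rw [tsum_mul_left, mul_assoc]
    exact mul_le_mul_of_nonneg_left (hg y hy).2 hC
  · rw [norm_mul, Complex.norm_real, Real.norm_eq_abs]
    exact mul_le_mul (hb X) (hgb X z y h1 h2 h3) (abs_nonneg _) hC

theorem summable_gSeries {q : ℝ × ℝ × ℝ → ℝ} (hq : IsTempered q) {z : ℂ} (hz : z ∈ upperSet) :
    Summable fun X : dualL N => b X * gTerm N k q (conjAct σ X) z := by
  obtain ⟨g, C, hg, h⟩ := exists_norm_gTerm_bound hN hk σ hb hq |z.re| hz
  exact .of_norm_bounded (hg z.im le_rfl).1 fun X => h X z z.im le_rfl le_rfl le_rfl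

theorem exists_norm_gSeries_le {q : ℝ × ℝ × ℝ → ℝ} (hq : IsTempered q) (x₁ : ℝ) {y₁ : ℝ}
    (hy₁ : 0 < y₁) : ∃ C : ℝ, 0 ≤ C ∧ ∀ z : ℂ, |z.re| ≤ x₁ → y₁ ≤ z.im →
      ‖gSeries N k σ b q z‖ ≤ C * z.im := by
  obtain ⟨g, C, hg, h⟩ := exists_norm_gTerm_bound hN hk σ hb hq x₁ hy₁
  refine ⟨|C|, abs_nonneg C, fun z h1 h2 => ?_⟩
  refine (tsum_of_norm_bounded (hg z.im h2).1.hasSum fun X => h X z z.im h1 h2 le_rfl).trans ?_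
  exact (hg z.im h2).2.trans (mul_le_mul_of_nonneg_right (le_abs_self C) (hy₁.le.trans h2))

theorem continuousOn_gSeries {q : ℝ × ℝ × ℝ → ℝ} (hq : IsTempered q) :
    ContinuousOn (gSeries N k σ b q) upperSet := fun z hz => by
  have hz' : 0 < z.im := hz
  obtain ⟨g, C, hg, h⟩ := exists_norm_gTerm_bound hN hk σ hb hq (|z.re| + 1) (half_pos hz')
  have hn := (isOpen_box (|z.re| + 1) (z.im / 2) (2 * z.im)).mem_nhds (mem_box hz)
  refine ContinuousAt.continuousWithinAt (ContinuousOn.continuousAt ?_ hn)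
  refine continuousOn_tsum (fun X => ?_) (hg (2 * z.im) (by linarith)).1 fun X w hw =>
    h X w (2 * z.im) (abs_le.2 ⟨hw.1.le, hw.2.1.le⟩) hw.2.2.1.le hw.2.2.2.le
  intro w hw
  have hw' : w ∈ upperSet := show 0 < w.im by linarith [hw.2.2.1]
  have e1 := (hasFDerivAt_fP N (conjAct σ X) hw').continuousAt
  have e2 := (hasFDerivAt_fA N (conjAct σ X) hw').continuousAt
  have e3 := (hasFDerivAt_fB N (conjAct σ X) hw').continuousAt
  have e4 := (hasFDerivAt_exp_fM N (conjAct σ X) hw' k).continuousAt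
  refine ContinuousAt.continuousWithinAt (continuousAt_const.mul
    (Complex.continuous_ofReal.continuousAt.comp' ?_))
  exact (hq.continuous.continuousAt.comp' (e1.prodMk (e2.prodMk e3))).mul e4

theorem hasFDerivAt_gSeries {q qx qy : ℝ × ℝ × ℝ → ℝ} (hq : IsTempered q) (hqx : IsTempered qx)
    (hqy : IsTempered qy) (hg : IsGradient k q qx qy) {z : ℂ} (hz : z ∈ upperSet) :
    HasFDerivAt (gSeries N k σ b q) (z.im⁻¹ • (gSeries N k σ b qx z • cre +
      gSeries N k σ b qy z • cim)) z := by
  have hz' : 0 < z.im := hz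
  obtain ⟨gx, _, hgx, hx⟩ := exists_norm_gTerm_bound hN hk σ hb hqx (|z.re| + 1) (half_pos hz')
  obtain ⟨gy, _, hgy, hy⟩ := exists_norm_gTerm_bound hN hk σ hb hqy (|z.re| + 1) (half_pos hz')
  set F' : dualL N → ℂ → ℂ →L[ℝ] ℂ := fun X w =>
    w.im⁻¹ • ((b X * gTerm N k qx (conjAct σ X) w : ℂ) • cre +
      (b X * gTerm N k qy (conjAct σ X) w : ℂ) • cim) with hF'
  have hsum : HasSum (fun X => F' X z) (z.im⁻¹ • (gSeries N k σ b qx z • cre +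
      gSeries N k σ b qy z • cim)) :=
    ((((summable_gSeries hN hk σ hb hqx hz).hasSum.smul_const cre).add
      ((summable_gSeries hN hk σ hb hqy hz).hasSum.smul_const cim)).const_smul z.im⁻¹)
  rw [← hsum.tsum_eq]
  refine hasFDerivAt_tsum_of_isPreconnected (u := fun X => (z.im / 2)⁻¹ *
      (gx (2 * z.im) X * ‖cre‖ + gy (2 * z.im) X * ‖cim‖))
    ((((hgx _ (by linarith)).1.mul_right _).add ((hgy _ (by linarith)).1.mul_right _)).mul_left _)
    (isOpen_box (|z.re| + 1) (z.im / 2) (2 * z.im)) (convex_box _ _ _).isPreconnected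
    (fun X w hw => ?_) (fun X w hw => ?_) (mem_box hz) (summable_gSeries hN hk σ hb hq hz)
    (mem_box hz)
  · have hw' : w ∈ upperSet := show 0 < w.im by linarith [hw.2.2.1]
    refine ((Complex.ofRealCLM.hasFDerivAt.comp w (hg N (conjAct σ X) w hw')).const_mul
      (b X)).congr_fderiv ?_
    ext v
    simp [hF', cre, cim]
    ring
  · have h1 : |w.re| ≤ |z.re| + 1 := abs_le.2 ⟨hw.1.le, hw.2.1.le⟩
    have h2 := hx X w (2 * z.im) h1 hw.2.2.1.le hw.2.2.2.le
    have h3 := hy X w (2 * z.im) h1 hw.2.2.1.le hw.2.2.2.le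
    have hw0 : 0 < w.im := by linarith [hw.2.2.1]
    rw [hF', norm_smul, norm_inv, Real.norm_of_nonneg hw0.le]
    refine mul_le_mul (inv_anti₀ (half_pos hz') hw.2.2.1.le) ?_ (norm_nonneg _) (by positivity)
    refine (norm_add_le _ _).trans (add_le_add ?_ ?_)
    · rw [norm_smul]
      exact mul_le_mul_of_nonneg_right h2 (norm_nonneg _)
    · rw [norm_smul]
      exact mul_le_mul_of_nonneg_right h3 (norm_nonneg _)

/-- The gradient is y⁻¹ times two series of the same type, so each order of smoothness is inherited
from the order below, starting from continuity. -/
theorem contDiffOn_gSeries_succ {q qx qy : ℝ × ℝ × ℝ → ℝ} (hq : IsTempered q)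
    (hqx : IsTempered qx) (hqy : IsTempered qy) (hg : IsGradient k q qx qy) (n : ℕ)
    (hx : ContDiffOn ℝ n (gSeries N k σ b qx) upperSet)
    (hy : ContDiffOn ℝ n (gSeries N k σ b qy) upperSet) :
    ContDiffOn ℝ (n + 1) (gSeries N k σ b q) upperSet := by
  have h := fun z hz => hasFDerivAt_gSeries hN hk σ hb hq hqx hqy hg (z := z) hz
  rw [contDiffOn_succ_iff_fderiv_of_isOpen isOpen_upperSet]
  refine ⟨fun z hz => (h z hz).differentiableAt.differentiableWithinAt, by simp, ?_⟩
  refine ContDiffOn.congr (f := fun z : ℂ => z.im⁻¹ • (gSeries N k σ b qx z • cre +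
      gSeries N k σ b qy z • cim)) ?_ fun z hz => (h z hz).fderiv
  have him : ContDiffOn ℝ n (fun z : ℂ => z.im⁻¹) upperSet :=
    (Complex.imCLM.contDiff.contDiffOn).inv fun z hz => ne_of_gt hz
  exact him.smul ((hx.smul contDiffOn_const).add (hy.smul contDiffOn_const))

/-- The weight of the hyperbolic Laplacian of the Gaussian. -/
def gLap (k : ℝ) (v : ℝ × ℝ × ℝ) : ℝ :=
  4 * k ^ 2 * (v.1 * v.1 * (v.2.1 * v.2.1 + v.2.2 * v.2.2)) +
    -(2 * k) * (2 * (v.1 * v.1) + v.2.1 * v.2.1 + v.2.2 * v.2.2)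

omit hN hk hb in
theorem isTempered_gLap (k : ℝ) : IsTempered (gLap k) := by
  have h1 := isTempered_fst.mul isTempered_fst
  have h2 := isTempered_snd.mul isTempered_snd
  have h3 := isTempered_thd.mul isTempered_thd
  exact ((isTempered_const _).mul (h1.mul (h2.add h3))).add ((isTempered_const _).mul
    ((((isTempered_const 2).mul h1).add h2).add h3))

theorem gaussian_series_regular : ContDiffOn ℝ 2 (gSeries N k σ b fun _ => 1) upperSet ∧
    (∀ z ∈ upperSet, Laplacian.laplacian (gSeries N k σ b fun _ => 1) z =
      (z.im ^ 2)⁻¹ • gSeries N k σ b (gLap k) z) ∧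
    ∀ (x₁ : ℝ) {y₁ : ℝ}, 0 < y₁ → ∃ C : ℝ, 0 ≤ C ∧ ∀ z : ℂ, |z.re| ≤ x₁ → y₁ ≤ z.im →
      ‖gSeries N k σ b (fun _ => 1) z‖ ≤ C * z.im ∧
      ‖gSeries N k σ b (gLap k) z‖ ≤ C * z.im ∧
      ‖fderiv ℝ (gSeries N k σ b fun _ => 1) z‖ ≤ C := by
  have t0 := isTempered_const 1
  have tc := isTempered_const (-(2 * k))
  have tpp := isTempered_fst.mul isTempered_fst
  have taa := isTempered_snd.mul isTempered_snd
  have tbb := isTempered_thd.mul isTempered_thd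
  have tab := isTempered_snd.mul isTempered_thd
  have tpa := isTempered_fst.mul isTempered_snd
  have tx := tc.mul tpa
  have ty := tc.mul (isTempered_fst.mul isTempered_thd)
  have txx := tc.mul ((taa.add (isTempered_fst.mul (isTempered_thd.add isTempered_fst))).add
    (tc.mul (tpp.mul taa)))
  have txy := tc.mul (tab.add (tc.mul (tpp.mul tab)))
  have tyx := tc.mul ((tab.add ((isTempered_const (-1)).mul tpa)).add (tc.mul (tpp.mul tab)))
  have tyy := tc.mul ((tbb.add tpp).add (tc.mul (tpp.mul tbb)))
  have c0 := fun q (hq : IsTempered q) => (contDiffOn_zero (𝕜 := ℝ)).2 (continuousOn_gSeries hN hk σ hb hq)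
  have cx := contDiffOn_gSeries_succ hN hk σ hb tx txx txy (isGradient_fst_mul_snd k) 0
    (c0 _ txx) (c0 _ txy)
  have cy := contDiffOn_gSeries_succ hN hk σ hb ty tyx tyy (isGradient_fst_mul_thd k) 0
    (c0 _ tyx) (c0 _ tyy)
  have h2 : ContDiffOn ℝ 2 (gSeries N k σ b fun _ => 1) upperSet := by
    have := contDiffOn_gSeries_succ hN hk σ hb t0 tx ty (isGradient_one k) 1
      (by simpa using cx) (by simpa using cy)
    norm_num at this
    exact this
  have d0 := fun z hz => hasFDerivAt_gSeries hN hk σ hb t0 tx ty (isGradient_one k) (z := z) hz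
  refine ⟨h2, fun z hz => ?_, fun x₁ y₁ hy₁ => ?_⟩
  · have dx := hasFDerivAt_gSeries hN hk σ hb tx txx txy (isGradient_fst_mul_snd k) hz
    have dy := hasFDerivAt_gSeries hN hk σ hb ty tyx tyy (isGradient_fst_mul_thd k) hz
    have hz0 : z.im ≠ 0 := ne_of_gt hz
    have hF := hasFDerivAt_fderiv h2 hz
    have ev := isOpen_upperSet.mem_nhds hz
    have e1 := (ContinuousLinearMap.apply ℝ ℂ (1 : ℂ)).hasFDerivAt.comp z hF
    have e2 := (ContinuousLinearMap.apply ℝ ℂ Complex.I).hasFDerivAt.comp z hF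
    have e1' := ((hasFDerivAt_im_inv hz).smul dx).congr_of_eventuallyEq
      (show (fun w => fderiv ℝ (gSeries N k σ b fun _ => 1) w 1) =ᶠ[nhds z] _ by
        filter_upwards [ev] with w hw
        rw [(d0 w hw).fderiv]
        simp [cre, cim])
    have e2' := ((hasFDerivAt_im_inv hz).smul dy).congr_of_eventuallyEq
      (show (fun w => fderiv ℝ (gSeries N k σ b fun _ => 1) w Complex.I) =ᶠ[nhds z] _ by
        filter_upwards [ev] with w hw
        rw [(d0 w hw).fderiv]
        simp [cre, cim])
    have f1 := congrArg (fun L : ℂ →L[ℝ] ℂ => L 1) (e1.unique e1')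
    have f2 := congrArg (fun L : ℂ →L[ℝ] ℂ => L Complex.I) (e2.unique e2')
    simp [cre, cim] at f1 f2
    -- Two applications of y∂/∂y exceed y²∂²/∂y² by one y∂/∂y, whence the subtracted first-order
    -- series.
    have hs : gSeries N k σ b (gLap k) z = gSeries N k σ b (fun v => -(2 * k) *
          (v.2.1 * v.2.1 + v.1 * (v.2.2 + v.1) + -(2 * k) * ((v.1 * v.1) * (v.2.1 * v.2.1)))) z +
        gSeries N k σ b (fun v => -(2 * k) *
          (v.2.2 * v.2.2 + v.1 * v.1 + -(2 * k) * ((v.1 * v.1) * (v.2.2 * v.2.2)))) z -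
        gSeries N k σ b (fun v => -(2 * k) * (v.1 * v.2.2)) z := by
      rw [eq_sub_iff_add_eq]
      simp only [gSeries]
      rw [← (summable_gSeries hN hk σ hb (isTempered_gLap k) hz).tsum_add
        (summable_gSeries hN hk σ hb ty hz), ← (summable_gSeries hN hk σ hb txx hz).tsum_add
        (summable_gSeries hN hk σ hb tyy hz)]
      refine tsum_congr fun X => ?_
      simp only [gTerm, gLap]
      push_cast
      ring
    rw [laplacian_eq_fderiv, f1, f2, hs]
    simp only [Complex.real_smul]
    push_cast
    field_simp
    ring
  · obtain ⟨C₀, hC₀, b₀⟩ := exists_norm_gSeries_le hN hk σ hb t0 x₁ hy₁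
    obtain ⟨C₁, hC₁, b₁⟩ := exists_norm_gSeries_le hN hk σ hb (isTempered_gLap k) x₁ hy₁
    obtain ⟨Cx, hCx, bx⟩ := exists_norm_gSeries_le hN hk σ hb tx x₁ hy₁
    obtain ⟨Cy, hCy, bby⟩ := exists_norm_gSeries_le hN hk σ hb ty x₁ hy₁
    refine ⟨C₀ + C₁ + (Cx * ‖cre‖ + Cy * ‖cim‖), by positivity, fun z h1 h2 => ?_⟩
    have hz0 : 0 < z.im := hy₁.trans_le h2
    have p1 : 0 ≤ Cx * ‖cre‖ + Cy * ‖cim‖ := by positivity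
    refine ⟨(b₀ z h1 h2).trans ?_, (b₁ z h1 h2).trans ?_, ?_⟩
    · gcongr; linarith
    · gcongr; linarith
    · rw [(d0 z hz0).fderiv, norm_smul, norm_inv, Real.norm_of_nonneg hz0.le,
        inv_mul_le_iff₀ hz0]
      refine (norm_add_le _ _).trans ?_
      rw [norm_smul, norm_smul]
      have q1 := mul_le_mul_of_nonneg_right (bx z h1 h2) (norm_nonneg cre)
      have q2 := mul_le_mul_of_nonneg_right (bby z h1 h2) (norm_nonneg cim)
      nlinarith [mul_nonneg hz0.le hC₀, mul_nonneg hz0.le hC₁]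

end series

/-- The oscillating factor in u does not depend on z and is absorbed into the coefficients. The
relation A² + B² = P² - 2(X,X) identifies `lapWeight` with `gLap`, so the second series is the
hyperbolic Laplacian of the first. -/
theorem exists_twistedTheta_eq_gSeries {N : ℕ} (hN : 0 < N) {D : ℤ} (hD : D ≠ 0) (r : ℤ)
    (h : DiscGroup N 1) (τ : ℍ) : ∃ (b : dualL N → ℂ) (Cb : ℝ), (∀ X, ‖b X‖ ≤ Cb) ∧
      ∀ (σ : SL(2, ℤ)) (z : ℍ),
        twistedTheta N D r (kernel N D 1 fun _ _ => 1) h τ (σ • z) =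
          gSeries N (piDiv D * τ.im) σ⁻¹ b (fun _ => 1) z ∧
        twistedTheta N D r (kernel N D 1 (lapWeight N (piDiv D * τ.im))) h τ (σ • z) =
          gSeries N (piDiv D * τ.im) σ⁻¹ b (gLap (piDiv D * τ.im)) z := by
  obtain ⟨C, hC, hb⟩ := exists_norm_psi_le hN hD r h
  refine ⟨fun X => wt N D r h X *
    Complex.exp (((piDiv D * bil N (X : Mat) X * τ.re : ℝ) : ℂ) * Complex.I), C,
    fun X => ?_, fun σ z => ?_⟩
  · rw [norm_mul, Complex.norm_exp_ofReal_mul_I, mul_one]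
    exact hb _
  · have hker : ∀ (p : Mat → ℍ → ℝ) (X : dualL N), kernel N D 1 p X τ (σ • z) =
        Complex.exp (((piDiv D * bil N (X : Mat) X * τ.re : ℝ) : ℂ) * Complex.I) *
          ((p X (σ • z) * Real.exp (-(piDiv D * τ.im * fM N (conjAct σ⁻¹ X) z)) : ℝ) : ℂ) := by
      intro p X
      rw [kernel, expUV, majorant_eq N (dualL_traceless X), fM_smul N _ (dualL_traceless X)]
      push_cast
      rw [mul_left_comm (Complex.exp _), ← Complex.exp_add]
      congr 2
      simp only [coe_re, coe_im]
      ring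
    constructor
    · rw [twistedTheta_kernel hN hD r h 1 (isWeight_const N 1), gSeries]
      refine tsum_congr fun X => ?_
      rw [hker, ← mul_assoc]
      simp [gTerm]
    · rw [twistedTheta_kernel hN hD r h 1 (isWeight_lapWeight N _), gSeries]
      refine tsum_congr fun X => ?_
      rw [hker, ← mul_assoc, gTerm]
      congr 3
      have hX := conjAct_traceless σ⁻¹ (dualL_traceless X)
      have h1 := sq_fA_add_sq_fB N hX (z := z) z.im_pos
      rw [bil_conjAct] at h1
      have h2 : bil N X (lineGen N (σ • z)) = fP N (conjAct σ⁻¹ X) z := by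
        rw [bil_lineGen N (dualL_traceless X), fP_smul N _ (dualL_traceless X)]
      rw [lapWeight, gLap, h2]
      linear_combination (-(4 * (piDiv D * τ.im) ^ 2 * fP N (conjAct σ⁻¹ X) z ^ 2) +
        2 * (piDiv D * τ.im)) * h1

/-! ## Invariance of the twisted theta function under `Γ₀(N)` -/

theorem exists_of_mem_Gamma0 {N : ℕ} {γ : SL(2, ℤ)} (hγ : γ ∈ Gamma0 N) :
    ∃ t : ℤ, γ 1 0 = N * t ∧ γ 0 0 * γ 1 1 - γ 0 1 * (N * t) = 1 := by
  rw [Gamma0_mem, ZMod.intCast_zmod_eq_zero_iff_dvd] at hγ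
  obtain ⟨t, ht⟩ := hγ
  have h := γ.det_coe
  rw [Matrix.det_fin_two, ht] at h
  exact ⟨t, ht, h⟩

theorem conjAct_formVec {N : ℕ} (hN : 0 < N) {γ : SL(2, ℤ)} {t : ℤ} (ht : γ 1 0 = N * t)
    (a b c : ℤ) : conjAct γ (formVec N a b c) =
      formVec N (a * γ 0 0 ^ 2 + b * γ 0 0 * γ 0 1 + N * c * γ 0 1 ^ 2)
        (b * (γ 0 0 * γ 1 1 + γ 0 1 * (N * t)) + 2 * N * c * γ 0 1 * γ 1 1 +
          2 * N * a * γ 0 0 * t)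
        (c * γ 1 1 ^ 2 + b * t * γ 1 1 + N * a * t ^ 2) := by
  have hN' : (N : ℝ) ≠ 0 := by positivity
  rw [conjAct_apply γ (by simp [formVec]), ht]
  ext i j
  fin_cases i <;> fin_cases j <;> simp [formVec] <;> field_simp <;> ring

theorem conjAct_mem_dualL {N : ℕ} (hN : 0 < N) {γ : SL(2, ℤ)} (hγ : γ ∈ Gamma0 N) {X : Mat}
    (hX : X ∈ dualL N) : conjAct γ X ∈ dualL N := by
  obtain ⟨t, ht, -⟩ := exists_of_mem_Gamma0 hγ
  obtain ⟨a, b, c, rfl⟩ := hX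
  exact ⟨_, _, _, conjAct_formVec hN ht a b c⟩

/-- The action of `Γ₀(N)` on the dual lattice. -/
def actL {N : ℕ} (hN : 0 < N) (γ : Gamma0 N) : dualL N ≃ dualL N where
  toFun X := ⟨conjAct γ X, conjAct_mem_dualL hN γ.2 X.2⟩
  invFun X := ⟨conjAct (γ : SL(2, ℤ))⁻¹ X, conjAct_mem_dualL hN (inv_mem γ.2) X.2⟩
  left_inv _ := Subtype.ext (conjAct_inv_conjAct _ _)
  right_inv _ := Subtype.ext (conjAct_conjAct_inv _ _)

theorem mem_latticeL_iff {N : ℕ} (hN : 0 < N) (X : Mat) :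
    X ∈ latticeL N ↔ ∃ a b c : ℤ, X = formVec N a (2 * N * b) c := by
  have hN' : (N : ℝ) ≠ 0 := by positivity
  have h : ∀ a b c : ℤ, formVec N a (2 * N * b) c = !![(b : ℝ), -(a : ℝ) / N; (c : ℝ), -(b : ℝ)] :=
    fun a b c => by
      ext i j
      fin_cases i <;> fin_cases j <;> simp [formVec] <;> field_simp
  simp only [h]
  rfl

theorem conjAct_mem_scaledL {N : ℕ} (hN : 0 < N) (D : ℤ) {γ : SL(2, ℤ)} (hγ : γ ∈ Gamma0 N)
    {X : Mat} (hX : X ∈ scaledL N D) : conjAct γ X ∈ scaledL N D := by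
  obtain ⟨t, ht, -⟩ := exists_of_mem_Gamma0 hγ
  obtain ⟨Y, hY, rfl⟩ := hX
  obtain ⟨a, b, c, rfl⟩ := (mem_latticeL_iff hN Y).1 hY
  refine ⟨conjAct γ (formVec N a (2 * N * b) c), (mem_latticeL_iff hN _).2 ?_, ?_⟩
  · rw [conjAct_formVec hN ht]
    refine ⟨_, b * (γ 0 0 * γ 1 1 + γ 0 1 * (N * t)) + c * γ 0 1 * γ 1 1 + a * γ 0 0 * t, _,
      congrArg₂ (formVec N _) ?_ rfl⟩
    ring
  · simp only [zsmulAddGroupHom_apply]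
    rw [conjAct_zsmul]

/-! ### Invariance of the coefficients of the twisted theta series. -/

theorem cls_eq_iff (N : ℕ) (D : ℤ) (X Y : dualL N) :
    cls N D X = cls N D Y ↔ (Y : Mat) - X ∈ scaledL N D := by
  rw [cls, cls, QuotientAddGroup.eq, AddSubgroup.mem_addSubgroupOf]
  simp [sub_eq_neg_add]

section

variable {N : ℕ} (hN : 0 < N) (D : ℤ) (γ : Gamma0 N)

theorem cls_actL_congr {X Y : dualL N} (h : cls N D X = cls N D Y) :
    cls N D (actL hN γ X) = cls N D (actL hN γ Y) := by
  rw [cls_eq_iff] at h ⊢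
  simp only [actL, Equiv.coe_fn_mk]
  rw [← conjAct_sub]
  exact conjAct_mem_scaledL hN D γ.2 h

/-- Only b matters modulo L. The determinant relation gives ps + qNt = 1 + 2Nqt, so b changes by a
multiple of 2N. -/
theorem cls_one_actL (X : dualL N) : cls N 1 (actL hN γ X) = cls N 1 X := by
  rw [eq_comm, cls_eq_iff]
  obtain ⟨t, ht, hdet⟩ := exists_of_mem_Gamma0 γ.2
  obtain ⟨X, a, b, c, rfl⟩ := X
  simp only [actL, Equiv.coe_fn_mk]
  have hN' : (N : ℝ) ≠ 0 := by positivity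
  rw [conjAct_formVec hN ht]
  set γ' := γ.1
  refine ⟨_, (mem_latticeL_iff hN _).2 ⟨a * γ' 0 0 ^ 2 + b * γ' 0 0 * γ' 0 1 + N * c * γ' 0 1 ^ 2 - a,
    b * γ' 0 1 * t + c * γ' 0 1 * γ' 1 1 + a * γ' 0 0 * t,
    c * γ' 1 1 ^ 2 + b * t * γ' 1 1 + N * a * t ^ 2 - c, rfl⟩, ?_⟩
  have hdet' : (γ' 0 0 : ℝ) * γ' 1 1 - γ' 0 1 * (N * t) = 1 := by exact_mod_cast hdet
  simp only [zsmulAddGroupHom_apply, one_smul]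
  ext i j
  fin_cases i <;> fin_cases j <;> simp [formVec] <;> field_simp <;>
    first | ring1 | linear_combination (b : ℝ) * hdet' | linear_combination (-(b : ℝ)) * hdet'

theorem proj_cls (X : dualL N) : proj N D (cls N D X) = cls N 1 X := rfl

theorem actL_inv_actL (X : dualL N) : actL hN γ⁻¹ (actL hN γ X) = X :=
  Subtype.ext (by simpa [actL] using conjAct_inv_conjAct (γ : SL(2, ℤ)) X)

theorem QuadCongr.actL {X : dualL N} {h : DiscGroup N 1} (hq : QuadCongr N D (cls N D X) h) :
    QuadCongr N D (cls N D (actL hN γ X)) h := by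
  obtain ⟨X', Y, n, h1, h2, h3⟩ := hq
  refine ⟨TwistedLift.actL hN γ X', Y, n, cls_actL_congr hN D γ h1, h2, ?_⟩
  rw [← h3]
  congr 2
  exact quad_conjAct N γ X'

/-- The inverse substitution expresses a, b, c through the transformed coefficients, so a common
divisor of the latter with Δ divides the former as well. -/
theorem gcd_transform {a b c p q s t : ℤ} {N : ℤ} (hdet : p * s - q * (N * t) = 1)
    (hg : Int.gcd a (Int.gcd b (Int.gcd c D)) = 1) :
    Int.gcd (a * p ^ 2 + b * p * q + N * c * q ^ 2)
      (Int.gcd (b * (p * s + q * (N * t)) + 2 * N * c * q * s + 2 * N * a * p * t)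
        (Int.gcd (c * s ^ 2 + b * t * s + N * a * t ^ 2) D)) = 1 := by
  set a' := a * p ^ 2 + b * p * q + N * c * q ^ 2 with ha'
  set b' := b * (p * s + q * (N * t)) + 2 * N * c * q * s + 2 * N * a * p * t with hb'
  set c' := c * s ^ 2 + b * t * s + N * a * t ^ 2 with hc'
  set d := Int.gcd a' (Int.gcd b' (Int.gcd c' D)) with hd
  have h1 : (d : ℤ) ∣ a' := Int.gcd_dvd_left ..
  have h2 : (d : ℤ) ∣ Int.gcd b' (Int.gcd c' D) := Int.gcd_dvd_right ..
  have h3 : (d : ℤ) ∣ b' := h2.trans (Int.gcd_dvd_left ..)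
  have h4 : (d : ℤ) ∣ Int.gcd c' D := h2.trans (Int.gcd_dvd_right ..)
  have h5 : (d : ℤ) ∣ c' := h4.trans (Int.gcd_dvd_left ..)
  have h6 : (d : ℤ) ∣ D := h4.trans (Int.gcd_dvd_right ..)
  have ea : a = a' * s ^ 2 - b' * s * q + c' * N * q ^ 2 := by
    rw [ha', hb', hc']
    linear_combination (-(a * (p * s - q * (N * t) + 1))) * hdet
  have eb : b = b' * (p * s + q * (N * t)) - 2 * N * c' * q * p - 2 * N * a' * s * t := by
    rw [ha', hb', hc']
    linear_combination (-(b * (p * s - q * (N * t) + 1))) * hdet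
  have ec : c = c' * p ^ 2 - b' * t * p + a' * N * t ^ 2 := by
    rw [ha', hb', hc']
    linear_combination (-(c * (p * s - q * (N * t) + 1))) * hdet
  have da : (d : ℤ) ∣ a := by
    rw [ea, mul_assoc b', mul_assoc c']
    exact ((h1.mul_right _).sub (h3.mul_right _)).add (h5.mul_right _)
  have db : (d : ℤ) ∣ b := by
    rw [eb]
    exact ((h3.mul_right _).sub (((h5.mul_left _).mul_right _).mul_right _)).sub
      (((h1.mul_left _).mul_right _).mul_right _)
  have dc : (d : ℤ) ∣ c := by
    rw [ec, mul_assoc b', mul_assoc a']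
    exact ((h5.mul_right _).sub (h3.mul_right _)).add (h1.mul_right _)
  have := Int.dvd_coe_gcd da (Int.dvd_coe_gcd db (Int.dvd_coe_gcd dc h6))
  rw [hg] at this
  exact Nat.dvd_one.1 (by exact_mod_cast this)

/-- The same n remains admissible with the same factorization of N. The substitution with rows (s,
-N₂t) and (-N₁q, p) has determinant 1 and carries the representation of n over to the transformed
form [N₁a', b', N₂c']. -/
theorem GenusWitness.actL {X : dualL N} {n : ℤ} (hw : GenusWitness N D (cls N D X) n) :
    GenusWitness N D (cls N D (actL hN γ X)) n := by
  obtain ⟨a, b, c, Y, hY, hcls, ⟨d, e, hd, he⟩, hg, ⟨N₁, N₂, x, y, hNN, hn⟩, hco⟩ := hw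
  obtain ⟨t, ht, hdet⟩ := exists_of_mem_Gamma0 γ.2
  set γ' := γ.1
  refine ⟨_, _, _, TwistedLift.actL hN γ Y, ?_, cls_actL_congr hN D γ hcls, ⟨d, e, ?_, he⟩,
    gcd_transform D hdet hg, ⟨N₁, N₂, γ' 1 1 * x - N₂ * t * y, -(N₁ * γ' 0 1 * x) + γ' 0 0 * y,
      hNN, ?_⟩, hco⟩
  · rw [← conjAct_formVec hN ht, ← hY]; rfl
  · rw [← hd]
    linear_combination ((b ^ 2 - 4 * N * a * c) *
      (γ' 0 0 * γ' 1 1 - γ' 0 1 * (N * t) + 1)) * hdet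
  · have hNN' : (N : ℤ) = N₁ * N₂ := by exact_mod_cast hNN.symm
    rw [hNN'] at hdet ⊢
    rw [hn]
    linear_combination (-((N₁ * a * x ^ 2 + b * x * y + N₂ * c * y ^ 2) *
      (γ' 0 0 * γ' 1 1 - γ' 0 1 * (N₁ * N₂ * t) + 1))) * hdet

-- The character is evaluated at a chosen n. Once the admissible integers of two classes coincide,
-- the choices coincide too, and independence of the value from n need not be proved.
omit hN in
open Classical in
theorem genusChar_congr {δ δ' : DiscGroup N D} (h : GenusWitness N D δ = GenusWitness N D δ') :
    genusChar N D δ = genusChar N D δ' := by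
  have : ∀ P Q : ℤ → Prop, P = Q → (if h : ∃ n, P n then kronecker D h.choose else 0) =
      if h : ∃ n, Q n then kronecker D h.choose else 0 := by
    rintro P _ rfl; rfl
  exact this _ _ h

open Classical in
theorem wt_actL (r : ℤ) (h : DiscGroup N 1) (X : dualL N) :
    wt N D r h (actL hN γ X) = wt N D r h X := by
  have h1 : GenusWitness N D (cls N D (actL hN γ X)) = GenusWitness N D (cls N D X) := by
    funext n
    refine propext ⟨fun hw => ?_, fun hw => hw.actL hN D γ⟩
    have := hw.actL hN D γ⁻¹
    rwa [actL_inv_actL] at this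
  have h2 : QuadCongr N D (cls N D (actL hN γ X)) h ↔ QuadCongr N D (cls N D X) h := by
    refine ⟨fun hw => ?_, fun hw => hw.actL hN D γ⟩
    have := hw.actL hN D γ⁻¹
    rwa [actL_inv_actL] at this
  rw [wt, wt, psi, psi, genusChar_congr D h1, proj_cls, proj_cls, cls_one_actL]
  exact if_congr (and_congr Iff.rfl h2) rfl rfl

include hN in
theorem twistedTheta_one_invariant {D : ℤ} (hD : D ≠ 0) (r : ℤ) (h : DiscGroup N 1) (s : ℝ)
    (τ : ℍ) : IsInvariant N fun z => twistedTheta N D r (kernel N D s fun _ _ => 1) h τ z := by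
  intro γ hγ z
  have hw := isWeight_const N 1
  simp only [twistedTheta_kernel hN hD r h s hw]
  rw [← (actL hN ⟨γ, hγ⟩).tsum_eq]
  refine tsum_congr fun X => ?_
  have e1 : bil N (actL hN ⟨γ, hγ⟩ X : Mat) (actL hN ⟨γ, hγ⟩ X) = bil N (X : Mat) X :=
    bil_conjAct N γ X X
  have e2 : majorant N (actL hN ⟨γ, hγ⟩ X) (γ • z) = majorant N X z := by
    rw [majorant_eq N (dualL_traceless _), majorant_eq N (dualL_traceless _)]
    exact fM_conjAct N γ (dualL_traceless X) z
  rw [wt_actL, kernel, kernel, e1, e2]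

end

/-! ## The divergence theorem on the truncated fundamental domain -/

/-- The upper half of the unit circle as a graph. -/
def arc (x : ℝ) : ℝ := √(1 - x ^ 2)

theorem one_sub_sq_pos {x : ℝ} (hx : |x| < 1) : 0 < 1 - x ^ 2 := by
  have := (sq_lt_one_iff_abs_lt_one x).2 hx
  linarith

theorem arc_pos {x : ℝ} (hx : |x| < 1) : 0 < arc x := Real.sqrt_pos.2 (one_sub_sq_pos hx)

theorem hasDerivAt_arc {x : ℝ} (hx : |x| < 1) : HasDerivAt arc (-x / arc x) x := by
  have h1 : HasDerivAt (fun x : ℝ => 1 - x ^ 2) (-(2 * x)) x := by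
    simpa using ((hasDerivAt_id x).pow 2).const_sub 1
  refine (h1.sqrt (one_sub_sq_pos hx).ne').congr_deriv ?_
  have := (arc_pos hx).ne'
  simp only [arc] at this ⊢
  field_simp

theorem continuous_arc : Continuous arc := by unfold arc; fun_prop

/-- The parametrization of the region between the unit circle and height `Y`. -/
def shear (Y : ℝ) (p : ℝ × ℝ) : ℂ := ⟨p.1, arc p.1 + p.2 * (Y - arc p.1)⟩

section

variable {Y : ℝ} (hY : 0 < Y) {p : ℝ × ℝ} (h1 : |p.1| < 1) (h2 : p.2 ∈ Set.Icc (0 : ℝ) 1)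

include hY h1 h2 in
theorem shear_mem : shear Y p ∈ upperSet := by
  have := arc_pos h1
  have e : arc p.1 + p.2 * (Y - arc p.1) = (1 - p.2) * arc p.1 + p.2 * Y := by ring
  change 0 < arc p.1 + p.2 * (Y - arc p.1)
  rw [e]
  rcases h2.1.eq_or_lt with h | h
  · simpa [← h] using this
  · have := mul_nonneg (sub_nonneg.2 h2.2) this.le
    have := mul_pos h hY
    linarith

include h1 in
theorem hasFDerivAt_arc_fst : HasFDerivAt (fun p : ℝ × ℝ => arc p.1)
    ((-p.1 / arc p.1) • ContinuousLinearMap.fst ℝ ℝ ℝ) p :=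
  (hasDerivAt_arc h1).comp_hasFDerivAt p hasFDerivAt_fst

include h1 in
theorem exists_hasFDerivAt_shear : ∃ Φ : ℝ × ℝ →L[ℝ] ℂ, HasFDerivAt (shear Y) Φ p ∧
    Φ (1, 0) = (1 : ℝ) • (1 : ℂ) + (-p.1 / arc p.1 * (1 - p.2)) • Complex.I ∧
    Φ (0, 1) = (Y - arc p.1) • Complex.I := by
  have ha := hasFDerivAt_arc_fst h1
  have hs : HasFDerivAt (fun p : ℝ × ℝ => p.2) (ContinuousLinearMap.snd ℝ ℝ ℝ) p := hasFDerivAt_snd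
  have hf : HasFDerivAt (fun p : ℝ × ℝ => p.1) (ContinuousLinearMap.fst ℝ ℝ ℝ) p := hasFDerivAt_fst
  have h3 := (ha.add (hs.mul (ha.const_sub Y))).smul_const Complex.I
  have h4 := (hf.smul_const (1 : ℂ)).add h3
  refine ⟨_, h4.congr_of_eventuallyEq (Eventually.of_forall fun q => ?_), ?_, ?_⟩
  · apply Complex.ext <;> simp [shear]
  · simp
    ring
  · simp

variable {U V : ℂ → ℂ} {U' V' : ℂ → ℂ →L[ℝ] ℂ}
  (hU : ∀ z ∈ upperSet, HasFDerivAt U (U' z) z) (hV : ∀ z ∈ upperSet, HasFDerivAt V (V' z) z)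

-- This is the flux of (U, V) pulled back to the rectangle by the shear (x, s) ↦ (x, arc x + s(Y -
-- arc x)). The terms produced by the slope of the arc cancel, and the Jacobian Y - arc x is left.
include hY h1 h2 hU hV in
theorem exists_hasFDerivAt_flux : ∃ F' G' : ℝ × ℝ →L[ℝ] ℂ,
    HasFDerivAt (fun p : ℝ × ℝ => (Y - arc p.1) • U (shear Y p)) F' p ∧
    HasFDerivAt (fun p : ℝ × ℝ => V (shear Y p) -
      (-p.1 / arc p.1 * (1 - p.2)) • U (shear Y p)) G' p ∧
    F' (1, 0) + G' (0, 1) = (Y - arc p.1) •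
      (U' (shear Y p) 1 + V' (shear Y p) Complex.I) := by
  obtain ⟨Φ, hΦ, hΦ1, hΦ2⟩ := exists_hasFDerivAt_shear (Y := Y) h1
  have hm := shear_mem hY h1 h2
  have ha := hasFDerivAt_arc_fst h1
  have hs : HasFDerivAt (fun p : ℝ × ℝ => p.2) (ContinuousLinearMap.snd ℝ ℝ ℝ) p := hasFDerivAt_snd
  have hf : HasFDerivAt (fun p : ℝ × ℝ => p.1) (ContinuousLinearMap.fst ℝ ℝ ℝ) p := hasFDerivAt_fst
  have hu := (hU _ hm).comp p hΦ
  have hv := (hV _ hm).comp p hΦ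
  have hq1 : DifferentiableAt ℝ (fun x : ℝ => -x / arc x) p.1 :=
    differentiableAt_id.fun_neg.fun_div (hasDerivAt_arc h1).differentiableAt (arc_pos h1).ne'
  have hq : HasFDerivAt (fun p : ℝ × ℝ => -p.1 / arc p.1) _ p :=
    hq1.hasDerivAt.comp_hasFDerivAt p hf
  refine ⟨_, _, (ha.const_sub Y).smul hu, hv.sub ((hq.mul (hs.const_sub 1)).smul hu), ?_⟩
  have e1 : U' (shear Y p) (Φ (1, 0)) = U' (shear Y p) 1 +
      (-p.1 / arc p.1 * (1 - p.2)) • U' (shear Y p) Complex.I := by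
    rw [hΦ1, map_add, map_smul, map_smul, one_smul]
  have e2 : U' (shear Y p) (Φ (0, 1)) = (Y - arc p.1) • U' (shear Y p) Complex.I := by
    rw [hΦ2, map_smul]
  have e3 : V' (shear Y p) (Φ (0, 1)) = (Y - arc p.1) • V' (shear Y p) Complex.I := by
    rw [hΦ2, map_smul]
  simp [e1, e2, e3]
  ring

end

/-- The divergence theorem is applied on the rectangle after the shear. The edge s = 0 yields the
flux through the arc, where the slope of the arc is -x/arc x. -/
theorem green_truncated {Y : ℝ} (hY : 0 < Y) {U V : ℂ → ℂ} {U' V' : ℂ → ℂ →L[ℝ] ℂ}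
    (hU : ∀ z ∈ upperSet, HasFDerivAt U (U' z) z) (hV : ∀ z ∈ upperSet, HasFDerivAt V (V' z) z)
    (hUV : ContinuousOn (fun z => U' z 1 + V' z Complex.I) upperSet) :
    ∫ x in (-(1 / 2) : ℝ)..(1 / 2), ∫ y in (arc x)..Y, (U' ⟨x, y⟩ 1 + V' ⟨x, y⟩ Complex.I) =
      (∫ x in (-(1 / 2) : ℝ)..(1 / 2), V ⟨x, Y⟩) -
      (∫ x in (-(1 / 2) : ℝ)..(1 / 2), (V ⟨x, arc x⟩ - (-x / arc x) • U ⟨x, arc x⟩)) +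
      (∫ y in (arc (1 / 2))..Y, U ⟨1 / 2, y⟩) - ∫ y in (arc (1 / 2))..Y, U ⟨-(1 / 2), y⟩ := by
  have hin : ∀ p ∈ Set.uIcc (-(1 / 2) : ℝ) (1 / 2) ×ˢ Set.uIcc (0 : ℝ) 1,
      |p.1| < 1 ∧ p.2 ∈ Set.Icc (0 : ℝ) 1 := fun p hp => by
    rw [Set.uIcc_of_le (by norm_num), Set.uIcc_of_le (by norm_num)] at hp
    refine ⟨abs_lt.2 ⟨?_, ?_⟩, hp.2⟩ <;> linarith [hp.1.1, hp.1.2]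
  set f : ℝ × ℝ → ℂ := fun p => (Y - arc p.1) • U (shear Y p) with hf
  set g : ℝ × ℝ → ℂ := fun p => V (shear Y p) -
    (-p.1 / arc p.1 * (1 - p.2)) • U (shear Y p) with hg
  have key : ∀ p ∈ Set.uIcc (-(1 / 2) : ℝ) (1 / 2) ×ˢ Set.uIcc (0 : ℝ) 1,
      HasFDerivAt f (fderiv ℝ f p) p ∧ HasFDerivAt g (fderiv ℝ g p) p ∧
      fderiv ℝ f p (1, 0) + fderiv ℝ g p (0, 1) = (Y - arc p.1) •
        (U' (shear Y p) 1 + V' (shear Y p) Complex.I) := fun p hp => by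
    obtain ⟨F', G', e1, e2, e3⟩ := exists_hasFDerivAt_flux hY (hin p hp).1 (hin p hp).2 hU hV
    rw [← e1.fderiv, ← e2.fderiv] at e3
    exact ⟨e1.differentiableAt.hasFDerivAt, e2.differentiableAt.hasFDerivAt, e3⟩
  have hsub : Set.Ioo (min (-(1 / 2) : ℝ) (1 / 2)) (max (-(1 / 2)) (1 / 2)) ×ˢ
      Set.Ioo (min (0 : ℝ) 1) (max 0 1) \ ∅ ⊆
      Set.uIcc (-(1 / 2) : ℝ) (1 / 2) ×ˢ Set.uIcc (0 : ℝ) 1 := fun p hp =>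
    ⟨Set.Ioo_subset_Icc_self hp.1.1, Set.Ioo_subset_Icc_self hp.1.2⟩
  have hcont : ContinuousOn (fun p : ℝ × ℝ => (Y - arc p.1) •
      (U' (shear Y p) 1 + V' (shear Y p) Complex.I))
      (Set.uIcc (-(1 / 2) : ℝ) (1 / 2) ×ˢ Set.uIcc (0 : ℝ) 1) := by
    refine ContinuousOn.smul (f := fun p : ℝ × ℝ => Y - arc p.1) ?_
      (hUV.comp (fun p hp => ?_) fun p hp => shear_mem hY (hin p hp).1 (hin p hp).2)
    · have : Continuous fun p : ℝ × ℝ => Y - arc p.1 :=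
        continuous_const.sub (continuous_arc.comp continuous_fst)
      exact this.continuousOn
    · obtain ⟨Φ, hΦ, -⟩ := exists_hasFDerivAt_shear (Y := Y) (hin p hp).1
      exact hΦ.continuousAt.continuousWithinAt
  have hdiv := integral2_divergence_prod_of_hasFDerivAt_off_countable f g (fderiv ℝ f) (fderiv ℝ g)
    (-(1 / 2)) 0 (1 / 2) 1 ∅ Set.countable_empty
    (fun p hp => (key p hp).1.continuousAt.continuousWithinAt)
    (fun p hp => (key p hp).2.1.continuousAt.continuousWithinAt)
    (fun p hp => (key p (hsub hp)).1) (fun p hp => (key p (hsub hp)).2.1)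
    ((hcont.integrableOn_compact (isCompact_uIcc.prod isCompact_uIcc)).congr_fun
      (fun p hp => ((key p hp).2.2).symm) (measurableSet_uIcc.prod measurableSet_uIcc))
  have hsubst : ∀ (b : ℝ) (F : ℝ → ℂ), ∫ s in (0 : ℝ)..1, (Y - b) • F (b + s * (Y - b)) =
      ∫ y in b..Y, F y := fun b F => by
    rw [intervalIntegral.integral_smul]
    have := intervalIntegral.smul_integral_comp_add_mul F (Y - b) b (a := 0) (b := 1)
    simp only [mul_comm _ (Y - b)]
    rw [this]
    simp
  have hl : ∫ x in (-(1 / 2) : ℝ)..(1 / 2), ∫ s in (0 : ℝ)..1,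
      (fderiv ℝ f (x, s) (1, 0) + fderiv ℝ g (x, s) (0, 1)) =
      ∫ x in (-(1 / 2) : ℝ)..(1 / 2), ∫ y in (arc x)..Y, (U' ⟨x, y⟩ 1 + V' ⟨x, y⟩ Complex.I) := by
    refine intervalIntegral.integral_congr fun x hx => ?_
    rw [← hsubst (arc x) fun y => U' ⟨x, y⟩ 1 + V' ⟨x, y⟩ Complex.I]
    exact intervalIntegral.integral_congr fun s hs => (key (x, s) ⟨hx, hs⟩).2.2
  rw [← hl, hdiv]
  have harc : arc (-2⁻¹) = arc 2⁻¹ := by simp [arc]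
  rw [← hsubst (arc (1 / 2)) fun y => U ⟨1 / 2, y⟩, ← hsubst (arc (1 / 2)) fun y => U ⟨-(1 / 2), y⟩]
  simp [hf, hg, shear, harc]

/-! ## Green's formula for invariant families on the fundamental domain -/

/-- The Wronskian of two functions in the direction `v`. -/
def wron (u w : ℂ → ℂ) (v z : ℂ) : ℂ := u z * fderiv ℝ w z v - w z * fderiv ℝ u z v

/-- The integrand of Green's formula. -/
def greenDensity (u w : ℂ → ℂ) (z : ℂ) : ℂ :=
  u z * Laplacian.laplacian w z - w z * Laplacian.laplacian u z

theorem continuousOn_laplacian {u : ℂ → ℂ} (hu : ContDiffOn ℝ 2 u upperSet) :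
    ContinuousOn (Laplacian.laplacian u) upperSet := by
  have h : ContinuousOn (fderiv ℝ (fderiv ℝ u)) upperSet :=
    (contDiffOn_fderiv hu).continuousOn_fderiv_of_isOpen isOpen_upperSet le_rfl
  refine (((h.clm_apply continuousOn_const).clm_apply continuousOn_const).add
    ((h.clm_apply continuousOn_const).clm_apply continuousOn_const)).congr fun z _ =>
      laplacian_eq_fderiv u z

section pair

variable {u w : ℂ → ℂ} (hu : ContDiffOn ℝ 2 u upperSet) (hw : ContDiffOn ℝ 2 w upperSet)

include hu hw

theorem exists_hasFDerivAt_wron (v : ℂ) : ∃ W' : ℂ → ℂ →L[ℝ] ℂ,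
    (∀ z ∈ upperSet, HasFDerivAt (wron u w v) (W' z) z) ∧
    ∀ z, W' z v = u z * fderiv ℝ (fderiv ℝ w) z v v - w z * fderiv ℝ (fderiv ℝ u) z v v := by
  have h : ∀ {g : ℂ → ℂ}, ContDiffOn ℝ 2 g upperSet → ∀ z ∈ upperSet,
      HasFDerivAt (fun z => fderiv ℝ g z v)
        ((ContinuousLinearMap.apply ℝ ℂ v).comp (fderiv ℝ (fderiv ℝ g) z)) z := fun hg z hz =>
    (ContinuousLinearMap.apply ℝ ℂ v).hasFDerivAt.comp z (hasFDerivAt_fderiv hg hz)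
  refine ⟨_, fun z hz => ((hasFDerivAt_of_contDiffOn hu hz).mul (h hw z hz)).sub
    ((hasFDerivAt_of_contDiffOn hw hz).mul (h hu z hz)), fun z => ?_⟩
  simp
  ring

theorem continuousOn_wron (v : ℂ) : ContinuousOn (wron u w v) upperSet := by
  obtain ⟨W', h, -⟩ := exists_hasFDerivAt_wron hu hw v
  exact fun z hz => (h z hz).continuousAt.continuousWithinAt

theorem continuousOn_greenDensity : ContinuousOn (greenDensity u w) upperSet :=
  (hu.continuousOn.mul (continuousOn_laplacian hw)).sub
    (hw.continuousOn.mul (continuousOn_laplacian hu))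

theorem green_pair {Y : ℝ} (hY : 0 < Y) :
    ∫ x in (-(1 / 2) : ℝ)..(1 / 2), ∫ y in (arc x)..Y, greenDensity u w ⟨x, y⟩ =
      (∫ x in (-(1 / 2) : ℝ)..(1 / 2), wron u w Complex.I ⟨x, Y⟩) -
      (∫ x in (-(1 / 2) : ℝ)..(1 / 2), (wron u w Complex.I ⟨x, arc x⟩ -
        (-x / arc x) • wron u w 1 ⟨x, arc x⟩)) +
      (∫ y in (arc (1 / 2))..Y, wron u w 1 ⟨1 / 2, y⟩) -
      ∫ y in (arc (1 / 2))..Y, wron u w 1 ⟨-(1 / 2), y⟩ := by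
  obtain ⟨U', h1, h1'⟩ := exists_hasFDerivAt_wron hu hw 1
  obtain ⟨V', h2, h2'⟩ := exists_hasFDerivAt_wron hu hw Complex.I
  have e : ∀ z, U' z 1 + V' z Complex.I = greenDensity u w z := fun z => by
    rw [h1', h2', greenDensity, laplacian_eq_fderiv, laplacian_eq_fderiv]
    ring
  have hc : ContinuousOn (fun z => U' z 1 + V' z Complex.I) upperSet :=
    (continuousOn_greenDensity hu hw).congr fun z _ => e z
  rw [← green_truncated hY h1 h2 hc]
  simp only [e]

end pair

section family

variable {ι : Type*} [Fintype ι] {u w : ι → ℂ → ℂ} (hu : ∀ c, ContDiffOn ℝ 2 (u c) upperSet)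
  (hw : ∀ c, ContDiffOn ℝ 2 (w c) upperSet) {π : Equiv.Perm ι}

omit [Fintype ι] in
theorem fderiv_translate {u : ι → ℂ → ℂ} (h : ∀ c, ∀ z ∈ upperSet, u c (z + 1) = u (π c) z) (c : ι)
    {z : ℂ} (hz : z ∈ upperSet) : fderiv ℝ (u c) (z + 1) = fderiv ℝ (u (π c)) z := by
  rw [← fderiv_comp_add_right]
  refine Filter.EventuallyEq.fderiv_eq ?_
  filter_upwards [isOpen_upperSet.mem_nhds hz] with w hw using h c w hw

/-- Translation by 1 carries the left side to the right one and permutes the members of the family,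
so the two sums agree although the individual integrals need not. -/
theorem sum_sides (huT : ∀ c, ∀ z ∈ upperSet, u c (z + 1) = u (π c) z)
    (hwT : ∀ c, ∀ z ∈ upperSet, w c (z + 1) = w (π c) z) {Y : ℝ} (hY : 0 < Y) :
    ∑ c, ∫ y in (arc (1 / 2))..Y, wron (u c) (w c) 1 ⟨1 / 2, y⟩ =
      ∑ c, ∫ y in (arc (1 / 2))..Y, wron (u c) (w c) 1 ⟨-(1 / 2), y⟩ := by
  rw [← Equiv.sum_comp π fun c => ∫ y in (arc (1 / 2))..Y, wron (u c) (w c) 1 ⟨-(1 / 2), y⟩]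
  refine Finset.sum_congr rfl fun c _ => intervalIntegral.integral_congr fun y hy => ?_
  have ha : 0 < arc (1 / 2) := arc_pos (by rw [abs_of_pos] <;> norm_num)
  have hy0 : 0 < y := (lt_min ha hY).trans_le hy.1
  have hz : (⟨-(1 / 2), y⟩ : ℂ) ∈ upperSet := hy0
  have e : (⟨1 / 2, y⟩ : ℂ) = ⟨-(1 / 2), y⟩ + 1 := by
    apply Complex.ext
    · simp; norm_num
    · simp
  simp only [wron]
  rw [e, huT c _ hz, hwT c _ hz, fderiv_translate huT c hz, fderiv_translate hwT c hz]

theorem ne_zero_of_mem_upperSet {z : ℂ} (hz : z ∈ upperSet) : z ≠ 0 := by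
  rintro rfl
  exact lt_irrefl (0 : ℝ) hz

theorem neg_inv_mem {z : ℂ} (hz : z ∈ upperSet) : -z⁻¹ ∈ upperSet := by
  have h0 := ne_zero_of_mem_upperSet hz
  change 0 < (-z⁻¹).im
  rw [Complex.neg_im, Complex.inv_im, neg_div, neg_neg]
  exact div_pos hz (Complex.normSq_pos.2 h0)

omit [Fintype ι] in
theorem fderiv_neg_inv {u : ι → ℂ → ℂ} (hu : ∀ c, ContDiffOn ℝ 2 (u c) upperSet)
    (h : ∀ c, ∀ z ∈ upperSet, u c (-z⁻¹) = u (π c) z)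
    (c : ι) {z : ℂ} (hz : z ∈ upperSet) (v : ℂ) :
    fderiv ℝ (u (π c)) z v = fderiv ℝ (u c) (-z⁻¹) (v / z ^ 2) := by
  have h0 := ne_zero_of_mem_upperSet hz
  have h1 : HasDerivAt (fun z : ℂ => -z⁻¹) ((z ^ 2)⁻¹) z := by
    simpa using (hasDerivAt_inv h0).fun_neg
  have h2 := (hasFDerivAt_of_contDiffOn (hu c) (neg_inv_mem hz)).comp z h1.complexToReal_fderiv
  have h3 : HasFDerivAt (u (π c)) _ z := h2.congr_of_eventuallyEq (by
    filter_upwards [isOpen_upperSet.mem_nhds hz] with w hw using (h c w hw).symm)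
  rw [h3.fderiv]
  simp [div_eq_inv_mul]

-- The flux through the unit arc is radial. The map z ↦ -1/z reflects the arc and reverses the
-- radial direction, so the sum over the permuted family equals its own negative.
include hu hw in
theorem sum_bottom (huS : ∀ c, ∀ z ∈ upperSet, u c (-z⁻¹) = u (π c) z)
    (hwS : ∀ c, ∀ z ∈ upperSet, w c (-z⁻¹) = w (π c) z) :
    ∑ c, ∫ x in (-(1 / 2) : ℝ)..(1 / 2), (wron (u c) (w c) Complex.I ⟨x, arc x⟩ -
        (-x / arc x) • wron (u c) (w c) 1 ⟨x, arc x⟩) = 0 := by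
  have hx1 : ∀ x ∈ Set.uIcc (-(1 / 2) : ℝ) (1 / 2), |x| < 1 := fun x hx => by
    rw [Set.uIcc_of_le (by norm_num)] at hx
    exact abs_lt.2 ⟨by linarith [hx.1], by linarith [hx.2]⟩
  have hrad : ∀ c, ∀ x ∈ Set.uIcc (-(1 / 2) : ℝ) (1 / 2),
      wron (u c) (w c) Complex.I ⟨x, arc x⟩ - (-x / arc x) • wron (u c) (w c) 1 ⟨x, arc x⟩ =
      (arc x)⁻¹ • wron (u c) (w c) ⟨x, arc x⟩ ⟨x, arc x⟩ := fun c x hx => by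
    have ha : (arc x : ℂ) ≠ 0 := by exact_mod_cast (arc_pos (hx1 x hx)).ne'
    have e : ∀ L : ℂ →L[ℝ] ℂ, L ⟨x, arc x⟩ = x * L 1 + arc x * L Complex.I := fun L => by
      have : (⟨x, arc x⟩ : ℂ) = x • (1 : ℂ) + arc x • Complex.I := by apply Complex.ext <;> simp
      rw [this, map_add, map_smul, map_smul]
      simp
    simp only [wron, e, Complex.real_smul]
    push_cast
    field_simp
    ring
  have hS : ∀ c, ∫ x in (-(1 / 2) : ℝ)..(1 / 2), (wron (u (π c)) (w (π c)) Complex.I ⟨x, arc x⟩ -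
        (-x / arc x) • wron (u (π c)) (w (π c)) 1 ⟨x, arc x⟩) =
      -∫ x in (-(1 / 2) : ℝ)..(1 / 2), (wron (u c) (w c) Complex.I ⟨x, arc x⟩ -
        (-x / arc x) • wron (u c) (w c) 1 ⟨x, arc x⟩) := fun c => by
    have hneg := intervalIntegral.integral_comp_neg (a := (-(1 / 2) : ℝ)) (b := 1 / 2)
      fun x => wron (u c) (w c) Complex.I ⟨x, arc x⟩ -
        (-x / arc x) • wron (u c) (w c) 1 ⟨x, arc x⟩
    rw [neg_neg] at hneg
    rw [← hneg, ← intervalIntegral.integral_neg]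
    refine intervalIntegral.integral_congr fun x hx => ?_
    have hx' : -x ∈ Set.uIcc (-(1 / 2) : ℝ) (1 / 2) := by
      rw [Set.uIcc_of_le (by norm_num)] at hx ⊢
      exact ⟨by linarith [hx.2], by linarith [hx.1]⟩
    have ea : arc (-x) = arc x := by simp [arc]
    have hz : (⟨x, arc x⟩ : ℂ) ∈ upperSet := arc_pos (hx1 x hx)
    have hsq : arc x ^ 2 = 1 - x ^ 2 := Real.sq_sqrt (one_sub_sq_pos (hx1 x hx)).le
    set z : ℂ := ⟨x, arc x⟩ with hzd
    have h0 := ne_zero_of_mem_upperSet hz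
    have hinv : -z⁻¹ = ⟨-x, arc (-x)⟩ := by
      rw [ea, inv_eq_of_mul_eq_one_right (b := -⟨-x, arc x⟩), neg_neg]
      apply Complex.ext
      · simp [hzd]; linear_combination hsq
      · simp [hzd]; ring
    -- The derivative z⁻² of the inversion sends the radial vector z to the inward radial vector at
    -- the image point -1/z.
    have hdir : z / z ^ 2 = -(-z⁻¹) := by field_simp
    have e1 := hrad (π c) x hx
    have e2 := hrad c (-x) hx'
    rw [e1, e2, ← hinv, ea, ← hzd, ← smul_neg]
    congr 1
    simp only [wron]
    rw [fderiv_neg_inv hu huS c hz, fderiv_neg_inv hw hwS c hz, hdir,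
      huS c z hz, hwS c z hz]
    simp only [map_neg]
    ring
  have h := Equiv.sum_comp π fun c => ∫ x in (-(1 / 2) : ℝ)..(1 / 2),
    (wron (u c) (w c) Complex.I ⟨x, arc x⟩ - (-x / arc x) • wron (u c) (w c) 1 ⟨x, arc x⟩)
  simp only [hS, Finset.sum_neg_distrib] at h
  exact self_eq_neg.1 h.symm

include hu hw in
theorem sum_green {πT πS : Equiv.Perm ι}
    (huT : ∀ c, ∀ z ∈ upperSet, u c (z + 1) = u (πT c) z)
    (hwT : ∀ c, ∀ z ∈ upperSet, w c (z + 1) = w (πT c) z)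
    (huS : ∀ c, ∀ z ∈ upperSet, u c (-z⁻¹) = u (πS c) z)
    (hwS : ∀ c, ∀ z ∈ upperSet, w c (-z⁻¹) = w (πS c) z) {Y : ℝ} (hY : 0 < Y) :
    ∑ c, ∫ x in (-(1 / 2) : ℝ)..(1 / 2), ∫ y in (arc x)..Y, greenDensity (u c) (w c) ⟨x, y⟩ =
      ∑ c, ∫ x in (-(1 / 2) : ℝ)..(1 / 2), wron (u c) (w c) Complex.I ⟨x, Y⟩ := by
  simp only [fun c => green_pair (hu c) (hw c) hY, Finset.sum_add_distrib, Finset.sum_sub_distrib]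
  rw [sum_bottom hu hw huS hwS, sum_sides huT hwT hY]
  ring

end family

/-! ## The limit of the truncated formula -/

theorem tendsto_average {T : ℝ → ℂ} {L : ℂ} (hT : Tendsto T atTop (nhds L))
    (hi : ∀ R : ℝ, 1 ≤ R → IntervalIntegrable T volume R (2 * R)) :
    Tendsto (fun R : ℝ => R⁻¹ • ∫ y in R..(2 * R), T y) atTop (nhds L) := by
  rw [Metric.tendsto_atTop] at hT ⊢
  intro δ hδ
  obtain ⟨A, hA⟩ := hT (δ / 2) (half_pos hδ)
  refine ⟨max A 1, fun R hR => ?_⟩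
  have hR1 : 1 ≤ R := (le_max_right _ _).trans hR
  have hR0 : 0 < R := by linarith
  have e : R⁻¹ • (∫ y in R..(2 * R), T y) - L = R⁻¹ • ∫ y in R..(2 * R), (T y - L) := by
    rw [intervalIntegral.integral_sub (hi R hR1) (by simp), intervalIntegral.integral_const,
      smul_sub, smul_smul]
    have : R⁻¹ * (2 * R - R) = 1 := by field_simp; ring
    rw [this, one_smul]
  have hb := intervalIntegral.norm_integral_le_of_norm_le_const (a := R) (b := 2 * R)
    (f := fun y => T y - L) (C := δ / 2) fun y hy => by
      rw [Set.uIoc_of_le (by linarith)] at hy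
      rw [← dist_eq_norm]
      exact (hA y ((le_max_left _ _).trans (hR.trans hy.1.le))).le
  rw [dist_eq_norm, e, norm_smul, norm_inv, Real.norm_of_nonneg hR0.le]
  rw [show 2 * R - R = R by ring, abs_of_pos hR0] at hb
  calc R⁻¹ * _ ≤ R⁻¹ * (δ / 2 * R) := by gcongr
    _ = δ / 2 := by field_simp
    _ < δ := half_lt_self hδ

theorem continuousOn_mk {V : ℂ → ℂ} (hV : ContinuousOn V upperSet) {s : Set (ℝ × ℝ)}
    (hs : ∀ p ∈ s, 0 < p.2) : ContinuousOn (fun p : ℝ × ℝ => V ⟨p.1, p.2⟩) s := by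
  refine hV.comp ?_ hs
  have e : (fun p : ℝ × ℝ => (⟨p.1, p.2⟩ : ℂ)) = fun p => (p.1 : ℂ) + p.2 * Complex.I := by
    ext p; apply Complex.ext <;> simp
  rw [e]
  fun_prop

theorem integrableOn_rect {V : ℂ → ℂ} (hV : ContinuousOn V upperSet) (a b : ℝ) {c d : ℝ}
    (hc : 0 < c) (hd : 0 < d) : IntegrableOn (fun p : ℝ × ℝ => V ⟨p.1, p.2⟩)
      (Set.uIoc a b ×ˢ Set.uIoc c d) := by
  refine IntegrableOn.mono_set (t := Set.uIcc a b ×ˢ Set.uIcc c d) ?_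
    (Set.prod_mono Set.uIoc_subset_uIcc Set.uIoc_subset_uIcc)
  exact (continuousOn_mk hV fun p hp => (lt_min hc hd).trans_le hp.2.1).integrableOn_compact
    (isCompact_uIcc.prod isCompact_uIcc)

theorem intervalIntegrable_horizontal {V : ℂ → ℂ} (hV : ContinuousOn V upperSet) {a b : ℝ}
    (hab : a ≤ b) {c d : ℝ} (hc : 0 < c) (hd : 0 < d) :
    IntervalIntegrable (fun y => ∫ x in a..b, V ⟨x, y⟩) volume c d := by
  have h := integrableOn_rect hV a b hc hd
  rw [IntegrableOn, Measure.volume_eq_prod, ← Measure.prod_restrict] at h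
  rw [intervalIntegrable_iff]
  refine h.integral_prod_right.congr (Eventually.of_forall fun y => ?_)
  simp only
  rw [intervalIntegral.integral_of_le hab, Set.uIoc_of_le hab]

/-- No bound on the derivative of u is available. Integrating over R ≤ y ≤ 2R moves it onto w and
leaves an interior integral and two boundary terms, all O(R^(1-ε)); dividing by R gives decay. -/
theorem tendsto_average_wron {u w : ℂ → ℂ} (hu : ContDiffOn ℝ 2 u upperSet)
    (hw : ContDiffOn ℝ 2 w upperSet) {ε C₁ C : ℝ} (hε : 0 < ε) (hC₁ : 0 ≤ C₁)
    (hub : ∀ z : ℂ, |z.re| ≤ 1 / 2 → 1 ≤ z.im → ‖u z‖ ≤ C₁ * z.im ^ (-ε))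
    (hwb : ∀ z : ℂ, |z.re| ≤ 1 / 2 → 1 ≤ z.im → ‖w z‖ ≤ C * z.im ∧ ‖fderiv ℝ w z‖ ≤ C) :
    Tendsto (fun R : ℝ => R⁻¹ • ∫ y in R..(2 * R), ∫ x in (-(1 / 2) : ℝ)..(1 / 2),
      wron u w Complex.I ⟨x, y⟩) atTop (nhds 0) := by
  have hcu := hu.continuousOn
  have hcw := hw.continuousOn
  have hbound : ∀ R : ℝ, 1 ≤ R → ‖R⁻¹ • ∫ y in R..(2 * R), ∫ x in (-(1 / 2) : ℝ)..(1 / 2),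
      wron u w Complex.I ⟨x, y⟩‖ ≤ 5 * (C₁ * C) * R ^ (-ε) := by
    intro R hR
    have hR0 : 0 < R := by linarith
    have hcW := continuousOn_wron hu hw Complex.I
    rw [← intervalIntegral_intervalIntegral_swap (F := fun x y => wron u w Complex.I ⟨x, y⟩)
      (integrableOn_rect hcW _ _ hR0 (by linarith))]
    have hinner : ∀ x ∈ Set.uIoc (-(1 / 2) : ℝ) (1 / 2),
        ‖∫ y in R..(2 * R), wron u w Complex.I ⟨x, y⟩‖ ≤ 5 * (C₁ * C) * R ^ (-ε) * R := by
      intro x hx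
      rw [Set.uIoc_of_le (by norm_num)] at hx
      have hx' : |x| ≤ 1 / 2 := abs_le.2 ⟨hx.1.le, hx.2⟩
      have hy : ∀ y ∈ Set.uIcc R (2 * R), R ≤ y ∧ y ≤ 2 * R := fun y hy => by
        rwa [Set.uIcc_of_le (by linarith)] at hy
      have hpos : ∀ y ∈ Set.uIcc R (2 * R), (⟨x, y⟩ : ℂ) ∈ upperSet := fun y hy' =>
        hR0.trans_le (hy y hy').1
      have hline : ContinuousOn (fun y : ℝ => (⟨x, y⟩ : ℂ)) (Set.uIcc R (2 * R)) := by
        have e : (fun y : ℝ => (⟨x, y⟩ : ℂ)) = fun y : ℝ => (x : ℂ) + y * Complex.I := by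
          ext y; apply Complex.ext <;> simp
        rw [e]; fun_prop
      have hub' : ∀ y, R ≤ y → ‖u ⟨x, y⟩‖ ≤ C₁ * R ^ (-ε) := fun y h => by
        refine (hub ⟨x, y⟩ hx' (hR.trans h)).trans ?_
        exact mul_le_mul_of_nonneg_left
          (Real.rpow_le_rpow_of_nonpos hR0 h (by linarith)) hC₁
      have hderiv : ∀ (g : ℂ → ℂ), ContDiffOn ℝ 2 g upperSet → ∀ y ∈ Set.uIcc R (2 * R),
          HasDerivAt (fun y : ℝ => g ⟨x, y⟩) (fderiv ℝ g ⟨x, y⟩ Complex.I) y :=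
        fun g hg y hy' => by
          have e : ∀ y : ℝ, (⟨x, y⟩ : ℂ) = x + y * Complex.I := fun y => by
            apply Complex.ext <;> simp
          have := hasDerivAt_line hg (p := x) (v := Complex.I) (t := y) (by
            rw [← e]; exact hpos y hy')
          simp only [← e] at this
          exact this
      have hI : ∀ (g : ℂ → ℂ), ContDiffOn ℝ 2 g upperSet →
          ContinuousOn (fun y : ℝ => fderiv ℝ g ⟨x, y⟩ Complex.I) (Set.uIcc R (2 * R)) :=
        fun g hg => (((contDiffOn_fderiv hg).continuousOn.comp hline hpos).clm_apply
          continuousOn_const)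
      have hu' := hcu.comp hline hpos
      have hw' := hcw.comp hline hpos
      -- Uses u w_y - w u_y = 2u w_y - (uw)_y. The constant 5 in the bound is 2 from the integral
      -- plus 2 and 1 from uw at 2R and R.
      have e1 : ∫ y in R..(2 * R), wron u w Complex.I ⟨x, y⟩ =
          (∫ y in R..(2 * R), 2 * (u ⟨x, y⟩ * fderiv ℝ w ⟨x, y⟩ Complex.I)) -
          (u ⟨x, 2 * R⟩ * w ⟨x, 2 * R⟩ - u ⟨x, R⟩ * w ⟨x, R⟩) := by
        have i1 : IntervalIntegrable (fun y : ℝ => fderiv ℝ u ⟨x, y⟩ Complex.I * w ⟨x, y⟩ +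
            u ⟨x, y⟩ * fderiv ℝ w ⟨x, y⟩ Complex.I) volume R (2 * R) :=
          ContinuousOn.intervalIntegrable (((hI u hu).mul hw').add (hu'.mul (hI w hw)))
        have i2 : IntervalIntegrable (fun y : ℝ => 2 * (u ⟨x, y⟩ *
            fderiv ℝ w ⟨x, y⟩ Complex.I)) volume R (2 * R) :=
          ContinuousOn.intervalIntegrable (continuousOn_const.mul (hu'.mul (hI w hw)))
        rw [← intervalIntegral.integral_eq_sub_of_hasDerivAt
          (fun y hy' => (hderiv u hu y hy').fun_mul (hderiv w hw y hy')) i1,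
          ← intervalIntegral.integral_sub i2 i1]
        refine intervalIntegral.integral_congr fun y _ => ?_
        simp only [wron]
        ring
      have b1 : ‖∫ y in R..(2 * R), 2 * (u ⟨x, y⟩ * fderiv ℝ w ⟨x, y⟩ Complex.I)‖ ≤
          2 * (C₁ * R ^ (-ε) * C) * R := by
        refine (intervalIntegral.norm_integral_le_of_norm_le_const
          (C := 2 * (C₁ * R ^ (-ε) * C)) fun y hy' => ?_).trans_eq ?_
        · rw [Set.uIoc_of_le (by linarith)] at hy'
          rw [norm_mul, norm_mul, Complex.norm_ofNat]
          have h2 : ‖fderiv ℝ w ⟨x, y⟩ Complex.I‖ ≤ C := by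
            have := (fderiv ℝ w ⟨x, y⟩).le_opNorm Complex.I
            rw [Complex.norm_I, mul_one] at this
            exact this.trans (hwb ⟨x, y⟩ hx' (hR.trans hy'.1.le)).2
          exact mul_le_mul_of_nonneg_left (mul_le_mul (hub' y hy'.1.le) h2 (norm_nonneg _)
            (by positivity)) (by norm_num)
        · rw [show 2 * R - R = R by ring, abs_of_pos hR0]
      have b2 : ‖u ⟨x, 2 * R⟩ * w ⟨x, 2 * R⟩‖ ≤ C₁ * R ^ (-ε) * (C * (2 * R)) := by
        rw [norm_mul]
        exact mul_le_mul (hub' _ (by linarith)) (hwb ⟨x, 2 * R⟩ hx' (by simp; linarith)).1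
          (norm_nonneg _) (by positivity)
      have b3 : ‖u ⟨x, R⟩ * w ⟨x, R⟩‖ ≤ C₁ * R ^ (-ε) * (C * R) := by
        rw [norm_mul]
        exact mul_le_mul (hub' _ le_rfl) (hwb ⟨x, R⟩ hx' hR).1 (norm_nonneg _) (by positivity)
      rw [e1]
      refine (norm_sub_le _ _).trans ?_
      have := norm_sub_le (u ⟨x, 2 * R⟩ * w ⟨x, 2 * R⟩) (u ⟨x, R⟩ * w ⟨x, R⟩)
      linarith
    have := intervalIntegral.norm_integral_le_of_norm_le_const hinner
    rw [norm_smul, norm_inv, Real.norm_of_nonneg hR0.le, inv_mul_le_iff₀ hR0]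
    refine this.trans_eq ?_
    norm_num
    ring
  have hlim : Tendsto (fun R : ℝ => 5 * (C₁ * C) * R ^ (-ε)) atTop (nhds 0) := by
    simpa using (tendsto_rpow_neg_atTop hε).const_mul (5 * (C₁ * C))
  exact squeeze_zero_norm' ((eventually_ge_atTop 1).mono hbound) hlim

theorem arc_le_iff {x y : ℝ} (hx : |x| < 1) : arc x ≤ y ↔ 0 < y ∧ 1 ≤ x ^ 2 + y ^ 2 := by
  constructor
  · intro h
    have hy := (arc_pos hx).trans_le h
    have := (Real.sqrt_le_left hy.le).1 h
    exact ⟨hy, by linarith⟩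
  · rintro ⟨hy, h⟩
    exact (Real.sqrt_le_left hy.le).2 (by linarith)

theorem setIntegral_fdCoords_truncated {F : ℝ × ℝ → ℂ} (hF : IntegrableOn F fdCoords) {Y : ℝ}
    (hY : 1 ≤ Y) : ∫ p in {p : ℝ × ℝ | p.2 ≤ Y}, F p ∂(volume.restrict fdCoords) =
      ∫ x in (-(1 / 2) : ℝ)..(1 / 2), ∫ y in (arc x)..Y, F (x, y) := by
  have hm : MeasurableSet {p : ℝ × ℝ | p.2 ≤ Y} := measurableSet_le measurable_snd measurable_const
  rw [Measure.restrict_restrict hm]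
  have hms := hm.inter measurableSet_fdCoords
  rw [← integral_indicator hms, Measure.volume_eq_prod, integral_prod _ (by
    rw [← Measure.volume_eq_prod]
    exact (hF.mono_set Set.inter_subset_right).integrable_indicator hms),
    intervalIntegral.integral_of_le (by norm_num), ← integral_Icc_eq_integral_Ioc,
    ← integral_indicator measurableSet_Icc]
  congr 1
  ext x
  by_cases hx : x ∈ Set.Icc (-(1 / 2) : ℝ) (1 / 2)
  · have hx1 : |x| < 1 := abs_lt.2 ⟨by linarith [hx.1], by linarith [hx.2]⟩
    have ha : arc x ≤ Y := by
      refine (Real.sqrt_le_one.2 ?_).trans hY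
      nlinarith
    rw [Set.indicator_of_mem hx, intervalIntegral.integral_of_le ha, ← integral_Icc_eq_integral_Ioc,
      ← integral_indicator measurableSet_Icc]
    congr 1
    ext y
    have : (x, y) ∈ {p : ℝ × ℝ | p.2 ≤ Y} ∩ fdCoords ↔ y ∈ Set.Icc (arc x) Y := by
      rw [Set.mem_Icc, arc_le_iff hx1]
      simp only [Set.mem_inter_iff, Set.mem_ofPred_eq, fdCoords]
      have := abs_le.2 hx
      tauto
    by_cases hy : y ∈ Set.Icc (arc x) Y
    · rw [Set.indicator_of_mem hy, Set.indicator_of_mem (this.2 hy)]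
    · rw [Set.indicator_of_notMem hy, Set.indicator_of_notMem (fun h => hy (this.1 h))]
  · rw [Set.indicator_of_notMem hx]
    refine integral_eq_zero_of_ae (Eventually.of_forall fun y => ?_)
    refine Set.indicator_of_notMem (fun h => hx ?_) _
    exact abs_le.1 h.2.2.2

theorem tendsto_truncated {F : ℝ × ℝ → ℂ} (hF : IntegrableOn F fdCoords) :
    Tendsto (fun Y : ℝ => ∫ x in (-(1 / 2) : ℝ)..(1 / 2), ∫ y in (arc x)..Y, F (x, y)) atTop
      (nhds (∫ p in fdCoords, F p)) := by
  have hc : AECover (volume.restrict fdCoords) atTop fun Y : ℝ => {p : ℝ × ℝ | p.2 ≤ Y} :=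
    ⟨Eventually.of_forall fun p => (eventually_ge_atTop p.2), fun Y =>
      measurableSet_le measurable_snd measurable_const⟩
  refine (hc.integral_tendsto_of_countably_generated hF).congr' ?_
  filter_upwards [eventually_ge_atTop 1] with Y hY using setIntegral_fdCoords_truncated hF hY

/-- The truncated integrals converge to the full ones, so the top-edge terms have a limit. That
limit equals the limit of their averages over [R, 2R], which is zero. -/
theorem sum_integral_greenDensity {ι : Type*} [Fintype ι] {u w : ι → ℂ → ℂ}
    (hu : ∀ c, ContDiffOn ℝ 2 (u c) upperSet) (hw : ∀ c, ContDiffOn ℝ 2 (w c) upperSet)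
    {πT πS : Equiv.Perm ι}
    (huT : ∀ c, ∀ z ∈ upperSet, u c (z + 1) = u (πT c) z)
    (hwT : ∀ c, ∀ z ∈ upperSet, w c (z + 1) = w (πT c) z)
    (huS : ∀ c, ∀ z ∈ upperSet, u c (-z⁻¹) = u (πS c) z)
    (hwS : ∀ c, ∀ z ∈ upperSet, w c (-z⁻¹) = w (πS c) z)
    (hub : ∀ c, ∃ ε C₁ : ℝ, 0 < ε ∧ 0 ≤ C₁ ∧
      ∀ z : ℂ, |z.re| ≤ 1 / 2 → 1 ≤ z.im → ‖u c z‖ ≤ C₁ * z.im ^ (-ε))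
    (hwb : ∀ c, ∃ C : ℝ,
      ∀ z : ℂ, |z.re| ≤ 1 / 2 → 1 ≤ z.im → ‖w c z‖ ≤ C * z.im ∧ ‖fderiv ℝ (w c) z‖ ≤ C)
    (hint : ∀ c, IntegrableOn (fun p : ℝ × ℝ => greenDensity (u c) (w c) ⟨p.1, p.2⟩) fdCoords) :
    ∑ c, ∫ p in fdCoords, greenDensity (u c) (w c) ⟨p.1, p.2⟩ = 0 := by
  have h1 := tendsto_finsetSum Finset.univ fun c _ => tendsto_truncated (hint c)
  have h2 : Tendsto (fun Y : ℝ => ∑ c, ∫ x in (-(1 / 2) : ℝ)..(1 / 2),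
      wron (u c) (w c) Complex.I ⟨x, Y⟩) atTop
      (nhds (∑ c, ∫ p in fdCoords, greenDensity (u c) (w c) ⟨p.1, p.2⟩)) := by
    refine h1.congr' ?_
    filter_upwards [eventually_gt_atTop 0] with Y hY using sum_green hu hw huT hwT huS hwS hY
  have hii : ∀ c, ∀ R : ℝ, 1 ≤ R → IntervalIntegrable (fun y => ∫ x in (-(1 / 2) : ℝ)..(1 / 2),
      wron (u c) (w c) Complex.I ⟨x, y⟩) volume R (2 * R) := fun c R hR =>
    intervalIntegrable_horizontal (continuousOn_wron (hu c) (hw c) _) (by norm_num)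
      (by linarith) (by linarith)
  have h3 := tendsto_average h2 fun R hR => by
    simpa only [Finset.sum_fn] using IntervalIntegrable.sum Finset.univ fun c _ => hii c R hR
  have h4 : Tendsto (fun R : ℝ => ∑ c, R⁻¹ • ∫ y in R..(2 * R), ∫ x in (-(1 / 2) : ℝ)..(1 / 2),
      wron (u c) (w c) Complex.I ⟨x, y⟩) atTop (nhds (∑ _c : ι, 0)) :=
    tendsto_finsetSum _ fun c _ => by
      obtain ⟨ε, C₁, hε, hC₁, hb⟩ := hub c
      obtain ⟨C, hb'⟩ := hwb c
      exact tendsto_average_wron (hu c) (hw c) hε hC₁ hb hb'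
  rw [Finset.sum_const_zero] at h4
  refine tendsto_nhds_unique (h3.congr' ?_) h4
  filter_upwards [eventually_ge_atTop 1] with R hR
  rw [intervalIntegral.integral_finsetSum fun c _ => hii c R hR, Finset.smul_sum]

/-! ## Self-adjointness of the Laplacian and the second identity -/

/-- The chosen representative of g⁻¹c and g⁻¹ times that of c differ by an element of Γ₀(N). Hence T
and S permute the translates of an invariant function, as the cancellation of the boundary terms
requires. -/
theorem IsInvariant.out_inv_smul {N : ℕ} {F : ℍ → ℂ} (hF : IsInvariant N F) (g : SL(2, ℤ))
    (c : SL(2, ℤ) ⧸ Gamma0 N) (z : ℍ) :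
    F (c.out⁻¹ • g • z) = F ((g⁻¹ • c).out⁻¹ • z) := by
  have h1 : ((g⁻¹ • c).out : SL(2, ℤ) ⧸ Gamma0 N) = ((g⁻¹ * c.out : SL(2, ℤ)) :
      SL(2, ℤ) ⧸ Gamma0 N) := by
    rw [QuotientGroup.out_eq']
    conv_lhs => rw [← QuotientGroup.out_eq' c]
    rfl
  have h2 := QuotientGroup.eq.1 h1.symm
  rw [← hF _ h2 ((g⁻¹ • c).out⁻¹ • z), smul_smul, smul_smul]
  congr 2
  group

theorem ofComplex_add_one {z : ℂ} (hz : z ∈ upperSet) :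
    ofComplex (z + 1) = ModularGroup.T • ofComplex z := by
  rw [← ofComplex_mobius _ hz]
  congr 1
  simp [mobius, ModularGroup.T]

theorem ofComplex_neg_inv {z : ℂ} (hz : z ∈ upperSet) :
    ofComplex (-z⁻¹) = ModularGroup.S • ofComplex z := by
  rw [← ofComplex_mobius _ hz]
  congr 1
  simp [mobius, ModularGroup.S, neg_div]

theorem mem_fd_of_one_le_im {z : ℂ} (h1 : |z.re| ≤ 1 / 2) (h2 : 1 ≤ z.im) :
    ofComplex z ∈ ModularGroup.fd ∧ (ofComplex z).im = z.im := by
  have h0 : 0 < z.im := by linarith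
  rw [ofComplex_apply_of_im_pos h0]
  refine ⟨⟨?_, h1⟩, rfl⟩
  change 1 ≤ Complex.normSq z
  rw [Complex.normSq_apply]
  nlinarith [mul_self_nonneg z.re]

/-- Self-adjointness of Ω on Γ₀(N)\ℍ. Green's formula is applied to the family, indexed by cosets,
of translates of f and of the theta function; one side of the pairing gives `lapWeight`, the other
the eigenvalue. -/
theorem lift_lapWeight {N : ℕ} (hN : 0 < N) {D : ℤ} (hD : D ≠ 0) (r : ℤ) (h : DiscGroup N 1)
    {α : ℂ} {f : ℍ → ℂ} (hf : IsMaassCuspForm N α f) (τ : ℍ) :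
    lift N D r (kernel N D 1 (lapWeight N (piDiv D * τ.im))) f h τ =
      α * lift N D r (kernel N D 1 fun _ _ => 1) f h τ := by
  have := finite_quotient hN
  have := Fintype.ofFinite (SL(2, ℤ) ⧸ Gamma0 N)
  have hfc := hf.continuous
  have hfd := hf.decaysAtCusps hN
  have hk : 0 < piDiv D * τ.im := mul_pos (piDiv_pos hD) τ.im_pos
  set k := piDiv D * τ.im with hkd
  obtain ⟨b, Cb, hb, hθ⟩ := exists_twistedTheta_eq_gSeries hN hD r h τ
  set Θ := twistedTheta N D r (kernel N D 1 fun _ _ => 1) h τ with hΘ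
  set Λ := twistedTheta N D r (kernel N D 1 (lapWeight N k)) h τ with hΛ
  have hΘi : IsInvariant N Θ := twistedTheta_one_invariant hN hD r h 1 τ
  set u : SL(2, ℤ) ⧸ Gamma0 N → ℂ → ℂ := fun c z => f (c.out⁻¹ • ofComplex z) with hu
  set w : SL(2, ℤ) ⧸ Gamma0 N → ℂ → ℂ := fun c => gSeries N k (c.out⁻¹)⁻¹ b fun _ => 1 with hw
  have hreg := fun c : SL(2, ℤ) ⧸ Gamma0 N => gaussian_series_regular hN hk (c.out⁻¹)⁻¹ hb
  have hcoe : ∀ z ∈ upperSet, ((ofComplex z : ℍ) : ℂ) = z := fun z hz => by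
    rw [ofComplex_apply_of_im_pos hz]
  have hwΘ : ∀ c, ∀ z ∈ upperSet, w c z = Θ (c.out⁻¹ • ofComplex z) := fun c z hz => by
    rw [(hθ c.out⁻¹ (ofComplex z)).1, hcoe z hz]
  have hwΛ : ∀ c : SL(2, ℤ) ⧸ Gamma0 N, ∀ z ∈ upperSet,
      gSeries N k (c.out⁻¹)⁻¹ b (gLap k) z = Λ (c.out⁻¹ • ofComplex z) := fun c z hz => by
    rw [(hθ c.out⁻¹ (ofComplex z)).2, hcoe z hz]
  have hT1 : ∀ z ∈ upperSet, z + 1 ∈ upperSet := fun z hz => by simpa [upperSet] using hz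
  have hi1 := integrableM_kernel hN hD r h 1 (isWeight_lapWeight N k) hfc hfd τ
  have hi2 := integrableM_kernel hN hD r h 1 (isWeight_const N 1) hfc hfd τ
  set F : ℍ → ℂ := fun z => f z * Λ z - α * (f z * Θ z) with hF
  have hFi : ∀ c : SL(2, ℤ) ⧸ Gamma0 N,
      IntegrableOn (fun z => F (c.out⁻¹ • z)) ModularGroup.fd := fun c =>
    (hi1 c).sub ((hi2 c).const_mul α)
  -- Both Euclidean Laplacians carry the factor y⁻², which is exactly the hyperbolic density, so
  -- Green's integrand is the invariant one.
  have hdens : ∀ c, ∀ p ∈ fdCoords, greenDensity (u c) (w c) ⟨p.1, p.2⟩ =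
      (1 / p.2 ^ 2) • F (c.out⁻¹ • ofComplex ⟨p.1, p.2⟩) := fun c p hp => by
    have hz : (⟨p.1, p.2⟩ : ℂ) ∈ upperSet := hp.1
    have e := (hf.translate c.out⁻¹).2 _ hz
    rw [greenDensity, (hreg c).2.1 _ hz, hwΛ c _ hz, hwΘ c _ hz]
    simp only [hu, hF]
    rw [e, Complex.real_smul, Complex.real_smul]
    push_cast
    ring
  have hsum := sum_integral_greenDensity (u := u) (w := w)
    (πT := MulAction.toPerm ModularGroup.T⁻¹) (πS := MulAction.toPerm ModularGroup.S⁻¹)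
    (fun c => (hf.translate c.out⁻¹).1) (fun c => (hreg c).1)
    (fun c z hz => by
      simp only [hu]
      rw [ofComplex_add_one hz, hf.invariant.out_inv_smul]; rfl)
    (fun c z hz => by
      rw [hwΘ _ _ (hT1 z hz), hwΘ _ _ hz, ofComplex_add_one hz, hΘi.out_inv_smul]; rfl)
    (fun c z hz => by
      simp only [hu]
      rw [ofComplex_neg_inv hz, hf.invariant.out_inv_smul]; rfl)
    (fun c z hz => by
      rw [hwΘ _ _ (neg_inv_mem hz), hwΘ _ _ hz, ofComplex_neg_inv hz, hΘi.out_inv_smul]; rfl)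
    (fun c => by
      obtain ⟨ε, C, hε, hC, hb⟩ := exists_decay_on_fd hfc hfd c.out⁻¹
      refine ⟨ε, C, hε, hC, fun z h1 h2 => ?_⟩
      obtain ⟨m1, m2⟩ := mem_fd_of_one_le_im h1 h2
      rw [← m2]
      exact hb _ m1)
    (fun c => by
      obtain ⟨C, -, hC⟩ := (hreg c).2.2 (1 / 2) one_pos
      exact ⟨C, fun z h1 h2 => ⟨(hC z h1 h2).1, (hC z h1 h2).2.2⟩⟩)
    (fun c => ((integrableOn_fd_iff _).1 (hFi c)).congr_fun (fun p hp => (hdens c p hp).symm)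
      measurableSet_fdCoords)
  have hint : ∀ c : SL(2, ℤ) ⧸ Gamma0 N,
      ∫ p in fdCoords, greenDensity (u c) (w c) ⟨p.1, p.2⟩ =
      (∫ z in ModularGroup.fd, f (c.out⁻¹ • z) * Λ (c.out⁻¹ • z)) -
        α * ∫ z in ModularGroup.fd, f (c.out⁻¹ • z) * Θ (c.out⁻¹ • z) := fun c => by
    rw [setIntegral_congr_fun measurableSet_fdCoords (hdens c),
      ← setIntegral_fd fun z => F (c.out⁻¹ • z), ← integral_const_mul,
      ← integral_sub (hi1 c) ((hi2 c).const_mul α)]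
  simp only [hint, Finset.sum_sub_distrib, ← Finset.mul_sum] at hsum
  simp only [TwistedLift.lift, integralM, finsum_eq_sum_of_fintype]
  exact sub_eq_zero.1 hsum

theorem xi_three_halves_liftKM_of_maass {N : ℕ} (hN : 0 < N) {D : ℤ} (hD : D ≠ 0) (r : ℤ) {α : ℂ}
    {f : ℍ → ℂ} (hf : IsMaassCuspForm N α f) (τ : ℍ) :
    xi (3 / 2) (liftKM N D r f) τ =
      (-(conj α / (4 * (Real.pi : ℂ)))) • liftMaass N D r (fun z => conj (f z)) τ := by
  ext h
  rw [xi_three_halves_liftKM r h hN hD hf.continuous (hf.decaysAtCusps hN) τ,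
    lift_lapWeight hN hD r h hf τ, map_mul, conj_lift_kernel r h 1 hN hD (isWeight_const N 1),
    Pi.smul_apply, liftMaass, lift_phiSiegel r h hN hD, smul_eq_mul]
  ring

end TwistedLift

end

theorem mainTheorem9 (N : ℕ) (hN : 0 < N) (D r : ℤ)
    (hD : TwistedLift.IsFundamentalDiscriminant D) (hr : D ≡ r ^ 2 [ZMOD 4 * (N : ℤ)]) :
    (∀ f : UpperHalfPlane → ℂ, Continuous f → TwistedLift.IsInvariant N f →
      TwistedLift.DecaysAtCusps f →
        TwistedLift.LiftConverges N D r (TwistedLift.phiSiegel N D) f ∧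
        TwistedLift.LiftConverges N D r (TwistedLift.phiKM N D) f ∧
        ∀ τ : UpperHalfPlane,
          TwistedLift.xi (1 / 2) (TwistedLift.liftMaass N D r f) τ
            = (-(Real.pi : ℂ)) •
              TwistedLift.liftKM N D r (fun z => (starRingEnd ℂ) (f z)) τ) ∧
    (∀ (α : ℂ) (f : UpperHalfPlane → ℂ), TwistedLift.IsMaassCuspForm N α f →
        TwistedLift.LiftConverges N D r (TwistedLift.phiSiegel N D) f ∧
        TwistedLift.LiftConverges N D r (TwistedLift.phiKM N D) f ∧
        ∀ τ : UpperHalfPlane,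
          TwistedLift.xi (1 / 2) (TwistedLift.liftMaass N D r f) τ
              = (-(Real.pi : ℂ)) •
                TwistedLift.liftKM N D r (fun z => (starRingEnd ℂ) (f z)) τ ∧
          TwistedLift.xi (3 / 2) (TwistedLift.liftKM N D r f) τ
              = (-((starRingEnd ℂ) α / (4 * (Real.pi : ℂ)))) •
                TwistedLift.liftMaass N D r (fun z => (starRingEnd ℂ) (f z)) τ) := by
  have hD0 := hD.ne_zero
  refine ⟨fun f hf _ hd => ⟨TwistedLift.liftConverges_phiSiegel r hN hD0 hf hd,
    TwistedLift.liftConverges_phiKM r hN hD0 hf hd,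
    fun τ => TwistedLift.xi_half_liftMaass r hN hD0 hf hd τ⟩, fun α f hf => ?_⟩
  have hc := hf.continuous
  have hd := hf.decaysAtCusps hN
  exact ⟨TwistedLift.liftConverges_phiSiegel r hN hD0 hc hd,
    TwistedLift.liftConverges_phiKM r hN hD0 hc hd,
    fun τ => ⟨TwistedLift.xi_half_liftMaass r hN hD0 hc hd τ,
      TwistedLift.xi_three_halves_liftKM_of_maass hN hD0 r hf τ⟩⟩
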